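/- Let $u(x,y,t)$ be a real-valued function of $x,t\in\mathbb R$, $y\ge 0$, which is $C^\infty$ up to the boundary on $\{y\ge 0\}$ and satisfies the wave equation $u_{tt}-u_{xx}-u_{yy}=0$ in $\{y\ge 0\}$ and the boundary condition $u|_{y=0}=0$. Let $y_0>0$ and $x_0,t_0\in\mathbb R$. For $c,\varepsilon>0$ put \[ D(z)=z\sqrt{\frac{c}{c+2z}}\quad(z\ge 0),\qquad U=\Big\{(x,t)\in\mathbb R^2:\ |x-x_0|\le D\big(\sqrt{y_0^2-(t-t_0)^2}\big)+\varepsilon,\ |t-t_0|\le y_0\Big\}, \] and for $h>0$, $x\in\mathbb R$, $|t|\le y_0$, \[ K_h(x,y_0,t)=\frac{1}{2\pi^{3/2}\sqrt h}\,\mathrm{Re}\left[\frac{1}{\sqrt{c+ix}}\int_0^{\pi/2}\exp\left(-\frac{\big(x+i\sqrt{y_0^2-t^2}\,\sin s\big)^2}{4h(c+ix)}\right)ds\right], \] where the square root of $c+ix$ is the one with positive real part. Then for all $c,\varepsilon>0$ the function $(x,t)\mapsto K_h(x-x_0,y_0,t-t_0)\,\frac{\partial u}{\partial y}(x,0,t)$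 is integrable over $U$ for every $h>0$, and \[ u(x_0,y_0,t_0)=\lim_{h\to 0+}\int_U K_h(x-x_0,y_0,t-t_0)\,\frac{\partial u}{\partial y}(x,0,t)\,dx\,dt . \] Moreover, the set $U$ can be made arbitrarily thin in the $x$-direction: for every $\delta>0$ there is $\eta>0$ such that for all $c,\varepsilon\in(0,\eta)$ one has $U\subset\{(x,t): |x-x_0|\le\delta,\ |t-t_0|\le y_0\}$. -/

import Mathlib

open Real Set Filter Topology MeasureTheory
open scoped ContDiff

noncomputable section

namespace WaveCauchy

/-- The closed half-space `{y ≥ 0}`; points are written `(x, y, t)`. -/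
def halfSpace : Set (ℝ × ℝ × ℝ) := {p | 0 ≤ p.2.1}

/-- `u` is smooth up to the boundary on `{y ≥ 0}`, solves `u_tt - u_xx - u_yy = 0` there, and vanishes
for `y = 0`. Values of `u` for `y < 0` are irrelevant: derivatives in `y` are taken within `[0, ∞)`. -/
structure IsWaveSolution (u : ℝ → ℝ → ℝ → ℝ) : Prop where
  smooth : ContDiffOn ℝ ∞ (fun p : ℝ × ℝ × ℝ => u p.1 p.2.1 p.2.2) halfSpace
  wave : ∀ x y t : ℝ, 0 ≤ y →
    iteratedDeriv 2 (fun τ => u x y τ) t - iteratedDeriv 2 (fun ξ => u ξ y t) x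
      - iteratedDerivWithin 2 (fun η => u x η t) (Ici 0) y = 0
  boundary : ∀ x t : ℝ, u x 0 t = 0

/-- The boundary datum `∂u/∂y (x, 0, t)`. -/
def normalDeriv (u : ℝ → ℝ → ℝ → ℝ) (x t : ℝ) : ℝ :=
  derivWithin (fun η => u x η t) (Ici 0) 0

/-- `D(z) = z √(c / (c + 2z))`. -/
def D (c z : ℝ) : ℝ := z * √(c / (c + 2 * z))

/-- The set `U` of boundary points `(x, t)` on which data are used. -/
def U (c ε x₀ y₀ t₀ : ℝ) : Set (ℝ × ℝ) :=
  {p | |p.1 - x₀| ≤ D c (√(y₀ ^ 2 - (p.2 - t₀) ^ 2)) + ε ∧ |p.2 - t₀| ≤ y₀}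

/-- The square root of `c + i x` given by the principal branch. -/
def sqrtC (c x : ℝ) : ℂ := ((c : ℂ) + Complex.I * x) ^ (1 / 2 : ℂ)

/-- `sqrtC c x` is a square root of `c + i x`. -/
theorem sqrtC_sq (c x : ℝ) : sqrtC c x ^ 2 = (c : ℂ) + Complex.I * x := by
  unfold sqrtC
  simp

/-- `sqrtC c x` is the square root with positive real part. -/
theorem sqrtC_re_pos {c : ℝ} (hc : 0 < c) (x : ℝ) : 0 < (sqrtC c x).re := by
  have hne : (c : ℂ) + Complex.I * x ≠ 0 := by
    intro h
    have := congrArg Complex.re h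
    simp at this
    exact hc.ne' this
  unfold sqrtC
  rw [Complex.cpow_def_of_ne_zero hne, Complex.exp_re]
  apply mul_pos (Real.exp_pos _)
  have him : (Complex.log ((c : ℂ) + Complex.I * x) * (1 / 2)).im
      = Complex.arg ((c : ℂ) + Complex.I * x) / 2 := by
    rw [← Complex.log_im, ← Complex.div_ofNat_im]
    congr 1
    ring
  rw [him]
  have h1 := Complex.neg_pi_lt_arg ((c : ℂ) + Complex.I * x)
  have h2 := Complex.abs_arg_lt_pi_div_two_iff (z := (c : ℂ) + Complex.I * x)
  have h3 := abs_lt.mp (h2.mpr (Or.inl (by simpa using hc)))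
  apply Real.cos_pos_of_mem_Ioo
  constructor <;> linarith [h3.1, h3.2, Real.pi_pos]

/-- The regularization kernel `K_h(x, y₀, t)` (with parameter `c`). -/
def K (c h x y₀ t : ℝ) : ℝ :=
  1 / (2 * π ^ (3 / 2 : ℝ) * √h) *
    (1 / sqrtC c x *
      ∫ s in (0 : ℝ)..(π / 2),
        Complex.exp (-(1 / (4 * (h : ℂ) * ((c : ℂ) + Complex.I * x))) *
          ((x : ℂ) + Complex.I * ((√(y₀ ^ 2 - t ^ 2) * Real.sin s : ℝ) : ℂ)) ^ 2)).re

end WaveCauchy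

end

/-! For ρ² = ξ² + η², the wave e^{iξx} cos(ρt) sin(ηy)/η vanishes on y = 0, has normal derivative
e^{iξx} cos(ρt) there, and takes the value sin(ηy₀)/η at (0, y₀, 0). At the complex point x = -iσ
the factor e^{iξx} becomes e^{ξσ}, and the integral of e^{ξσ} cos(ρt) over σ = √(y₀² - t²) sin s,
|s| ≤ π/2, |t| ≤ y₀, is 2π sin(ηy₀)/η (`poisson_identity`). So u is a mean of its data continued to
complex x. The data are only smooth; the kernel replaces evaluation at -iσ by integration against a
Gaussian of width of order √h centred there. The denominator c + ix makes this Gaussian decay on the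
real axis as soon as |x| > D(σ) (`re_kern_exponent`), and D(σ) tends to 0 with c. Hence only the
thin set U matters in the limit (`abs_K_le_of_far`).

Convergence on single modes is not enough: a bound uniform in the frequency is needed. Applied to
e^{iξx}, the kernel gives, up to normalisation and an exponentially small error, e^{κσ - chκ²} with
κ = (√(1 + 4hξ) - 1)/(2h), which tends to ξ (`modal_integral_approx`). For ξ ≥ 0 one has 0 ≤ κ ≤ ξ,
so when ξ < ρ Poisson's formula bounds the half-disc mean of e^{κσ} cos(ρt) independently of the
frequency, although e^{κσ} alone is exponentially large (`abs_halfMean_le`). For ξ ≤ 0 a shift of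
contour into the lower half-plane gives the bound (`modal_integral_bound`). The real part in K
averages ξ and -ξ, so two half-discs combine into the full one. With `modal_bound` and
`tendsto_modal`, dominated convergence settles superpositions of plane waves with integrable
amplitude.

A general u is reduced to such superpositions. Its odd reflection in y is a smooth solution on the
whole space (`HalfSol.contDiff_oddExt`). As K and U are even in t - t₀, only the time-even part of
the data contributes, and within a cone it is determined by the values at time t₀ through finite
speed of propagation (`WaveGrad.eq_zero`). Cutting off these values and taking the Fourier transform
yields plane waves whose time-even part has the right normal derivative on U
(`exists_planeWaves_rep`). -/

noncomputable section
namespace WaveCauchy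

/-! ### Odd reflection of solutions across the boundary -/

/-- Reflection across the plane `y = 0`. -/
def reflY : ℝ × ℝ × ℝ →L[ℝ] ℝ × ℝ × ℝ :=
  (ContinuousLinearMap.fst ℝ ℝ (ℝ × ℝ)).prod
    ((-(ContinuousLinearMap.fst ℝ ℝ ℝ).comp (ContinuousLinearMap.snd ℝ ℝ (ℝ × ℝ))).prod
      ((ContinuousLinearMap.snd ℝ ℝ ℝ).comp (ContinuousLinearMap.snd ℝ ℝ (ℝ × ℝ))))

@[simp] theorem reflY_apply (p : ℝ × ℝ × ℝ) : reflY p = (p.1, -p.2.1, p.2.2) := rfl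

/-- The unit vectors in the directions `x`, `y`, `t`. -/
def ex : ℝ × ℝ × ℝ := (1, 0, 0)
/-- The unit vector in the direction `y`. -/
def ey : ℝ × ℝ × ℝ := (0, 1, 0)
/-- The unit vector in the direction `t`. -/
def et : ℝ × ℝ × ℝ := (0, 0, 1)

/-- The linear form with coefficients `a`, `b`, `c`. -/
def linForm (a b c : ℝ) : ℝ × ℝ × ℝ →L[ℝ] ℝ :=
  a • ContinuousLinearMap.fst ℝ ℝ (ℝ × ℝ) +
  b • (ContinuousLinearMap.fst ℝ ℝ ℝ).comp (ContinuousLinearMap.snd ℝ ℝ (ℝ × ℝ)) +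
  c • (ContinuousLinearMap.snd ℝ ℝ ℝ).comp (ContinuousLinearMap.snd ℝ ℝ (ℝ × ℝ))

@[simp] theorem linForm_apply (a b c : ℝ) (p : ℝ × ℝ × ℝ) :
    linForm a b c p = a * p.1 + b * p.2.1 + c * p.2.2 := rfl

theorem eq_linForm (L : ℝ × ℝ × ℝ →L[ℝ] ℝ) : L = linForm (L ex) (L ey) (L et) := by
  have h : ∀ p : ℝ × ℝ × ℝ, p = p.1 • ex + p.2.1 • ey + p.2.2 • et := by
    intro p
    ext <;> simp [ex, ey, et]
  refine ContinuousLinearMap.ext fun p => ?_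
  conv_lhs => rw [h p]
  simp only [map_add, map_smul, linForm_apply, smul_eq_mul]
  ring

/-- The directional derivative within the half-space. -/
def derivHalf (e : ℝ × ℝ × ℝ) (f : ℝ × ℝ × ℝ → ℝ) (p : ℝ × ℝ × ℝ) : ℝ :=
  fderivWithin ℝ f halfSpace p e

/-- The directional derivative. -/
def pd (e : ℝ × ℝ × ℝ) (f : ℝ × ℝ × ℝ → ℝ) (p : ℝ × ℝ × ℝ) : ℝ := fderiv ℝ f p e

/-- The odd extension in `y` of a function on the half-space. -/
def oddExt (f : ℝ × ℝ × ℝ → ℝ) (p : ℝ × ℝ × ℝ) : ℝ :=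
  if 0 ≤ p.2.1 then f p else -f (reflY p)

/-- The even extension in `y` of a function on the half-space. -/
def evenExt (f : ℝ × ℝ × ℝ → ℝ) (p : ℝ × ℝ × ℝ) : ℝ :=
  if 0 ≤ p.2.1 then f p else f (reflY p)

/-! ### Derivatives within the closed half-space -/

theorem convex_halfSpace : Convex ℝ halfSpace := by
  intro p hp q hq a b ha hb _
  simp only [halfSpace, mem_ofPred_eq] at *
  simp only [Prod.snd_add, Prod.smul_snd, Prod.fst_add, Prod.smul_fst, smul_eq_mul]
  positivity

theorem mem_nhds_halfSpace {p : ℝ × ℝ × ℝ} (hp : 0 < p.2.1) : halfSpace ∈ 𝓝 p := by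
  have : IsOpen {q : ℝ × ℝ × ℝ | 0 < q.2.1} := isOpen_lt continuous_const (by fun_prop)
  exact mem_of_superset (this.mem_nhds hp) fun q (hq : 0 < q.2.1) => hq.le

theorem interior_halfSpace_nonempty : (interior halfSpace).Nonempty :=
  ⟨(0, 1, 0), mem_interior_iff_mem_nhds.2 (mem_nhds_halfSpace (by norm_num))⟩

theorem uniqueDiffOn_halfSpace : UniqueDiffOn ℝ halfSpace :=
  uniqueDiffOn_convex convex_halfSpace interior_halfSpace_nonempty

theorem halfSpace_subset_closure_interior : halfSpace ⊆ closure (interior halfSpace) := by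
  rw [convex_halfSpace.closure_interior_eq_closure_of_nonempty_interior
    interior_halfSpace_nonempty]
  exact subset_closure

theorem contDiffOn_derivHalf {f : ℝ × ℝ × ℝ → ℝ} (hf : ContDiffOn ℝ ∞ f halfSpace)
    (e : ℝ × ℝ × ℝ) : ContDiffOn ℝ ∞ (derivHalf e f) halfSpace :=
  (hf.fderivWithin uniqueDiffOn_halfSpace (by simp)).clm_apply contDiffOn_const

/-- Symmetry of the second derivative persists on the boundary plane because every boundary point is
a limit of interior points. -/
theorem derivHalf_comm {f : ℝ × ℝ × ℝ → ℝ} (hf : ContDiffOn ℝ ∞ f halfSpace)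
    (a b : ℝ × ℝ × ℝ) {p : ℝ × ℝ × ℝ} (hp : p ∈ halfSpace) :
    derivHalf a (derivHalf b f) p = derivHalf b (derivHalf a f) p := by
  have h2 : ∀ a b : ℝ × ℝ × ℝ, derivHalf a (derivHalf b f) p =
      fderivWithin ℝ (fderivWithin ℝ f halfSpace) halfSpace p a b := by
    intro a b
    have hd : DifferentiableWithinAt ℝ (fderivWithin ℝ f halfSpace) halfSpace p :=
      ((hf.fderivWithin uniqueDiffOn_halfSpace (m := ∞) (by simp)).differentiableOn (by simp)) p hp
    unfold derivHalf
    rw [fderivWithin_clm_apply (uniqueDiffOn_halfSpace p hp) hd (by fun_prop)]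
    simp
  rw [h2, h2]
  exact ContDiffWithinAt.isSymmSndFDerivWithinAt (n := ∞) (hf p hp)
    (by simp only [minSmoothness_of_isRCLikeNormedField]; exact WithTop.coe_le_coe.2 le_top)
    uniqueDiffOn_halfSpace (halfSpace_subset_closure_interior hp) hp a b

theorem derivHalf_congr {f g : ℝ × ℝ × ℝ → ℝ} (h : EqOn f g halfSpace) (e : ℝ × ℝ × ℝ) :
    EqOn (derivHalf e f) (derivHalf e g) halfSpace := by
  intro p hp
  unfold derivHalf
  rw [fderivWithin_congr h (h hp)]

theorem hasFDerivWithinAt_halfSpace {f : ℝ × ℝ × ℝ → ℝ} (hf : ContDiffOn ℝ ∞ f halfSpace)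
    {p : ℝ × ℝ × ℝ} (hp : p ∈ halfSpace) :
    HasFDerivWithinAt f (linForm (derivHalf ex f p) (derivHalf ey f p) (derivHalf et f p))
      halfSpace p := by
  have := ((hf.differentiableOn (by simp)) p hp).hasFDerivWithinAt
  rwa [eq_linForm (fderivWithin ℝ f halfSpace p)] at this

theorem hasDerivAt_line {f : ℝ × ℝ × ℝ → ℝ} (hf : ContDiffOn ℝ ∞ f halfSpace)
    {p e : ℝ × ℝ × ℝ} (hp : p ∈ halfSpace) (he : e.2.1 = 0) :
    HasDerivAt (fun s : ℝ => f (p + s • e)) (derivHalf e f p) 0 := by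
  have h1 := ((hf.differentiableOn (by simp)) p hp).hasFDerivWithinAt
  have h2 : HasDerivAt (fun s : ℝ => p + s • e) e 0 := by
    have := ((hasDerivAt_id (0 : ℝ)).smul_const e).const_add p
    rwa [one_smul] at this
  have h3 := HasFDerivWithinAt.comp_hasDerivWithinAt (x := (0 : ℝ))
    (f := fun s : ℝ => p + s • e) (s := univ) (t := halfSpace)
    (by simpa using h1) h2.hasDerivWithinAt (by
      intro s _
      have : 0 ≤ p.2.1 := hp
      simpa [halfSpace, he] using this)
  exact h3.hasDerivAt univ_mem

theorem derivHalf_eq_zero_of_boundary {f : ℝ × ℝ × ℝ → ℝ} (hf : ContDiffOn ℝ ∞ f halfSpace)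
    (h0 : ∀ p : ℝ × ℝ × ℝ, p.2.1 = 0 → f p = 0) {e : ℝ × ℝ × ℝ} (he : e.2.1 = 0)
    {p : ℝ × ℝ × ℝ} (hp : p.2.1 = 0) : derivHalf e f p = 0 := by
  have h := hasDerivAt_line hf (p := p) (by simp [halfSpace, hp]) he
  have hz : (fun s : ℝ => f (p + s • e)) = fun _ => 0 := by
    funext s
    exact h0 _ (by simp [he, hp])
  rw [hz] at h
  exact h.unique (hasDerivAt_const _ _)

theorem reflY_mem {p : ℝ × ℝ × ℝ} (hp : p.2.1 ≤ 0) : reflY p ∈ halfSpace := by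
  simpa [halfSpace] using hp

/-- The two closed half-spaces cover the space, so equal one-sided derivatives at a point of the
plane glue to a full derivative. -/
theorem hasFDerivAt_of_half_derivs {F : ℝ × ℝ × ℝ → ℝ} {L : ℝ × ℝ × ℝ →L[ℝ] ℝ} {p : ℝ × ℝ × ℝ}
    (h1 : 0 ≤ p.2.1 → HasFDerivWithinAt F L halfSpace p)
    (h2 : p.2.1 ≤ 0 → HasFDerivWithinAt F L {q | q.2.1 ≤ 0} p) : HasFDerivAt F L p := by
  rcases lt_trichotomy p.2.1 0 with h | h | h
  · refine (h2 h.le).hasFDerivAt ?_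
    have : IsOpen {q : ℝ × ℝ × ℝ | q.2.1 < 0} := isOpen_lt (by fun_prop) continuous_const
    exact mem_of_superset (this.mem_nhds h) fun q (hq : q.2.1 < 0) => hq.le
  · have := (h1 h.ge).union (h2 h.le)
    rw [← hasFDerivWithinAt_univ]
    refine this.mono fun q _ => ?_
    exact le_total 0 q.2.1
  · exact (h1 h.le).hasFDerivAt (mem_nhds_halfSpace h)

theorem hasFDerivWithinAt_comp_reflY {f : ℝ × ℝ × ℝ → ℝ} (hf : ContDiffOn ℝ ∞ f halfSpace)
    {p : ℝ × ℝ × ℝ} (hp : p.2.1 ≤ 0) :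
    HasFDerivWithinAt (fun q => f (reflY q)) (linForm (derivHalf ex f (reflY p))
      (-derivHalf ey f (reflY p)) (derivHalf et f (reflY p))) {q | q.2.1 ≤ 0} p := by
  have h := (hasFDerivWithinAt_halfSpace hf (reflY_mem hp)).comp p
    (reflY.hasFDerivWithinAt (s := {q | q.2.1 ≤ 0})) (fun q hq => reflY_mem hq)
  have e : (linForm (derivHalf ex f (reflY p)) (derivHalf ey f (reflY p))
      (derivHalf et f (reflY p))).comp reflY = linForm (derivHalf ex f (reflY p))
      (-derivHalf ey f (reflY p)) (derivHalf et f (reflY p)) :=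
    ContinuousLinearMap.ext fun q => by simp
  rw [← e]
  exact h

theorem oddExt_of_nonneg (f : ℝ × ℝ × ℝ → ℝ) {p : ℝ × ℝ × ℝ} (hp : 0 ≤ p.2.1) :
    oddExt f p = f p := if_pos hp

theorem evenExt_of_nonneg (f : ℝ × ℝ × ℝ → ℝ) {p : ℝ × ℝ × ℝ} (hp : 0 ≤ p.2.1) :
    evenExt f p = f p := if_pos hp

theorem evenExt_of_nonpos (f : ℝ × ℝ × ℝ → ℝ) {p : ℝ × ℝ × ℝ} (hp : p.2.1 ≤ 0) :
    evenExt f p = f (reflY p) := by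
  rcases hp.lt_or_eq with h | h
  · exact if_neg (not_le.2 h)
  · rw [evenExt_of_nonneg f h.ge]
    congr 1
    ext <;> simp [h]

theorem oddExt_of_nonpos {f : ℝ × ℝ × ℝ → ℝ} (h0 : ∀ p : ℝ × ℝ × ℝ, p.2.1 = 0 → f p = 0)
    {p : ℝ × ℝ × ℝ} (hp : p.2.1 ≤ 0) : oddExt f p = -f (reflY p) := by
  rcases hp.lt_or_eq with h | h
  · exact if_neg (not_le.2 h)
  · rw [oddExt_of_nonneg f h.ge, h0 p h, h0 _ (by simp [h]), neg_zero]

/-- Reflection keeps the parity of tangential derivatives and flips that of the normal one. The two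
sides match on the plane because the tangential derivatives of f vanish there. -/
theorem hasFDerivAt_oddExt {f : ℝ × ℝ × ℝ → ℝ} (hf : ContDiffOn ℝ ∞ f halfSpace)
    (h0 : ∀ p : ℝ × ℝ × ℝ, p.2.1 = 0 → f p = 0) (p : ℝ × ℝ × ℝ) :
    HasFDerivAt (oddExt f) (linForm (oddExt (derivHalf ex f) p) (evenExt (derivHalf ey f) p)
      (oddExt (derivHalf et f) p)) p := by
  refine hasFDerivAt_of_half_derivs (fun hp => ?_) (fun hp => ?_)
  · rw [oddExt_of_nonneg _ hp, evenExt_of_nonneg _ hp, oddExt_of_nonneg _ hp]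
    exact (hasFDerivWithinAt_halfSpace hf hp).congr (fun q hq => oddExt_of_nonneg f hq)
      (oddExt_of_nonneg f hp)
  · rw [oddExt_of_nonpos (fun q hq => derivHalf_eq_zero_of_boundary hf h0 (by rfl) hq) hp,
      evenExt_of_nonpos _ hp,
      oddExt_of_nonpos (fun q hq => derivHalf_eq_zero_of_boundary hf h0 (by rfl) hq) hp]
    have h := (hasFDerivWithinAt_comp_reflY hf hp).neg.congr
      (fun q hq => oddExt_of_nonpos h0 hq) (oddExt_of_nonpos h0 hp)
    have e : -linForm (derivHalf ex f (reflY p)) (-derivHalf ey f (reflY p))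
        (derivHalf et f (reflY p)) = linForm (-derivHalf ex f (reflY p))
        (derivHalf ey f (reflY p)) (-derivHalf et f (reflY p)) :=
      ContinuousLinearMap.ext fun q => by
        simp only [neg_apply, linForm_apply]
        ring
    rw [← e]
    exact h

theorem hasFDerivAt_evenExt {f : ℝ × ℝ × ℝ → ℝ} (hf : ContDiffOn ℝ ∞ f halfSpace)
    (h0 : ∀ p : ℝ × ℝ × ℝ, p.2.1 = 0 → derivHalf ey f p = 0) (p : ℝ × ℝ × ℝ) :
    HasFDerivAt (evenExt f) (linForm (evenExt (derivHalf ex f) p) (oddExt (derivHalf ey f) p)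
      (evenExt (derivHalf et f) p)) p := by
  refine hasFDerivAt_of_half_derivs (fun hp => ?_) (fun hp => ?_)
  · rw [oddExt_of_nonneg _ hp, evenExt_of_nonneg _ hp, evenExt_of_nonneg _ hp]
    exact (hasFDerivWithinAt_halfSpace hf hp).congr (fun q hq => evenExt_of_nonneg f hq)
      (evenExt_of_nonneg f hp)
  · rw [oddExt_of_nonpos h0 hp, evenExt_of_nonpos _ hp, evenExt_of_nonpos _ hp]
    exact (hasFDerivWithinAt_comp_reflY hf hp).congr
      (fun q hq => evenExt_of_nonpos f hq) (evenExt_of_nonpos f hp)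

/-- Solutions on the half-space with Dirichlet condition, in terms of derivatives within it. -/
structure HalfSol (f : ℝ × ℝ × ℝ → ℝ) : Prop where
  smooth : ContDiffOn ℝ ∞ f halfSpace
  boundary : ∀ p : ℝ × ℝ × ℝ, p.2.1 = 0 → f p = 0
  wave : ∀ p ∈ halfSpace, derivHalf et (derivHalf et f) p =
    derivHalf ex (derivHalf ex f) p + derivHalf ey (derivHalf ey f) p

theorem HalfSol.derivHalf {f : ℝ × ℝ × ℝ → ℝ} (hf : HalfSol f) {e : ℝ × ℝ × ℝ}
    (he : e.2.1 = 0) : HalfSol (derivHalf e f) where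
  smooth := contDiffOn_derivHalf hf.smooth e
  boundary := fun _ hp => derivHalf_eq_zero_of_boundary hf.smooth hf.boundary he hp
  wave := by
    intro p hp
    have hc : ∀ a : ℝ × ℝ × ℝ, WaveCauchy.derivHalf a (WaveCauchy.derivHalf a
        (WaveCauchy.derivHalf e f)) p = WaveCauchy.derivHalf e (WaveCauchy.derivHalf a
        (WaveCauchy.derivHalf a f)) p := by
      intro a
      rw [derivHalf_congr (fun q hq => derivHalf_comm hf.smooth a e hq) a hp,
        derivHalf_comm (contDiffOn_derivHalf hf.smooth a) a e hp]
    rw [hc, hc, hc, derivHalf_congr (fun q hq => hf.wave q hq) e hp]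
    have h1 := (contDiffOn_derivHalf (contDiffOn_derivHalf hf.smooth ex) ex).differentiableOn
      (by simp) p hp
    have h2 := (contDiffOn_derivHalf (contDiffOn_derivHalf hf.smooth ey) ey).differentiableOn
      (by simp) p hp
    change fderivWithin ℝ (WaveCauchy.derivHalf ex (WaveCauchy.derivHalf ex f) +
      WaveCauchy.derivHalf ey (WaveCauchy.derivHalf ey f)) halfSpace p e = _
    rw [fderivWithin_add (uniqueDiffOn_halfSpace p hp) h1 h2]
    rfl

/-- On the plane f_yy = f_tt - f_xx, and both terms are tangential derivatives of a function
vanishing there. This is the compatibility condition that makes the even extension of f_y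
differentiable. -/
theorem HalfSol.derivHalf_yy_boundary {f : ℝ × ℝ × ℝ → ℝ} (hf : HalfSol f) {p : ℝ × ℝ × ℝ}
    (hp : p.2.1 = 0) : WaveCauchy.derivHalf ey (WaveCauchy.derivHalf ey f) p = 0 := by
  have h := hf.wave p (by simp [halfSpace, hp])
  have h1 := derivHalf_eq_zero_of_boundary (hf.derivHalf (e := et) rfl).smooth
    (hf.derivHalf (e := et) rfl).boundary (e := et) rfl hp
  have h2 := derivHalf_eq_zero_of_boundary (hf.derivHalf (e := ex) rfl).smooth
    (hf.derivHalf (e := ex) rfl).boundary (e := ex) rfl hp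
  linarith

theorem contDiff_linForm {E : Type*} [NormedAddCommGroup E] [NormedSpace ℝ E] {n : ℕ∞ω}
    {a b c : E → ℝ} (ha : ContDiff ℝ n a) (hb : ContDiff ℝ n b) (hc : ContDiff ℝ n c) :
    ContDiff ℝ n fun p => linForm (a p) (b p) (c p) := by
  unfold linForm
  exact ((ha.smul contDiff_const).add (hb.smul contDiff_const)).add (hc.smul contDiff_const)

theorem oddExt_add_on {f g h : ℝ × ℝ × ℝ → ℝ} (hfgh : ∀ p ∈ halfSpace, f p = g p + h p)
    (p : ℝ × ℝ × ℝ) : oddExt f p = oddExt g p + oddExt h p := by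
  unfold oddExt
  split_ifs with hp
  · exact hfgh p hp
  · rw [hfgh _ (reflY_mem (not_le.1 hp).le)]
    ring

/-- The two claims need each other: the y-derivative of the odd extension of f is the even extension
of f_y, and the y-derivative of the latter is the odd extension of f_yy = f_tt - f_xx. Tangential
derivatives of f are again Dirichlet solutions, so the induction closes without looking at higher
normal derivatives. -/
theorem HalfSol.contDiff_ext_nat (n : ℕ) : ∀ {f : ℝ × ℝ × ℝ → ℝ}, HalfSol f →
    ContDiff ℝ n (oddExt f) ∧ ContDiff ℝ n (evenExt (WaveCauchy.derivHalf ey f)) := by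
  induction n with
  | zero =>
    intro f hf
    constructor
    · refine contDiff_zero.2 (continuous_iff_continuousAt.2 fun p => ?_)
      exact (hasFDerivAt_oddExt hf.smooth hf.boundary p).continuousAt
    · refine contDiff_zero.2 (continuous_iff_continuousAt.2 fun p => ?_)
      exact (hasFDerivAt_evenExt (contDiffOn_derivHalf hf.smooth ey)
        (fun q hq => hf.derivHalf_yy_boundary hq) p).continuousAt
  | succ n ih =>
    intro f hf
    have hx := hf.derivHalf (e := ex) rfl
    have ht := hf.derivHalf (e := et) rfl
    have hsw : ∀ e : ℝ × ℝ × ℝ, evenExt (WaveCauchy.derivHalf e (WaveCauchy.derivHalf ey f)) =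
        evenExt (WaveCauchy.derivHalf ey (WaveCauchy.derivHalf e f)) := by
      intro e
      funext p
      unfold evenExt
      split_ifs with hp
      · exact derivHalf_comm hf.smooth _ _ hp
      · exact derivHalf_comm hf.smooth _ _ (reflY_mem (not_le.1 hp).le)
    constructor
    · refine (contDiff_succ_iff_hasFDerivAt (n := n)).2 ⟨_, ?_, hasFDerivAt_oddExt hf.smooth hf.boundary⟩
      exact contDiff_linForm (ih hx).1 (ih hf).2 (ih ht).1
    · refine (contDiff_succ_iff_hasFDerivAt (n := n)).2 ⟨_, ?_, hasFDerivAt_evenExt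
        (contDiffOn_derivHalf hf.smooth ey) (fun q hq => hf.derivHalf_yy_boundary hq)⟩
      refine contDiff_linForm ?_ ?_ ?_
      · rw [hsw]; exact (ih hx).2
      · have hw : oddExt (WaveCauchy.derivHalf ey (WaveCauchy.derivHalf ey f)) = fun p =>
            oddExt (WaveCauchy.derivHalf et (WaveCauchy.derivHalf et f)) p -
            oddExt (WaveCauchy.derivHalf ex (WaveCauchy.derivHalf ex f)) p := by
          funext p
          rw [oddExt_add_on hf.wave p]
          ring
        rw [hw]
        exact (ih (ht.derivHalf rfl)).1.sub (ih (hx.derivHalf rfl)).1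
      · rw [hsw]; exact (ih ht).2

theorem HalfSol.contDiff_oddExt {f : ℝ × ℝ × ℝ → ℝ} (hf : HalfSol f) :
    ContDiff ℝ ∞ (oddExt f) :=
  contDiff_infty.2 fun n => (hf.contDiff_ext_nat n).1

theorem oddExt_reflY {f : ℝ × ℝ × ℝ → ℝ} (h0 : ∀ p : ℝ × ℝ × ℝ, p.2.1 = 0 → f p = 0)
    (p : ℝ × ℝ × ℝ) : oddExt f (reflY p) = -oddExt f p := by
  rcases le_total 0 p.2.1 with hp | hp
  · rw [oddExt_of_nonpos h0 (p := reflY p) (by simpa using hp), oddExt_of_nonneg f hp]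
    simp
  · rw [oddExt_of_nonneg f (reflY_mem hp), oddExt_of_nonpos h0 hp, neg_neg]

theorem HalfSol.wave_oddExt {f : ℝ × ℝ × ℝ → ℝ} (hf : HalfSol f) (p : ℝ × ℝ × ℝ) :
    pd et (pd et (oddExt f)) p = pd ex (pd ex (oddExt f)) p + pd ey (pd ey (oddExt f)) p := by
  have h1 : ∀ {g : ℝ × ℝ × ℝ → ℝ}, HalfSol g → pd et (oddExt g) = oddExt (WaveCauchy.derivHalf et g) ∧
      pd ex (oddExt g) = oddExt (WaveCauchy.derivHalf ex g) ∧
      pd ey (oddExt g) = evenExt (WaveCauchy.derivHalf ey g) := by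
    intro g hg
    refine ⟨funext fun q => ?_, funext fun q => ?_, funext fun q => ?_⟩ <;>
    · unfold pd
      rw [(hasFDerivAt_oddExt hg.smooth hg.boundary q).fderiv]
      simp [ex, ey, et]
  have h2 : pd ey (evenExt (WaveCauchy.derivHalf ey f)) p =
      oddExt (WaveCauchy.derivHalf ey (WaveCauchy.derivHalf ey f)) p := by
    unfold pd
    rw [(hasFDerivAt_evenExt (contDiffOn_derivHalf hf.smooth ey)
      (fun q hq => hf.derivHalf_yy_boundary hq) p).fderiv]
    simp [ey]
  rw [(h1 hf).1, (h1 hf).2.1, (h1 hf).2.2, (h1 (hf.derivHalf (e := et) rfl)).1,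
    (h1 (hf.derivHalf (e := ex) rfl)).2.1, h2]
  exact oddExt_add_on hf.wave p

/-! ### From one-variable derivatives of u to derivatives within the half-space -/

theorem hasDerivAt_x {f : ℝ × ℝ × ℝ → ℝ} (hf : ContDiffOn ℝ ∞ f halfSpace) (x : ℝ) {y : ℝ}
    (hy : 0 ≤ y) (t : ℝ) : HasDerivAt (fun s => f (s, y, t)) (derivHalf ex f (x, y, t)) x := by
  have h := hasDerivAt_line hf (p := (x, y, t)) (e := ex) hy rfl
  rw [← sub_self x] at h
  have h2 := h.comp_sub_const x x
  simpa [ex] using h2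

theorem hasDerivAt_t {f : ℝ × ℝ × ℝ → ℝ} (hf : ContDiffOn ℝ ∞ f halfSpace) (x : ℝ) {y : ℝ}
    (hy : 0 ≤ y) (t : ℝ) : HasDerivAt (fun s => f (x, y, s)) (derivHalf et f (x, y, t)) t := by
  have h := hasDerivAt_line hf (p := (x, y, t)) (e := et) hy rfl
  rw [← sub_self t] at h
  have h2 := h.comp_sub_const t t
  simpa [et] using h2

theorem hasDerivWithinAt_y {f : ℝ × ℝ × ℝ → ℝ} (hf : ContDiffOn ℝ ∞ f halfSpace) (x : ℝ) {y : ℝ}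
    (hy : 0 ≤ y) (t : ℝ) :
    HasDerivWithinAt (fun s => f (x, s, t)) (derivHalf ey f (x, y, t)) (Ici 0) y := by
  have h1 := ((hf.differentiableOn (by simp)) (x, y, t) hy).hasFDerivWithinAt
  have h2 : HasDerivAt (fun s : ℝ => (x, s, t)) ey y :=
    (hasDerivAt_const y x).prodMk ((hasDerivAt_id y).prodMk (hasDerivAt_const y t))
  exact h1.comp_hasDerivWithinAt (s := Ici 0) (t := halfSpace) y h2.hasDerivWithinAt
    fun s hs => hs

theorem IsWaveSolution.halfSol {u : ℝ → ℝ → ℝ → ℝ} (hu : IsWaveSolution u) :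
    HalfSol fun p => u p.1 p.2.1 p.2.2 where
  smooth := hu.smooth
  boundary := fun p hp => by rw [hp]; exact hu.boundary _ _
  wave := by
    rintro ⟨x, y, t⟩ (hy : 0 ≤ y)
    have hs := hu.smooth
    have h := hu.wave x y t hy
    have e1 : iteratedDeriv 2 (fun τ => u x y τ) t = WaveCauchy.derivHalf et
        (WaveCauchy.derivHalf et fun p => u p.1 p.2.1 p.2.2) (x, y, t) := by
      rw [iteratedDeriv_succ, iteratedDeriv_one,
        funext fun τ => (hasDerivAt_t hs x hy τ).deriv]
      exact (hasDerivAt_t (contDiffOn_derivHalf hs et) x hy t).deriv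
    have e2 : iteratedDeriv 2 (fun ξ => u ξ y t) x = WaveCauchy.derivHalf ex
        (WaveCauchy.derivHalf ex fun p => u p.1 p.2.1 p.2.2) (x, y, t) := by
      rw [iteratedDeriv_succ, iteratedDeriv_one,
        funext fun ξ => (hasDerivAt_x hs ξ hy t).deriv]
      exact (hasDerivAt_x (contDiffOn_derivHalf hs ex) x hy t).deriv
    have e3 : iteratedDerivWithin 2 (fun η => u x η t) (Ici 0) y = WaveCauchy.derivHalf ey
        (WaveCauchy.derivHalf ey fun p => u p.1 p.2.1 p.2.2) (x, y, t) := by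
      have hc : EqOn (iteratedDerivWithin 1 (fun η => u x η t) (Ici 0)) (fun η =>
          WaveCauchy.derivHalf ey (fun p => u p.1 p.2.1 p.2.2) (x, η, t)) (Ici 0) := by
        intro η hη
        rw [iteratedDerivWithin_one]
        exact (hasDerivWithinAt_y hs x hη t).derivWithin (uniqueDiffOn_Ici 0 η hη)
      rw [iteratedDerivWithin_succ, derivWithin_congr hc (hc hy)]
      exact (hasDerivWithinAt_y (contDiffOn_derivHalf hs ey) x hy t).derivWithin
        (uniqueDiffOn_Ici 0 y hy)
    rw [e1, e2, e3] at h
    linarith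

theorem IsWaveSolution.normalDeriv_eq {u : ℝ → ℝ → ℝ → ℝ} (hu : IsWaveSolution u) (x t : ℝ) :
    normalDeriv u x t = pd ey (oddExt fun p => u p.1 p.2.1 p.2.2) (x, 0, t) := by
  unfold normalDeriv pd
  rw [(hasFDerivAt_oddExt hu.halfSol.smooth hu.halfSol.boundary _).fderiv,
    (hasDerivWithinAt_y hu.smooth x le_rfl t).derivWithin (uniqueDiffOn_Ici 0 0 self_mem_Ici)]
  simp [ey, evenExt]

/-! ### The energy estimate -/

/-- The partial derivatives `dx, dy, dt` of a solution of the wave equation, with their first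
derivatives; the derivative of `dt` in `t` is `dxx + dyy`. -/
structure WaveGrad (dx dy dt dxx dyy dxt dyt : ℝ → ℝ → ℝ → ℝ) : Prop where
  cx : Continuous fun p : ℝ × ℝ × ℝ => dx p.1 p.2.1 p.2.2
  cy : Continuous fun p : ℝ × ℝ × ℝ => dy p.1 p.2.1 p.2.2
  ct : Continuous fun p : ℝ × ℝ × ℝ => dt p.1 p.2.1 p.2.2
  cxx : Continuous fun p : ℝ × ℝ × ℝ => dxx p.1 p.2.1 p.2.2
  cyy : Continuous fun p : ℝ × ℝ × ℝ => dyy p.1 p.2.1 p.2.2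
  cxt : Continuous fun p : ℝ × ℝ × ℝ => dxt p.1 p.2.1 p.2.2
  cyt : Continuous fun p : ℝ × ℝ × ℝ => dyt p.1 p.2.1 p.2.2
  x_x : ∀ x y t, HasDerivAt (fun s => dx s y t) (dxx x y t) x
  y_y : ∀ x y t, HasDerivAt (fun s => dy x s t) (dyy x y t) y
  x_t : ∀ x y t, HasDerivAt (fun s => dx x y s) (dxt x y t) t
  t_x : ∀ x y t, HasDerivAt (fun s => dt s y t) (dxt x y t) x
  y_t : ∀ x y t, HasDerivAt (fun s => dy x y s) (dyt x y t) t
  t_y : ∀ x y t, HasDerivAt (fun s => dt x s t) (dyt x y t) y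
  t_t : ∀ x y t, HasDerivAt (fun s => dt x y s) (dxx x y t + dyy x y t) t

theorem WaveGrad.sub {dx dy dt dxx dyy dxt dyt ex ey et exx eyy ext eyt : ℝ → ℝ → ℝ → ℝ}
    (h : WaveGrad dx dy dt dxx dyy dxt dyt) (k : WaveGrad ex ey et exx eyy ext eyt) :
    WaveGrad (dx - ex) (dy - ey) (dt - et) (dxx - exx) (dyy - eyy) (dxt - ext) (dyt - eyt) where
  cx := h.cx.sub k.cx
  cy := h.cy.sub k.cy
  ct := h.ct.sub k.ct
  cxx := h.cxx.sub k.cxx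
  cyy := h.cyy.sub k.cyy
  cxt := h.cxt.sub k.cxt
  cyt := h.cyt.sub k.cyt
  x_x x y t := (h.x_x x y t).sub (k.x_x x y t)
  y_y x y t := (h.y_y x y t).sub (k.y_y x y t)
  x_t x y t := (h.x_t x y t).sub (k.x_t x y t)
  t_x x y t := (h.t_x x y t).sub (k.t_x x y t)
  y_t x y t := (h.y_t x y t).sub (k.y_t x y t)
  t_y x y t := (h.t_y x y t).sub (k.t_y x y t)
  t_t x y t := by
    refine ((h.t_t x y t).sub (k.t_t x y t)).congr_deriv ?_
    simp only [Pi.sub_apply]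
    ring

/-- The squared positive part serves as weight in the energy estimate: it is C¹ and vanishes outside
the cone, so the energy can be integrated over a fixed box without boundary terms. -/
theorem hasDerivAt_max_sq (s : ℝ) :
    HasDerivAt (fun s : ℝ => max s 0 ^ 2) (2 * max s 0) s := by
  rcases lt_trichotomy s 0 with h | h | h
  · have : (fun s : ℝ => max s 0 ^ 2) =ᶠ[𝓝 s] fun _ => 0 := by
      filter_upwards [Iio_mem_nhds h] with r hr
      simp [max_eq_right (le_of_lt (mem_Iio.1 hr))]
    rw [max_eq_right h.le, mul_zero]
    exact (hasDerivAt_const s (0 : ℝ)).congr_of_eventuallyEq this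
  · subst h
    simp only [max_self, mul_zero]
    rw [hasDerivAt_iff_isLittleO_nhds_zero]
    refine Asymptotics.IsBigO.trans_isLittleO (g := fun h : ℝ => h ^ 2) ?_
      (Asymptotics.isLittleO_pow_id one_lt_two)
    refine Asymptotics.IsBigO.of_bound 1 (Eventually.of_forall fun h => ?_)
    simp only [zero_add, max_self, smul_zero, sub_zero, norm_eq_abs, abs_pow, one_mul, ne_eq,
      OfNat.ofNat_ne_zero, not_false_eq_true, zero_pow]
    refine pow_le_pow_left₀ (abs_nonneg _) ?_ 2
    rw [abs_of_nonneg (le_max_right _ _)]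
    exact max_le (le_abs_self _) (abs_nonneg _)
  · have : (fun s : ℝ => max s 0 ^ 2) =ᶠ[𝓝 s] fun s => s ^ 2 := by
      filter_upwards [Ioi_mem_nhds h] with r hr
      simp [max_eq_left (le_of_lt (mem_Ioi.1 hr))]
    rw [max_eq_left h.le]
    simpa using (hasDerivAt_pow 2 s).congr_of_eventuallyEq this

theorem intervalIntegral_swap_of_continuous {E : Type*} [NormedAddCommGroup E] [NormedSpace ℝ E]
    {f : ℝ → ℝ → E} (hf : Continuous (Function.uncurry f)) (a b c d : ℝ) :
    ∫ x in a..b, ∫ y in c..d, f x y = ∫ y in c..d, ∫ x in a..b, f x y := by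
  apply intervalIntegral_intervalIntegral_swap
  exact (hf.continuousOn.integrableOn_compact (isCompact_uIcc.prod isCompact_uIcc)).mono_set
    (prod_mono uIoc_subset_uIcc uIoc_subset_uIcc)

theorem eq_zero_of_integral_le_zero {f : ℝ → ℝ → ℝ} (hf : Continuous (Function.uncurry f))
    (h0 : ∀ x y, 0 ≤ f x y) {a b c d : ℝ} (hab : a < b) (hcd : c < d)
    (hI : ∫ x in a..b, ∫ y in c..d, f x y ≤ 0) {x y : ℝ} (hx : x ∈ Icc a b) (hy : y ∈ Icc c d) :
    f x y = 0 := by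
  by_contra hne
  have hpos : 0 < f x y := lt_of_le_of_ne (h0 x y) (Ne.symm hne)
  have h1 : 0 < ∫ y in c..d, f x y := intervalIntegral.integral_pos hcd
    (by fun_prop) (fun z _ => h0 x z) ⟨y, hy, hpos⟩
  have h2 : 0 < ∫ x in a..b, ∫ y in c..d, f x y := intervalIntegral.integral_pos hab
    (intervalIntegral.continuous_parametric_intervalIntegral_of_continuous' hf _ _).continuousOn
    (fun z _ => intervalIntegral.integral_nonneg hcd.le fun w _ => h0 z w) ⟨x, hx, h1⟩
  linarith

/-- Cauchy–Schwarz followed by 2kc·v ≤ k²c² + v². In the cone, with k = R - t, it says that the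
energy flux never exceeds the energy density. -/
theorem energy_flux_le {k x y a b c : ℝ} (hk : 0 ≤ k) (hxy : x ^ 2 + y ^ 2 ≤ k ^ 2) :
    2 * c * (x * a + y * b) ≤ k * (a ^ 2 + b ^ 2 + c ^ 2) := by
  rcases hk.eq_or_lt with h | h
  · subst h
    have hx : x = 0 := by nlinarith
    have hy : y = 0 := by nlinarith
    simp [hx, hy]
  · have : k * (2 * c * (x * a + y * b)) ≤ k * (k * (a ^ 2 + b ^ 2 + c ^ 2)) := by
      nlinarith [sq_nonneg (k * c - (x * a + y * b)), sq_nonneg (x * b - y * a),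
        mul_nonneg (sub_nonneg.2 hxy) (add_nonneg (sq_nonneg a) (sq_nonneg b))]
    exact le_of_mul_le_mul_left this h

/-- Integral over a box of the divergence of a field vanishing on the lateral boundary. -/
theorem integral_time_eq_of_divergence {F G P Ft Gx Py : ℝ → ℝ → ℝ → ℝ} {R T : ℝ}
    (hFt : Continuous fun p : ℝ × ℝ × ℝ => Ft p.1 p.2.1 p.2.2)
    (hGx : Continuous fun p : ℝ × ℝ × ℝ => Gx p.1 p.2.1 p.2.2)
    (hPy : Continuous fun p : ℝ × ℝ × ℝ => Py p.1 p.2.1 p.2.2)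
    (hF : Continuous fun p : ℝ × ℝ × ℝ => F p.1 p.2.1 p.2.2)
    (dF : ∀ x y t, HasDerivAt (fun s => F x y s) (Ft x y t) t)
    (dG : ∀ x y t, HasDerivAt (fun s => G s y t) (Gx x y t) x)
    (dP : ∀ x y t, HasDerivAt (fun s => P x s t) (Py x y t) y)
    (hT : 0 ≤ T) (hR : 0 ≤ R)
    (bG : ∀ y t, t ∈ Icc 0 T → G R y t = 0 ∧ G (-R) y t = 0)
    (bP : ∀ x t, t ∈ Icc 0 T → P x R t = 0 ∧ P x (-R) t = 0)
    (hle : ∀ x y t, t ∈ Icc 0 T → Ft x y t ≤ Gx x y t + Py x y t) :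
    ∫ x in -R..R, ∫ y in -R..R, F x y T ≤ ∫ x in -R..R, ∫ y in -R..R, F x y 0 := by
  -- The time difference of the energy is the space-time integral of `Ft`; it is at most the
  -- integral of a divergence whose lateral boundary terms vanish.
  have e1 : ∫ t in (0 : ℝ)..T, ∫ x in -R..R, ∫ y in -R..R, Ft x y t =
      (∫ x in -R..R, ∫ y in -R..R, F x y T) - ∫ x in -R..R, ∫ y in -R..R, F x y 0 := by
    rw [intervalIntegral_swap_of_continuous (f := fun t x => ∫ y in -R..R, Ft x y t),
      ← intervalIntegral.integral_sub]
    · refine intervalIntegral.integral_congr fun x _ => ?_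
      rw [intervalIntegral_swap_of_continuous (f := fun t y => Ft x y t) (by
        exact hFt.comp (g := fun p : ℝ × ℝ × ℝ => Ft p.1 p.2.1 p.2.2)
          (f := fun p : ℝ × ℝ => (x, p.2, p.1)) (by fun_prop)),
        ← intervalIntegral.integral_sub]
      · refine intervalIntegral.integral_congr fun y _ => ?_
        exact intervalIntegral.integral_eq_sub_of_hasDerivAt (fun t _ => dF x y t)
          (Continuous.intervalIntegrable (hFt.comp (g := fun p : ℝ × ℝ × ℝ => Ft p.1 p.2.1 p.2.2)
          (f := fun t : ℝ => (x, y, t)) (by fun_prop)) _ _)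
      · exact Continuous.intervalIntegrable (hF.comp (g := fun p : ℝ × ℝ × ℝ => F p.1 p.2.1 p.2.2)
          (f := fun y : ℝ => (x, y, T)) (by fun_prop)) _ _
      · exact Continuous.intervalIntegrable (hF.comp (g := fun p : ℝ × ℝ × ℝ => F p.1 p.2.1 p.2.2)
          (f := fun y : ℝ => (x, y, (0 : ℝ))) (by fun_prop)) _ _
    · refine Continuous.intervalIntegrable
        (intervalIntegral.continuous_parametric_intervalIntegral_of_continuous' ?_ _ _) _ _
      exact hF.comp (g := fun p : ℝ × ℝ × ℝ => F p.1 p.2.1 p.2.2)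
          (f := fun p : ℝ × ℝ => (p.1, p.2, T)) (by fun_prop)
    · refine Continuous.intervalIntegrable
        (intervalIntegral.continuous_parametric_intervalIntegral_of_continuous' ?_ _ _) _ _
      exact hF.comp (g := fun p : ℝ × ℝ × ℝ => F p.1 p.2.1 p.2.2)
          (f := fun p : ℝ × ℝ => (p.1, p.2, (0 : ℝ))) (by fun_prop)
    · refine intervalIntegral.continuous_parametric_intervalIntegral_of_continuous'
        (f := fun (p : ℝ × ℝ) y => Ft p.2 y p.1) ?_ _ _
      exact hFt.comp (g := fun p : ℝ × ℝ × ℝ => Ft p.1 p.2.1 p.2.2)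
          (f := fun p : (ℝ × ℝ) × ℝ => (p.1.2, p.2, p.1.1)) (by fun_prop)
  have c2 : ∀ {H : ℝ → ℝ → ℝ → ℝ}, Continuous (fun p : ℝ × ℝ × ℝ => H p.1 p.2.1 p.2.2) →
      ∀ t, Continuous (Function.uncurry fun x y => H x y t) := by
    intro H hH t
    exact hH.comp (g := fun p : ℝ × ℝ × ℝ => H p.1 p.2.1 p.2.2)
          (f := fun p : ℝ × ℝ => (p.1, p.2, t)) (by fun_prop)
  have e2 : ∀ t ∈ Icc 0 T, ∫ x in -R..R, ∫ y in -R..R, Ft x y t ≤ 0 := by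
    intro t ht
    have hRR : -R ≤ R := by linarith
    have hc : ∀ {H : ℝ → ℝ → ℝ → ℝ}, Continuous (fun p : ℝ × ℝ × ℝ => H p.1 p.2.1 p.2.2) →
        Continuous fun x => ∫ y in -R..R, H x y t := fun hH =>
      intervalIntegral.continuous_parametric_intervalIntegral_of_continuous' (c2 hH t) _ _
    have hcy : ∀ {H : ℝ → ℝ → ℝ → ℝ}, Continuous (fun p : ℝ × ℝ × ℝ => H p.1 p.2.1 p.2.2) →
        ∀ x, Continuous fun y => H x y t := fun hH x =>
      (c2 hH t).comp (f := fun y => (x, y)) (by fun_prop)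
    have hcx : ∀ {H : ℝ → ℝ → ℝ → ℝ}, Continuous (fun p : ℝ × ℝ × ℝ => H p.1 p.2.1 p.2.2) →
        ∀ y, Continuous fun x => H x y t := fun hH y =>
      (c2 hH t).comp (f := fun x => (x, y)) (by fun_prop)
    calc ∫ x in -R..R, ∫ y in -R..R, Ft x y t
        ≤ ∫ x in -R..R, ((∫ y in -R..R, Gx x y t) + ∫ y in -R..R, Py x y t) := by
          refine intervalIntegral.integral_mono_on hRR ((hc hFt).intervalIntegrable _ _)
            (((hc hGx).add (hc hPy)).intervalIntegrable _ _) fun x _ => ?_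
          rw [← intervalIntegral.integral_add ((hcy hGx x).intervalIntegrable _ _)
            ((hcy hPy x).intervalIntegrable _ _)]
          exact intervalIntegral.integral_mono_on hRR ((hcy hFt x).intervalIntegrable _ _)
            (((hcy hGx x).add (hcy hPy x)).intervalIntegrable _ _) fun y _ => hle x y t ht
      _ = (∫ y in -R..R, ∫ x in -R..R, Gx x y t) + ∫ x in -R..R, ∫ y in -R..R, Py x y t := by
          rw [intervalIntegral.integral_add ((hc hGx).intervalIntegrable _ _)
            ((hc hPy).intervalIntegrable _ _), intervalIntegral_swap_of_continuous (c2 hGx t)]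
      _ = 0 := by
          have g0 : ∀ y, ∫ x in -R..R, Gx x y t = 0 := fun y => by
            rw [intervalIntegral.integral_eq_sub_of_hasDerivAt (fun x _ => dG x y t)
              ((hcx hGx y).intervalIntegrable _ _), (bG y t ht).1, (bG y t ht).2, sub_zero]
          have p0 : ∀ x, ∫ y in -R..R, Py x y t = 0 := fun x => by
            rw [intervalIntegral.integral_eq_sub_of_hasDerivAt (fun y _ => dP x y t)
              ((hcy hPy x).intervalIntegrable _ _), (bP x t ht).1, (bP x t ht).2, sub_zero]
          simp [g0, p0]
  have e3 : ∫ t in (0 : ℝ)..T, ∫ x in -R..R, ∫ y in -R..R, Ft x y t ≤ 0 := by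
    have := intervalIntegral.integral_nonneg (μ := volume) hT
      (fun t ht => neg_nonneg.2 (e2 t ht))
    rw [intervalIntegral.integral_neg] at this
    linarith
  linarith

/-- Finite speed of propagation. -/
theorem WaveGrad.eq_zero {dx dy dt dxx dyy dxt dyt : ℝ → ℝ → ℝ → ℝ}
    (h : WaveGrad dx dy dt dxx dyy dxt dyt) {R : ℝ}
    (h0 : ∀ x y, x ^ 2 + y ^ 2 < R ^ 2 → dx x y 0 = 0 ∧ dy x y 0 = 0 ∧ dt x y 0 = 0)
    {x y t : ℝ} (ht : 0 ≤ t) (htR : t < R) (hxy : x ^ 2 + y ^ 2 < (R - t) ^ 2) :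
    dx x y t = 0 ∧ dy x y t = 0 ∧ dt x y t = 0 := by
  have hR : 0 < R := ht.trans_lt htR
  obtain ⟨cx, cy, ct, cxx, cyy, cxt, cyt, x_x, y_y, x_t, t_x, y_t, t_y, t_t⟩ := h
  -- The weight is m², where m is the positive part of (R - t)² - x² - y²; m is zero for |x| ≥ R or
  -- |y| ≥ R when 0 ≤ t ≤ R.
  let s : ℝ → ℝ → ℝ → ℝ := fun x y t => (R - t) ^ 2 - x ^ 2 - y ^ 2
  let m : ℝ → ℝ → ℝ → ℝ := fun x y t => max (s x y t) 0
  let e : ℝ → ℝ → ℝ → ℝ := fun x y t => dx x y t ^ 2 + dy x y t ^ 2 + dt x y t ^ 2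
  have mt : ∀ x y t, HasDerivAt (fun r => m x y r ^ 2) (2 * m x y t * (-(2 * (R - t)))) t := by
    intro x y t
    refine HasDerivAt.comp (h₂ := fun s : ℝ => max s 0 ^ 2) t (hasDerivAt_max_sq (s x y t)) ?_
    exact (((((hasDerivAt_id t).const_sub R).pow 2).sub_const (x ^ 2)).sub_const (y ^ 2)).congr_deriv (by simp)
  have mx : ∀ x y t, HasDerivAt (fun r => m r y t ^ 2) (2 * m x y t * (-(2 * x))) x := by
    intro x y t
    refine HasDerivAt.comp (h₂ := fun s : ℝ => max s 0 ^ 2) x (hasDerivAt_max_sq (s x y t)) ?_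
    exact ((((hasDerivAt_id x).pow 2).const_sub ((R - t) ^ 2)).sub_const (y ^ 2)).congr_deriv (by simp)
  have my : ∀ x y t, HasDerivAt (fun r => m x r t ^ 2) (2 * m x y t * (-(2 * y))) y := by
    intro x y t
    refine HasDerivAt.comp (h₂ := fun s : ℝ => max s 0 ^ 2) y (hasDerivAt_max_sq (s x y t)) ?_
    exact (((hasDerivAt_id y).pow 2).const_sub ((R - t) ^ 2 - x ^ 2)).congr_deriv (by simp)
  have key := integral_time_eq_of_divergence (R := R) (T := t)
    (F := fun x y t => e x y t * m x y t ^ 2)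
    (G := fun x y t => 2 * dt x y t * dx x y t * m x y t ^ 2)
    (P := fun x y t => 2 * dt x y t * dy x y t * m x y t ^ 2)
    (Ft := fun x y t => (2 * dx x y t * dxt x y t + 2 * dy x y t * dyt x y t +
      2 * dt x y t * (dxx x y t + dyy x y t)) * m x y t ^ 2 +
      e x y t * (2 * m x y t * (-(2 * (R - t)))))
    (Gx := fun x y t => (2 * dxt x y t * dx x y t + 2 * dt x y t * dxx x y t) * m x y t ^ 2 +
      2 * dt x y t * dx x y t * (2 * m x y t * (-(2 * x))))
    (Py := fun x y t => (2 * dyt x y t * dy x y t + 2 * dt x y t * dyy x y t) * m x y t ^ 2 +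
      2 * dt x y t * dy x y t * (2 * m x y t * (-(2 * y))))
    (by simp only [e]; fun_prop) (by fun_prop) (by fun_prop) (by simp only [e]; fun_prop)
    (fun x y t => by
      refine HasDerivAt.mul ?_ (mt x y t)
      exact ((((x_t x y t).pow 2).add ((y_t x y t).pow 2)).add ((t_t x y t).pow 2)).congr_deriv
        (by simp))
    (fun x y t => by
      exact (((t_x x y t).const_mul 2).mul (x_x x y t)).mul (mx x y t))
    (fun x y t => by
      exact (((t_y x y t).const_mul 2).mul (y_y x y t)).mul (my x y t))
    ht hR.le
    (fun y r hr => by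
      have : m R y r = 0 ∧ m (-R) y r = 0 := by
        constructor <;>
        · refine max_eq_right ?_
          simp only [s]
          nlinarith [hr.1, hr.2, sq_nonneg y]
      simp [this.1, this.2])
    (fun x r hr => by
      have : m x R r = 0 ∧ m x (-R) r = 0 := by
        constructor <;>
        · refine max_eq_right ?_
          simp only [s]
          nlinarith [hr.1, hr.2, sq_nonneg x]
      simp [this.1, this.2])
    (fun x y r hr => by
      -- The terms containing m² cancel by the wave equation. What is left of the divergence
      -- inequality comes from differentiating the weight and is 4 times this inequality.
      have hflux : 0 ≤ m x y r * ((R - r) * e x y r -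
          2 * dt x y r * (x * dx x y r + y * dy x y r)) := by
        rcases le_total (s x y r) 0 with hs | hs
        · have : m x y r = 0 := max_eq_right hs
          simp [this]
        · refine mul_nonneg (le_max_right _ _) (sub_nonneg.2 (energy_flux_le (by linarith [hr.2]) ?_))
          simp only [s] at hs
          linarith
      nlinarith [hflux])
  have hz : ∫ x in -R..R, ∫ y in -R..R, e x y 0 * m x y 0 ^ 2 = 0 := by
    have : ∀ x y, e x y 0 * m x y 0 ^ 2 = 0 := by
      intro x y
      by_cases hs : x ^ 2 + y ^ 2 < R ^ 2
      · obtain ⟨h1, h2, h3⟩ := h0 x y hs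
        simp [e, h1, h2, h3]
      · have : m x y 0 = 0 := by
          refine max_eq_right ?_
          simp only [s]
          linarith
        simp [this]
    simp [this]
  rw [hz] at key
  have hm : 0 < m x y t := lt_max_of_lt_left (by simp only [s]; linarith)
  have hxR : x ^ 2 ≤ R ^ 2 := by nlinarith [sq_nonneg y]
  have hyR : y ^ 2 ≤ R ^ 2 := by nlinarith [sq_nonneg x]
  have hzero := eq_zero_of_integral_le_zero (f := fun x y => e x y t * m x y t ^ 2)
    (by
      have : Continuous fun p : ℝ × ℝ × ℝ => e p.1 p.2.1 p.2.2 * m p.1 p.2.1 p.2.2 ^ 2 := by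
        simp only [e]; fun_prop
      exact this.comp (f := fun p : ℝ × ℝ => (p.1, p.2, t)) (by fun_prop))
    (fun x y => by positivity) (by linarith) (by linarith) key
    (abs_le.1 (abs_le_of_sq_le_sq hxR hR.le)) (abs_le.1 (abs_le_of_sq_le_sq hyR hR.le))
  have he : e x y t = 0 := by
    rcases mul_eq_zero.1 hzero with h | h
    · exact h
    · exact absurd h (by positivity)
  simp only [e] at he
  refine ⟨?_, ?_, ?_⟩ <;> nlinarith [sq_nonneg (dx x y t), sq_nonneg (dy x y t),
    sq_nonneg (dt x y t)]

/-! ### Poisson's formula for exponentials -/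

/-- Here cos φ dφ ds is the area element of the hemisphere with coordinates sin φ and cos φ sin s,
and α acts on these two as a rotation through an imaginary angle. Accordingly the α-derivative of
the integrand is a divergence in (φ, s) of a field whose normal component vanishes on the sides of
the square, so the mean does not depend on α. -/
theorem hyperbolic_mean_eq {m y α : ℝ} (hα : 0 ≤ α) :
    ∫ φ in -(π / 2)..(π / 2), ∫ s in -(π / 2)..(π / 2), cos φ *
      (cos (m * cosh α * y * sin φ) * exp (m * sinh α * y * cos φ * sin s)) =
    ∫ φ in -(π / 2)..(π / 2), ∫ _s in -(π / 2)..(π / 2), cos φ * cos (m * y * sin φ) := by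
  have hdF : ∀ φ s α : ℝ, HasDerivAt (fun α => cos φ *
      (cos (m * cosh α * y * sin φ) * exp (m * sinh α * y * cos φ * sin s)))
      (cos φ * (-sin (m * cosh α * y * sin φ) * (m * sinh α * y * sin φ) *
        exp (m * sinh α * y * cos φ * sin s) + cos (m * cosh α * y * sin φ) *
        (exp (m * sinh α * y * cos φ * sin s) * (m * cosh α * y * cos φ * sin s)))) α := by
    intro φ s α
    refine HasDerivAt.const_mul _ (HasDerivAt.mul (HasDerivAt.cos ?_) (HasDerivAt.exp ?_))
    · exact (((hasDerivAt_cosh α).const_mul m).mul_const y).mul_const (sin φ)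
    · exact ((((hasDerivAt_sinh α).const_mul m).mul_const y).mul_const (cos φ)).mul_const (sin s)
  have hdG : ∀ φ s α : ℝ, HasDerivAt (fun φ => sin (m * cosh α * y * sin φ) *
      exp (m * sinh α * y * cos φ * sin s) * (cos φ * sin s))
      ((cos (m * cosh α * y * sin φ) * (m * cosh α * y * cos φ) *
        exp (m * sinh α * y * cos φ * sin s) + sin (m * cosh α * y * sin φ) *
        (exp (m * sinh α * y * cos φ * sin s) * (m * sinh α * y * -sin φ * sin s))) *
        (cos φ * sin s) + sin (m * cosh α * y * sin φ) *
        exp (m * sinh α * y * cos φ * sin s) * (-sin φ * sin s)) φ := by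
    intro φ s α
    refine HasDerivAt.mul (HasDerivAt.mul (HasDerivAt.sin ?_) (HasDerivAt.exp ?_)) ?_
    · exact (hasDerivAt_sin φ).const_mul _
    · exact ((hasDerivAt_cos φ).const_mul _).mul_const _
    · exact (hasDerivAt_cos φ).mul_const _
  have hdP : ∀ φ s α : ℝ, HasDerivAt (fun s => sin (m * cosh α * y * sin φ) *
      exp (m * sinh α * y * cos φ * sin s) * (-sin φ * cos s))
      (sin (m * cosh α * y * sin φ) *
        (exp (m * sinh α * y * cos φ * sin s) * (m * sinh α * y * cos φ * cos s)) *
        (-sin φ * cos s) + sin (m * cosh α * y * sin φ) *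
        exp (m * sinh α * y * cos φ * sin s) * (-sin φ * -sin s)) s := by
    intro φ s α
    refine HasDerivAt.mul (HasDerivAt.const_mul _ (HasDerivAt.exp ?_)) ?_
    · exact (hasDerivAt_sin s).const_mul _
    · exact (hasDerivAt_cos s).const_mul _
  have hid : ∀ φ s α : ℝ, (cos φ * (-sin (m * cosh α * y * sin φ) * (m * sinh α * y * sin φ) *
        exp (m * sinh α * y * cos φ * sin s) + cos (m * cosh α * y * sin φ) *
        (exp (m * sinh α * y * cos φ * sin s) * (m * cosh α * y * cos φ * sin s)))) =
      ((cos (m * cosh α * y * sin φ) * (m * cosh α * y * cos φ) *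
        exp (m * sinh α * y * cos φ * sin s) + sin (m * cosh α * y * sin φ) *
        (exp (m * sinh α * y * cos φ * sin s) * (m * sinh α * y * -sin φ * sin s))) *
        (cos φ * sin s) + sin (m * cosh α * y * sin φ) *
        exp (m * sinh α * y * cos φ * sin s) * (-sin φ * sin s)) +
      (sin (m * cosh α * y * sin φ) *
        (exp (m * sinh α * y * cos φ * sin s) * (m * sinh α * y * cos φ * cos s)) *
        (-sin φ * cos s) + sin (m * cosh α * y * sin φ) *
        exp (m * sinh α * y * cos φ * sin s) * (-sin φ * -sin s)) := by
    intro φ s α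
    linear_combination (sin (m * cosh α * y * sin φ) * (m * sinh α * y * sin φ) * cos φ *
        exp (m * sinh α * y * cos φ * sin s)) * sin_sq_add_cos_sq s
  -- With α in the role of time, the divergence inequality for the field and for its negative gives
  -- both inequalities.
  have h1 := integral_time_eq_of_divergence (R := π / 2) (by fun_prop) (by fun_prop) (by fun_prop)
    (by fun_prop) hdF hdG hdP hα (by positivity) (fun s t _ => by simp) (fun φ t _ => by simp)
    (fun φ s t _ => (hid φ s t).le)
  have h2 := integral_time_eq_of_divergence (R := π / 2) (by fun_prop) (by fun_prop) (by fun_prop)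
    (by fun_prop) (fun φ s α => (hdF φ s α).fun_neg) (fun φ s α => (hdG φ s α).fun_neg)
    (fun φ s α => (hdP φ s α).fun_neg) hα (by positivity) (fun s t _ => by simp) (fun φ t _ => by simp)
    (fun φ s t _ => by rw [hid φ s t, neg_add])
  simp only [intervalIntegral.integral_neg, neg_le_neg_iff] at h2
  rw [le_antisymm h1 h2]
  simp

theorem integral_sin_substitution (y : ℝ) {f : ℝ → ℝ} (hf : Continuous f) :
    ∫ t in -y..y, f t = ∫ φ in -(π / 2)..(π / 2), f (y * sin φ) * (y * cos φ) := by
  have := intervalIntegral.integral_comp_mul_deriv (a := -(π / 2)) (b := π / 2)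
    (f := fun φ => y * sin φ) (f' := fun φ => y * cos φ) (g := f)
    (fun φ _ => (hasDerivAt_sin φ).const_mul y) (by fun_prop) hf
  simp only [Function.comp_apply, sin_neg, sin_pi_div_two, mul_one, mul_neg] at this
  exact this.symm

theorem sqrt_sq_sub_sin {y φ : ℝ} (hy : 0 ≤ y) (hφ : φ ∈ Icc (-(π / 2)) (π / 2)) :
    √(y ^ 2 - (y * sin φ) ^ 2) = y * cos φ := by
  have h : y ^ 2 - (y * sin φ) ^ 2 = (y * cos φ) ^ 2 := by
    rw [mul_pow, mul_pow, cos_sq']; ring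
  rw [h, sqrt_sq (mul_nonneg hy (cos_nonneg_of_mem_Icc hφ))]

/-- Poisson's formula for the wave `exp (κ σ) cos (ρ t)`. -/
theorem poisson_identity {y κ ρ : ℝ} (hy : 0 < y) (hκ : 0 ≤ κ) (hκρ : κ < ρ) :
    ∫ t in -y..y, cos (ρ * t) * ∫ s in -(π / 2)..(π / 2), exp (κ * (√(y ^ 2 - t ^ 2) * sin s)) =
      2 * π * (sin (√(ρ ^ 2 - κ ^ 2) * y) / √(ρ ^ 2 - κ ^ 2)) := by
  set m := √(ρ ^ 2 - κ ^ 2) with hm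
  have hpos : 0 < ρ ^ 2 - κ ^ 2 := by nlinarith
  have hm0 : 0 < m := sqrt_pos.2 hpos
  have hm2 : m ^ 2 = ρ ^ 2 - κ ^ 2 := sq_sqrt hpos.le
  -- The pair (ρ, κ) lies on the hyperbola ρ² - κ² = m², so it equals m (cosh α, sinh α). The
  -- substitution t = y sin φ below then leads to the hemisphere mean.
  set α := arsinh (κ / m) with hα
  have hsinh : m * sinh α = κ := by rw [hα, sinh_arsinh]; field_simp
  have hcosh : m * cosh α = ρ := by
    have h1 : 0 ≤ m * cosh α := by have := cosh_pos α; positivity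
    have h2 : (m * cosh α) ^ 2 = ρ ^ 2 := by
      have := cosh_sq α
      calc (m * cosh α) ^ 2 = m ^ 2 + (m * sinh α) ^ 2 := by rw [mul_pow, this]; ring
        _ = ρ ^ 2 := by rw [hsinh, hm2]; ring
    exact (pow_left_inj₀ h1 (hκ.trans hκρ.le) two_ne_zero).1 h2
  have hα0 : 0 ≤ α := arsinh_nonneg_iff.2 (by positivity)
  have hc : Continuous fun t : ℝ => cos (ρ * t) *
      ∫ s in -(π / 2)..(π / 2), exp (κ * (√(y ^ 2 - t ^ 2) * sin s)) :=
    Continuous.mul (by fun_prop)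
      (intervalIntegral.continuous_parametric_intervalIntegral_of_continuous' (by fun_prop) _ _)
  rw [integral_sin_substitution y hc]
  have h1 : ∫ φ in -(π / 2)..(π / 2), cos (ρ * (y * sin φ)) *
      (∫ s in -(π / 2)..(π / 2), exp (κ * (√(y ^ 2 - (y * sin φ) ^ 2) * sin s))) * (y * cos φ) =
      y * ∫ φ in -(π / 2)..(π / 2), ∫ s in -(π / 2)..(π / 2), cos φ *
      (cos (m * cosh α * y * sin φ) * exp (m * sinh α * y * cos φ * sin s)) := by
    rw [← intervalIntegral.integral_const_mul]
    refine intervalIntegral.integral_congr fun φ hφ => ?_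
    rw [uIcc_of_le (by linarith [pi_pos])] at hφ
    simp only [sqrt_sq_sub_sin hy.le hφ, hsinh, hcosh, intervalIntegral.integral_const_mul]
    have : ∀ s, κ * (y * cos φ * sin s) = κ * y * cos φ * sin s := fun s => by ring
    simp only [this]
    ring_nf
  rw [h1, hyperbolic_mean_eq hα0]
  simp only [intervalIntegral.integral_const, smul_eq_mul]
  rw [intervalIntegral.integral_const_mul]
  have h3 : ∫ φ in -(π / 2)..(π / 2), cos φ * cos (m * y * sin φ) =
      2 * sin (m * y) / (m * y) := by
    rw [intervalIntegral.integral_eq_sub_of_hasDerivAt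
      (f := fun φ => sin (m * y * sin φ) / (m * y)) (fun φ _ => ?_)
      (Continuous.intervalIntegrable (by fun_prop) _ _)]
    · simp only [sin_pi_div_two, sin_neg, mul_one, mul_neg]
      ring
    · have := (((hasDerivAt_sin φ).const_mul (m * y)).sin).div_const (m * y)
      refine this.congr_deriv ?_
      field_simp
  rw [h3]
  field_simp
  ring

/-- The mean of `exp (κ σ) cos (ρ t)` over a half-disc. -/
def halfMean (y κ ρ : ℝ) : ℝ :=
  ∫ t in -y..y, ∫ s in (0 : ℝ)..(π / 2), cos (ρ * t) * exp (κ * (√(y ^ 2 - t ^ 2) * sin s))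

theorem continuous_halfMean (y ρ : ℝ) : Continuous fun κ => halfMean y κ ρ := by
  unfold halfMean
  refine intervalIntegral.continuous_parametric_intervalIntegral_of_continuous' ?_ _ _
  refine intervalIntegral.continuous_parametric_intervalIntegral_of_continuous'
    (f := fun (p : ℝ × ℝ) s => cos (ρ * p.2) * exp (p.1 * (√(y ^ 2 - p.2 ^ 2) * sin s))) ?_ _ _
  fun_prop

/-- The substitution s ↦ -s turns the mean with -κ into the other half of the disc, so the sum is
the full Poisson integral. -/
theorem halfMean_add_neg {y κ ρ : ℝ} (hy : 0 < y) (hκ : |κ| < ρ) :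
    halfMean y κ ρ + halfMean y (-κ) ρ =
      2 * π * (sin (√(ρ ^ 2 - κ ^ 2) * y) / √(ρ ^ 2 - κ ^ 2)) := by
  wlog h0 : 0 ≤ κ generalizing κ
  · have := this (κ := -κ) (by rwa [abs_neg]) (by linarith)
    rw [neg_neg, neg_sq] at this
    rw [add_comm, this]
  rw [← poisson_identity hy h0 (lt_of_abs_lt hκ)]
  have hc : ∀ κ : ℝ, Continuous fun t : ℝ => ∫ s in (0 : ℝ)..(π / 2), cos (ρ * t) *
      exp (κ * (√(y ^ 2 - t ^ 2) * sin s)) := fun κ =>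
    intervalIntegral.continuous_parametric_intervalIntegral_of_continuous' (by fun_prop) _ _
  unfold halfMean
  rw [← intervalIntegral.integral_add ((hc κ).intervalIntegrable _ _)
    ((hc (-κ)).intervalIntegrable _ _)]
  refine intervalIntegral.integral_congr fun t _ => ?_
  simp only [intervalIntegral.integral_const_mul]
  rw [← mul_add]
  congr 1
  have h2 : ∫ s in (0 : ℝ)..(π / 2), exp (-κ * (√(y ^ 2 - t ^ 2) * sin s)) =
      ∫ s in -(π / 2)..0, exp (κ * (√(y ^ 2 - t ^ 2) * sin s)) := by
    have := intervalIntegral.integral_comp_neg (a := 0) (b := π / 2)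
      (fun s => exp (κ * (√(y ^ 2 - t ^ 2) * sin s)))
    rw [neg_zero] at this
    rw [← this]
    simp
  rw [h2, add_comm, intervalIntegral.integral_add_adjacent_intervals] <;>
    exact Continuous.intervalIntegrable (by fun_prop) _ _

theorem abs_halfMean_neg_le {y κ ρ : ℝ} (hy : 0 < y) (hκ : 0 ≤ κ) :
    |halfMean y (-κ) ρ| ≤ π * y := by
  have h1 : ∀ t ∈ uIoc (-y) y, ‖∫ s in (0 : ℝ)..(π / 2), cos (ρ * t) *
      exp (-κ * (√(y ^ 2 - t ^ 2) * sin s))‖ ≤ π / 2 := by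
    intro t _
    have := intervalIntegral.norm_integral_le_of_norm_le_const (a := (0 : ℝ)) (b := π / 2) (C := 1)
      (f := fun s => cos (ρ * t) * exp (-κ * (√(y ^ 2 - t ^ 2) * sin s))) (fun s hs => by
        rw [uIoc_of_le (by positivity)] at hs
        rw [norm_mul, norm_eq_abs, norm_eq_abs, abs_exp]
        refine mul_le_one₀ (abs_cos_le_one _) (exp_pos _).le (exp_le_one_iff.2 ?_)
        have : 0 ≤ sin s := sin_nonneg_of_nonneg_of_le_pi hs.1.le (by linarith [hs.2, pi_pos])
        rw [neg_mul, neg_nonpos]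
        positivity)
    rwa [one_mul, sub_zero, abs_of_pos (by positivity)] at this
  have := intervalIntegral.norm_integral_le_of_norm_le_const h1
  rw [norm_eq_abs, sub_neg_eq_add, abs_of_pos (by linarith : 0 < y + y)] at this
  unfold halfMean
  linarith

/-- The integrand may be as large as e^{κy}; only the oscillation of cos(ρt) compensates it. The
bound comes by subtraction: the full mean is at most 2πy by |sin r| ≤ |r|, and the half with -κ is
at most πy since its exponential is at most 1. -/
theorem abs_halfMean_le {y κ ρ : ℝ} (hy : 0 < y) (hκ : 0 ≤ κ) (hκρ : κ < ρ) :
    |halfMean y κ ρ| ≤ 3 * π * y := by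
  have h1 := halfMean_add_neg hy (by rwa [abs_of_nonneg hκ])
  have h2 := abs_halfMean_neg_le (ρ := ρ) hy hκ
  have hm : 0 < √(ρ ^ 2 - κ ^ 2) := sqrt_pos.2 (by nlinarith)
  have h3 : |sin (√(ρ ^ 2 - κ ^ 2) * y) / √(ρ ^ 2 - κ ^ 2)| ≤ y := by
    rw [abs_div, abs_of_pos hm, div_le_iff₀ hm]
    calc _ ≤ |√(ρ ^ 2 - κ ^ 2) * y| := abs_sin_le_abs
      _ = _ := by rw [abs_of_pos (by positivity)]; ring
  rw [eq_sub_of_add_eq h1]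
  calc _ ≤ |2 * π * (sin (√(ρ ^ 2 - κ ^ 2) * y) / √(ρ ^ 2 - κ ^ 2))| + |halfMean y (-κ) ρ| :=
        abs_sub _ _
    _ ≤ 2 * π * y + π * y := by
        rw [abs_mul, abs_of_pos (by positivity : 0 < 2 * π)]
        gcongr
    _ = _ := by ring

/-! ### The complementary error function -/

/-- The Gaussian integral over the ray `z + [0, ∞)`. -/
def gaussTail (z : ℂ) : ℂ := ∫ r in Ioi (0 : ℝ), Complex.exp (-(z + r) ^ 2)

theorem norm_exp_neg_add_sq_le {z : ℂ} {B : ℝ} (hz : ‖z‖ ≤ B) (r : ℝ) :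
    ‖Complex.exp (-(z + r) ^ 2)‖ ≤ exp (2 * B ^ 2) * exp (-(1 / 2) * r ^ 2) := by
  rw [Complex.norm_exp, ← exp_add]
  apply exp_le_exp.2
  have h1 : (-(z + r) ^ 2).re = -((z.re + r) ^ 2 - z.im ^ 2) := by
    simp [pow_two]
  have h2 : z.re ^ 2 + z.im ^ 2 ≤ B ^ 2 := by
    have := Complex.sq_norm z
    rw [Complex.normSq_apply] at this
    nlinarith [norm_nonneg z]
  rw [h1]
  nlinarith [sq_nonneg (2 * z.re + r), sq_nonneg z.re, sq_nonneg z.im]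

theorem integrable_exp_neg_half_sq : Integrable fun r : ℝ => exp (-(1 / 2) * r ^ 2) :=
  integrable_exp_neg_mul_sq (by norm_num)

theorem integrable_gaussTail (z : ℂ) : Integrable fun r : ℝ => Complex.exp (-(z + r) ^ 2) :=
  (integrable_exp_neg_half_sq.const_mul (exp (2 * ‖z‖ ^ 2))).mono'
    (by fun_prop) (Eventually.of_forall fun r => norm_exp_neg_add_sq_le le_rfl r)

theorem hasDerivAt_exp_neg_add_sq (z : ℂ) (r : ℝ) :
    HasDerivAt (fun z : ℂ => Complex.exp (-(z + r) ^ 2))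
      (-2 * (z + r) * Complex.exp (-(z + r) ^ 2)) z := by
  have := (((hasDerivAt_id z).add_const (r : ℂ)).pow 2).fun_neg.cexp
  refine this.congr_deriv ?_
  simp
  ring

theorem hasDerivAt_gaussTail (z : ℂ) : HasDerivAt gaussTail (-Complex.exp (-z ^ 2)) z := by
  have h := hasDerivAt_integral_of_dominated_loc_of_deriv_le (μ := volume.restrict (Ioi (0 : ℝ)))
    (F := fun (z : ℂ) (r : ℝ) => Complex.exp (-(z + r) ^ 2))
    (F' := fun (z : ℂ) (r : ℝ) => -2 * (z + r) * Complex.exp (-(z + r) ^ 2)) (x₀ := z)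
    (s := Metric.ball z 1)
    (bound := fun r => 2 * ((‖z‖ + 1) + |r|) * (exp (2 * (‖z‖ + 1) ^ 2) * exp (-(1 / 2) * r ^ 2)))
    (Metric.ball_mem_nhds z one_pos)
    (Eventually.of_forall fun w => by fun_prop) (integrable_gaussTail z).restrict
    (by fun_prop) (Eventually.of_forall fun r w hw => by
      have hw' : ‖w‖ ≤ ‖z‖ + 1 := by
        have h1 : ‖w - z‖ < 1 := by simpa [dist_eq_norm] using hw
        have := norm_le_norm_add_norm_sub' w z
        linarith
      rw [norm_mul, norm_mul]
      refine mul_le_mul (mul_le_mul (by simp) ?_ (norm_nonneg _) (by norm_num))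
        (norm_exp_neg_add_sq_le hw' r) (norm_nonneg _) (by positivity)
      refine (norm_add_le _ _).trans ?_
      simpa using hw') ?_
    (Eventually.of_forall fun r w _ => hasDerivAt_exp_neg_add_sq w r)
  · have hI := h.1
    have h2 := h.2
    have h3 : ∫ r in Ioi (0 : ℝ), -2 * (z + r) * Complex.exp (-(z + r) ^ 2) =
        0 - Complex.exp (-(z + (0 : ℝ)) ^ 2) := by
      refine integral_Ioi_of_hasDerivAt_of_tendsto' (f := fun r : ℝ => Complex.exp (-(z + r) ^ 2))
        (fun r _ => ?_) hI ?_
      · have := (((hasDerivAt_id (r : ℂ)).const_add z).pow 2).fun_neg.cexp.comp_ofReal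
        refine this.congr_deriv ?_
        simp
        ring
      · refine squeeze_zero_norm (fun r => norm_exp_neg_add_sq_le le_rfl r) ?_
        have : Tendsto (fun r : ℝ => exp (-(1 / 2) * r ^ 2)) atTop (𝓝 0) := by
          refine tendsto_exp_atBot.comp ?_
          exact (tendsto_pow_atTop two_ne_zero).const_mul_atTop_of_neg (by norm_num)
        simpa using this.const_mul (exp (2 * ‖z‖ ^ 2))
    have e : 0 - Complex.exp (-(z + (0 : ℝ)) ^ 2) = -Complex.exp (-z ^ 2) := by simp
    rw [h3, e] at h2
    exact h2
  · have h1 := integrable_exp_neg_half_sq.const_mul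
      (2 * (‖z‖ + 1) * exp (2 * (‖z‖ + 1) ^ 2))
    have h2 := (integrable_mul_exp_neg_mul_sq (b := 1 / 2) (by norm_num)).norm.const_mul
      (2 * exp (2 * (‖z‖ + 1) ^ 2))
    refine ((h1.add h2).congr (Eventually.of_forall fun r => ?_)).restrict
    simp only [Pi.add_apply, norm_mul, norm_eq_abs, abs_exp]
    ring

/-- The derivatives of the two terms cancel, so the sum equals its value at 0. It exchanges a tail
from a point with negative real part for one that can be estimated. -/
theorem gaussTail_add_neg (z : ℂ) : gaussTail z + gaussTail (-z) = (√π : ℝ) := by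
  have hd : ∀ z : ℂ, HasDerivAt (fun z => gaussTail z + gaussTail (-z)) 0 z := by
    intro z
    have h1 := (hasDerivAt_gaussTail (-z)).scomp z (hasDerivAt_neg z)
    have := (hasDerivAt_gaussTail z).add h1
    refine this.congr_deriv ?_
    simp
  have := is_const_of_deriv_eq_zero (fun z => (hd z).differentiableAt) (fun z => (hd z).deriv) z 0
  rw [this]
  have h0 : gaussTail 0 = ((√π / 2 : ℝ) : ℂ) := by
    have := integral_gaussian_Ioi 1
    rw [div_one] at this
    rw [← this, ← integral_complex_ofReal]
    unfold gaussTail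
    simp
  rw [neg_zero, h0]
  push_cast
  ring

/-- For Re z ≥ 0 the cross term 2zr only helps, so the integrand is at most |e^{-z²}| e^{-r²}, and
√π/2 ≤ 1. -/
theorem norm_gaussTail_le {z : ℂ} (hz : 0 ≤ z.re) : ‖gaussTail z‖ ≤ ‖Complex.exp (-z ^ 2)‖ := by
  have h1 : ∀ r ∈ Ioi (0 : ℝ), ‖Complex.exp (-(z + r) ^ 2)‖ ≤
      ‖Complex.exp (-z ^ 2)‖ * exp (-1 * r ^ 2) := by
    intro r hr
    rw [Complex.norm_exp, Complex.norm_exp, ← exp_add]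
    apply exp_le_exp.2
    have : (-(z + r) ^ 2).re = (-z ^ 2).re - 2 * z.re * r - r ^ 2 := by
      simp [pow_two]; ring
    rw [this]
    have : 0 ≤ z.re * r := mul_nonneg hz (le_of_lt hr)
    linarith
  have h2 : ‖gaussTail z‖ ≤ ∫ r in Ioi (0 : ℝ), ‖Complex.exp (-z ^ 2)‖ * exp (-1 * r ^ 2) :=
    (norm_integral_le_integral_norm _).trans (setIntegral_mono_on
      (integrable_gaussTail z).norm.integrableOn
      ((integrable_exp_neg_mul_sq one_pos).const_mul _).integrableOn measurableSet_Ioi h1)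
  rw [integral_const_mul, integral_gaussian_Ioi, div_one] at h2
  refine h2.trans (mul_le_of_le_one_right (norm_nonneg _) ?_)
  have : √π ≤ 2 := by
    rw [sqrt_le_left (by norm_num)]
    linarith [pi_le_four]
  linarith

/-! ### The square root of `c + ix` -/

theorem sqrtC_ne_zero {c : ℝ} (hc : 0 < c) (x : ℝ) : sqrtC c x ≠ 0 := fun h => by
  have := sqrtC_re_pos hc x
  simp [h] at this

theorem mem_slitPlane_add_I_mul {c : ℝ} (hc : 0 < c) (x : ℝ) :
    (c : ℂ) + Complex.I * x ∈ Complex.slitPlane :=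
  Or.inl (by simpa using hc)

theorem hasDerivAt_sqrtC {c : ℝ} (hc : 0 < c) (x : ℝ) :
    HasDerivAt (sqrtC c) (Complex.I / (2 * sqrtC c x)) x := by
  have h1 : HasDerivAt (fun z : ℂ => (c : ℂ) + Complex.I * z) Complex.I (x : ℂ) := by
    simpa using ((hasDerivAt_id (x : ℂ)).const_mul Complex.I).const_add (c : ℂ)
  have h2 := (h1.cpow_const (c := (1 / 2 : ℂ)) (mem_slitPlane_add_I_mul hc x)).comp_ofReal
  refine h2.congr_deriv ?_
  have h3 := Complex.slitPlane_ne_zero (mem_slitPlane_add_I_mul hc x)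
  rw [Complex.cpow_sub _ _ h3, Complex.cpow_one]
  change 1 / 2 * (sqrtC c x / ((c : ℂ) + Complex.I * x)) * Complex.I = _
  rw [← sqrtC_sq]
  field_simp

theorem continuous_sqrtC {c : ℝ} (hc : 0 < c) : Continuous (sqrtC c) :=
  continuous_iff_continuousAt.2 fun x => (hasDerivAt_sqrtC hc x).continuousAt

theorem sqrtC_re_mul_im (c x : ℝ) : 2 * (sqrtC c x).re * (sqrtC c x).im = x := by
  have := congrArg Complex.im (sqrtC_sq c x)
  simp [pow_two] at this
  linarith

theorem sqrtC_im_pos {c x : ℝ} (hc : 0 < c) (hx : 0 < x) : 0 < (sqrtC c x).im := by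
  have h1 := sqrtC_re_mul_im c x
  have h2 := sqrtC_re_pos hc x
  by_contra! h
  nlinarith

theorem sqrtC_im_neg {c x : ℝ} (hc : 0 < c) (hx : x < 0) : (sqrtC c x).im < 0 := by
  have h1 := sqrtC_re_mul_im c x
  have h2 := sqrtC_re_pos hc x
  by_contra! h
  nlinarith

theorem normSq_sqrtC (c x : ℝ) : Complex.normSq (sqrtC c x) = ‖(c : ℂ) + Complex.I * x‖ := by
  rw [← sqrtC_sq, norm_pow, ← Complex.normSq_eq_norm_sq]

theorem abs_le_normSq_sqrtC (c x : ℝ) : |x| ≤ Complex.normSq (sqrtC c x) := by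
  rw [normSq_sqrtC]
  simpa using Complex.abs_im_le_norm ((c : ℂ) + Complex.I * x)

theorem le_normSq_sqrtC (c x : ℝ) : c ≤ Complex.normSq (sqrtC c x) := by
  rw [normSq_sqrtC]
  simpa using (le_abs_self _).trans (Complex.abs_re_le_norm ((c : ℂ) + Complex.I * x))

theorem sqrtC_neg {c : ℝ} (hc : 0 < c) (x : ℝ) :
    sqrtC c (-x) = (starRingEnd ℂ) (sqrtC c x) := by
  unfold sqrtC
  have h := Complex.conj_cpow _ (1 / 2 : ℂ)
    (Complex.slitPlane_arg_ne_pi (mem_slitPlane_add_I_mul hc x))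
  have e : (starRingEnd ℂ) (1 / 2 : ℂ) = 1 / 2 := by
    rw [map_div₀, map_one, map_ofNat]
  rw [e] at h
  rw [← h]
  simp

/-! ### The modal integrals -/

/-- The integrand of the kernel. -/
def kern (c h σ x : ℝ) : ℂ :=
  1 / sqrtC c x * Complex.exp (-(1 / (4 * (h : ℂ) * ((c : ℂ) + Complex.I * x))) *
    ((x : ℂ) + Complex.I * (σ : ℂ)) ^ 2)

/-- The sign of x²(c + 2σ) - cσ² decides between decay and growth as h → 0. For σ ≥ 0 it is positive
exactly when |x| > D(σ), which is where D comes from. -/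
theorem re_kern_exponent {c h : ℝ} (hc : 0 < c) (hh : 0 < h) (σ x : ℝ) :
    (-(1 / (4 * (h : ℂ) * ((c : ℂ) + Complex.I * x))) * ((x : ℂ) + Complex.I * (σ : ℂ)) ^ 2).re =
      -((x ^ 2 * (c + 2 * σ) - c * σ ^ 2) / (4 * h * (c ^ 2 + x ^ 2))) := by
  have h0 : 0 < c ^ 2 + x ^ 2 := by positivity
  have e : -(1 / (4 * (h : ℂ) * ((c : ℂ) + Complex.I * x))) *
      ((x : ℂ) + Complex.I * (σ : ℂ)) ^ 2 = ((-1 / (4 * h * (c ^ 2 + x ^ 2)) : ℝ) : ℂ) *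
      (((c : ℂ) - Complex.I * x) * ((x : ℂ) + Complex.I * (σ : ℂ)) ^ 2) := by
    have h2 : ((c ^ 2 + x ^ 2 : ℝ) : ℂ) = ((c : ℂ) + Complex.I * x) * ((c : ℂ) - Complex.I * x) := by
      push_cast
      linear_combination (x : ℂ) ^ 2 * Complex.I_sq
    have h3 : (c : ℂ) - Complex.I * x ≠ 0 := by
      intro h
      rw [h, mul_zero] at h2
      exact h0.ne' (by exact_mod_cast h2)
    rw [Complex.ofReal_div, Complex.ofReal_mul, h2]
    push_cast
    field_simp
  rw [e, Complex.re_ofReal_mul]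
  simp [pow_two]
  field_simp
  ring

theorem norm_kern_exp {c h : ℝ} (hc : 0 < c) (hh : 0 < h) (σ x : ℝ) :
    ‖Complex.exp (-(1 / (4 * (h : ℂ) * ((c : ℂ) + Complex.I * x))) *
      ((x : ℂ) + Complex.I * (σ : ℂ)) ^ 2)‖ =
      exp (-((x ^ 2 * (c + 2 * σ) - c * σ ^ 2) / (4 * h * (c ^ 2 + x ^ 2)))) := by
  rw [Complex.norm_exp, re_kern_exponent hc hh]

theorem kern_exp_le_of_far {c h σ x R : ℝ} (hc : 0 < c) (hh : 0 < h) (hσ : 0 ≤ σ)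
    (hR : 2 * (c + σ) ≤ R) (hx : x ^ 2 = R ^ 2) :
    ‖Complex.exp (-(1 / (4 * (h : ℂ) * ((c : ℂ) + Complex.I * x))) *
      ((x : ℂ) + Complex.I * (σ : ℂ)) ^ 2)‖ ≤ exp (-(c / (8 * h))) := by
  rw [norm_kern_exp hc hh, hx]
  apply exp_le_exp.2
  apply neg_le_neg
  rw [div_le_div_iff₀ (by positivity) (by positivity)]
  have h2 : c * (c ^ 2 + R ^ 2) * (4 * h) ≤ (R ^ 2 * (c + 2 * σ) - c * σ ^ 2) * (8 * h) := by
    have h3 : c * (c ^ 2 + R ^ 2) ≤ 2 * (R ^ 2 * (c + 2 * σ) - c * σ ^ 2) := by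
      have h6 : c ^ 2 + 2 * σ ^ 2 ≤ R ^ 2 := by nlinarith [mul_nonneg hc.le hσ]
      nlinarith [mul_le_mul_of_nonneg_left h6 hc.le]
    nlinarith [mul_le_mul_of_nonneg_right h3 (by positivity : 0 ≤ 4 * h)]
  linarith

theorem norm_sub_sub_sub_sub_le {u v w y z : ℂ} {a b c d e : ℝ} (hu : ‖u‖ ≤ a) (hv : ‖v‖ ≤ b)
    (hw : ‖w‖ ≤ c) (hy : ‖y‖ ≤ d) (hz : ‖z‖ ≤ e) :
    ‖u - v - w - y - z‖ ≤ a + b + c + d + e := by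
  refine (norm_sub_le _ _).trans (add_le_add ?_ hz)
  refine (norm_sub_le _ _).trans (add_le_add ?_ hy)
  refine (norm_sub_le _ _).trans (add_le_add ?_ hw)
  exact (norm_sub_le _ _).trans (add_le_add hu hv)

set_option maxHeartbeats 1000000 in
-- With w = √(c + ix) the total exponent is E + p²w² + a²/w², and the square can be completed in two
-- ways, with z₁ = -i(pw - a/w) and z₂ = -i(pw + a/w). The integrand therefore has an explicit
-- primitive in Gaussian tails. The main term comes from the √π produced when the tail at z₁(-R) is
-- reflected; everything else is exponentially small.
theorem modal_integral_approx {c h σ ξ R : ℝ} (hc : 0 < c) (hh : 0 < h) (hσ : 0 ≤ σ)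
    (hR : 2 * (c + σ) ≤ R) (hξ : -(3 / 4) ≤ 4 * h * ξ) :
    ‖(∫ x in -R..R, kern c h σ x * Complex.exp (Complex.I * (ξ * x : ℝ))) -
      ((2 * √(π * h) / √(1 + 4 * h * ξ) *
        exp ((√(1 + 4 * h * ξ) - 1) / (2 * h) * σ -
          c * h * ((√(1 + 4 * h * ξ) - 1) / (2 * h)) ^ 2) : ℝ) : ℂ)‖ ≤
      24 * √h * exp (-(c / (8 * h))) := by
  set q := √(1 + 4 * h * ξ) with hq
  have hq2 : q ^ 2 = 1 + 4 * h * ξ := sq_sqrt (by linarith)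
  -- This is the purpose of the bound -3/4: it keeps p of order at least 1/√h, and with R ≥ 2(c + σ)
  -- it gives pR ≥ a.
  have hq0 : 1 / 2 ≤ q := by
    rw [hq]
    apply le_sqrt_of_sq_le
    linarith
  have hqpos : 0 < q := by linarith
  have hsh : 0 < √h := sqrt_pos.2 hh
  have hsh2 : √h ^ 2 = h := sq_sqrt hh.le
  have hR0 : 0 < R := by linarith
  set p : ℝ := q / (2 * √h) with hp
  set a : ℝ := (c + σ) / (2 * √h) with ha
  have hp0 : 0 < p := by positivity
  have ha0 : 0 < a := by positivity
  set E : ℝ := -ξ * c - (c + σ) / (2 * h) with hE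
  let w := sqrtC c
  let z₁ : ℝ → ℂ := fun x => -Complex.I * (p * w x - a / w x)
  let z₂ : ℝ → ℂ := fun x => -Complex.I * (p * w x + a / w x)
  have hw0 : ∀ x, w x ≠ 0 := sqrtC_ne_zero hc
  have hX0 : ∀ x : ℝ, (c : ℂ) + Complex.I * x ≠ 0 := fun x =>
    Complex.slitPlane_ne_zero (mem_slitPlane_add_I_mul hc x)
  have hw2 : ∀ x, w x ^ 2 = (c : ℂ) + Complex.I * x := sqrtC_sq c
  have hp2 : p ^ 2 = ξ + 1 / (4 * h) := by
    rw [hp, div_pow, mul_pow, hsh2, hq2]; field_simp; ring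
  have ha2 : a ^ 2 = (c + σ) ^ 2 / (4 * h) := by
    rw [ha, div_pow, mul_pow, hsh2]; ring
  have hpa : 2 * p * a = q * (c + σ) / (2 * h) := by
    rw [hp, ha]; field_simp; rw [hsh2]
  have hexp : ∀ x : ℝ, -(1 / (4 * (h : ℂ) * ((c : ℂ) + Complex.I * x))) *
      ((x : ℂ) + Complex.I * (σ : ℂ)) ^ 2 + Complex.I * (ξ * x : ℝ) =
      E + (p ^ 2 * w x ^ 2 + a ^ 2 / w x ^ 2) := by
    intro x
    have e1 : (p : ℂ) ^ 2 = ξ + 1 / (4 * h) := by exact_mod_cast hp2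
    have e2 : (a : ℂ) ^ 2 = (c + σ) ^ 2 / (4 * h) := by exact_mod_cast ha2
    have e4 : (x : ℂ) + Complex.I * σ = -Complex.I * (((c : ℂ) + Complex.I * x) - (c + σ)) := by
      linear_combination (x : ℂ) * Complex.I_sq
    have e5 : Complex.I * (x : ℂ) = ((c : ℂ) + Complex.I * x) - c := by ring
    have e6 := hX0 x
    have e7 : Complex.I * ((ξ * x : ℝ) : ℂ) = ξ * (Complex.I * x) := by push_cast; ring
    rw [hw2, e1, e2, hE, e7, e4, mul_pow, neg_sq, Complex.I_sq]
    push_cast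
    rw [e5]
    generalize (c : ℂ) + Complex.I * x = X at e6 ⊢
    have e8 : (c : ℂ) + (X - c) = X := by ring
    rw [e8]
    field_simp
    ring
  have hz₁ : ∀ x, -z₁ x ^ 2 = p ^ 2 * w x ^ 2 + a ^ 2 / w x ^ 2 - 2 * p * a := by
    intro x
    have := hw0 x
    simp only [z₁, mul_pow, neg_sq, Complex.I_sq]
    field_simp
    ring
  have hz₂ : ∀ x, -z₂ x ^ 2 = p ^ 2 * w x ^ 2 + a ^ 2 / w x ^ 2 + 2 * p * a := by
    intro x
    have := hw0 x
    simp only [z₂, mul_pow, neg_sq, Complex.I_sq]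
    field_simp
    ring
  have hdw : ∀ x, HasDerivAt w (Complex.I / (2 * w x)) x := hasDerivAt_sqrtC hc
  have hdz₁ : ∀ x, HasDerivAt z₁ ((p + a / w x ^ 2) / (2 * w x)) x := by
    intro x
    have := hw0 x
    refine ((((hdw x).const_mul (p : ℂ)).sub ((hdw x).fun_inv (hw0 x) |>.const_mul (a : ℂ))).const_mul
      (-Complex.I)).congr_deriv ?_
    field_simp
    linear_combination (-(p * w x ^ 2 + a)) * Complex.I_sq
  have hdz₂ : ∀ x, HasDerivAt z₂ ((p - a / w x ^ 2) / (2 * w x)) x := by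
    intro x
    have := hw0 x
    refine ((((hdw x).const_mul (p : ℂ)).add ((hdw x).fun_inv (hw0 x) |>.const_mul (a : ℂ))).const_mul
      (-Complex.I)).congr_deriv ?_
    field_simp
    linear_combination (-(p * w x ^ 2 - a)) * Complex.I_sq
  -- The weights e^{±2pa} undo the completion of the squares, and in the sum the terms with a/w³
  -- cancel, which leaves the factor 1/w of the kernel.
  let Φ : ℝ → ℂ := fun x => -(1 / p * Complex.exp E) * (Complex.exp (2 * p * a) * gaussTail (z₁ x) +
    Complex.exp (-(2 * p * a)) * gaussTail (z₂ x))
  have hpC : (p : ℂ) ≠ 0 := by exact_mod_cast hp0.ne'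
  have hΦ : ∀ x, HasDerivAt Φ (kern c h σ x * Complex.exp (Complex.I * (ξ * x : ℝ))) x := by
    intro x
    have h1 := (hasDerivAt_gaussTail (z₁ x)).comp x (hdz₁ x)
    have h2 := (hasDerivAt_gaussTail (z₂ x)).comp x (hdz₂ x)
    refine (((h1.const_mul (Complex.exp (2 * p * a))).add
      (h2.const_mul (Complex.exp (-(2 * p * a))))).const_mul (-(1 / p * Complex.exp E))).congr_deriv ?_
    unfold kern
    rw [mul_assoc (1 / sqrtC c x), ← Complex.exp_add, hexp, hz₁, hz₂]
    change _ = 1 / w x * _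
    have e1 : Complex.exp (p ^ 2 * w x ^ 2 + a ^ 2 / w x ^ 2 - 2 * p * a) =
        Complex.exp (p ^ 2 * w x ^ 2 + a ^ 2 / w x ^ 2) * Complex.exp (-(2 * p * a)) := by
      rw [← Complex.exp_add]; rfl
    have e2 : Complex.exp (2 * p * a) * Complex.exp (-(2 * p * a)) = 1 := by
      rw [← Complex.exp_add]; simp
    rw [e1, Complex.exp_add _ (2 * p * a : ℂ), Complex.exp_add (E : ℂ)]
    have := hw0 x
    generalize Complex.exp (2 * p * a) = P at e2 ⊢
    generalize Complex.exp (-(2 * p * a)) = Q at e2 ⊢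
    generalize Complex.exp (p ^ 2 * w x ^ 2 + a ^ 2 / w x ^ 2) = S
    field_simp
    linear_combination (2 * p * w x ^ 2 * S) * e2
  have hcont : Continuous fun x : ℝ => kern c h σ x * Complex.exp (Complex.I * (ξ * x : ℝ)) := by
    unfold kern
    have := continuous_sqrtC hc
    have h4 : (h : ℂ) ≠ 0 := by exact_mod_cast hh.ne'
    refine Continuous.mul (Continuous.mul (continuous_const.div this (sqrtC_ne_zero hc)) ?_)
      (by fun_prop)
    refine Complex.continuous_exp.comp (Continuous.mul (Continuous.neg (continuous_const.div
      (by fun_prop) fun x => ?_)) (by fun_prop))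
    exact mul_ne_zero (mul_ne_zero (by norm_num) h4) (hX0 x)
  rw [intervalIntegral.integral_eq_sub_of_hasDerivAt (fun x _ => hΦ x)
    (hcont.intervalIntegrable _ _)]
  have hre₁ : ∀ x, (z₁ x).re = (w x).im * (p + a / Complex.normSq (w x)) := by
    intro x
    simp [z₁, Complex.div_im]
    ring
  have hre₂ : ∀ x, (z₂ x).re = (w x).im * (p - a / Complex.normSq (w x)) := by
    intro x
    simp [z₂, Complex.div_im]
    ring
  -- As |w|² ≥ |x| = R and pR ≥ a, the real parts of both z₁ and z₂ have the sign of Im w, which is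
  -- that of x.
  have hpa' : ∀ x, |x| = R → 0 ≤ p - a / Complex.normSq (w x) := by
    intro x hx
    have h1 : R ≤ Complex.normSq (w x) := hx ▸ abs_le_normSq_sqrtC c x
    rw [sub_nonneg, div_le_iff₀ (by linarith)]
    calc a ≤ p * R := by
          rw [ha, hp, div_mul_eq_mul_div]
          gcongr
          nlinarith
      _ ≤ _ := by gcongr
  have hpa'' : ∀ x, 0 ≤ p + a / Complex.normSq (w x) := fun x =>
    add_nonneg hp0.le (div_nonneg ha0.le (Complex.normSq_nonneg _))
  -- At the left endpoint the real parts are nonpositive, so the tails are reflected before they are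
  -- estimated.
  have hT₁ : gaussTail (z₁ (-R)) = (√π : ℝ) - gaussTail (-z₁ (-R)) :=
    eq_sub_of_add_eq (gaussTail_add_neg _)
  have hT₂ : gaussTail (z₂ (-R)) = (√π : ℝ) - gaussTail (-z₂ (-R)) :=
    eq_sub_of_add_eq (gaussTail_add_neg _)
  have hwR : 0 < (w R).im := sqrtC_im_pos hc hR0
  have hwR' : (w (-R)).im < 0 := sqrtC_im_neg hc (by linarith)
  have b1 : ∀ x, |x| = R → ‖Complex.exp E * (Complex.exp (2 * p * a) * Complex.exp (-z₁ x ^ 2))‖ ≤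
      exp (-(c / (8 * h))) := by
    intro x hx
    rw [hz₁, ← Complex.exp_add, ← Complex.exp_add, add_sub_cancel, ← hexp, Complex.exp_add, norm_mul,
      mul_comm Complex.I ((ξ * x : ℝ) : ℂ), Complex.norm_exp_ofReal_mul_I, mul_one]
    exact kern_exp_le_of_far hc hh hσ hR (by rw [← sq_abs, hx])
  have b2 : ∀ x, |x| = R → ‖Complex.exp E * (Complex.exp (-(2 * p * a)) * Complex.exp (-z₂ x ^ 2))‖ ≤
      exp (-(c / (8 * h))) := by
    intro x hx
    rw [hz₂, ← Complex.exp_add, ← Complex.exp_add, neg_add_cancel_comm_assoc, ← hexp, Complex.exp_add,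
      norm_mul, mul_comm Complex.I ((ξ * x : ℝ) : ℂ), Complex.norm_exp_ofReal_mul_I, mul_one]
    exact kern_exp_le_of_far hc hh hσ hR (by rw [← sq_abs, hx])
  have g : ∀ {A z : ℂ}, 0 ≤ z.re → ‖Complex.exp E * (A * Complex.exp (-z ^ 2))‖ ≤
      exp (-(c / (8 * h))) → ‖Complex.exp E * (A * gaussTail z)‖ ≤ exp (-(c / (8 * h))) := by
    intro A z hz hb
    refine le_trans ?_ hb
    rw [norm_mul, norm_mul, norm_mul, norm_mul]
    gcongr
    exact norm_gaussTail_le hz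
  have g1 := g (by rw [hre₁]; exact mul_nonneg hwR.le (hpa'' _)) (b1 R (abs_of_pos hR0))
  have g2 := g (by rw [hre₂]; exact mul_nonneg hwR.le (hpa' _ (abs_of_pos hR0)))
    (b2 R (abs_of_pos hR0))
  have hRa : |-R| = R := by rw [abs_neg, abs_of_pos hR0]
  have g3 := g (z := -z₁ (-R)) (by
    rw [Complex.neg_re, hre₁, ← neg_mul]; exact mul_nonneg (by linarith) (hpa'' _))
    (by rw [neg_sq]; exact b1 (-R) hRa)
  have g4 := g (z := -z₂ (-R)) (by
    rw [Complex.neg_re, hre₂, ← neg_mul]; exact mul_nonneg (by linarith) (hpa' _ hRa))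
    (by rw [neg_sq]; exact b2 (-R) hRa)
  -- The √π reflected at z₂ carries e^{E - 2pa} and is an error term. With its factor 2 and the four
  -- tails the errors add up to 6 exponentials, and 1/p ≤ 4√h gives the constant 24.
  have g5 : ‖Complex.exp E * (Complex.exp (-(2 * p * a)) * (√π : ℝ))‖ ≤
      2 * exp (-(c / (8 * h))) := by
    rw [← mul_assoc, ← Complex.exp_add, norm_mul, Complex.norm_exp, Complex.norm_real, norm_eq_abs,
      abs_of_nonneg (sqrt_nonneg _), mul_comm]
    have e1 : √π ≤ 2 := by
      rw [sqrt_le_left (by norm_num)]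
      linarith [pi_le_four]
    refine mul_le_mul e1 (exp_le_exp.2 ?_) (exp_pos _).le (by norm_num)
    have e2 : ((E : ℂ) + -(2 * p * a)).re = E - 2 * p * a := by simp; ring
    rw [e2, hpa, hE]
    have e3 : ξ = (q ^ 2 - 1) / (4 * h) := by rw [hq2]; field_simp; ring
    have e4 : -ξ * c - (c + σ) / (2 * h) - q * (c + σ) / (2 * h) =
        -((1 + q) * (c * (1 + q) + 2 * σ)) / (4 * h) := by
      rw [e3]; field_simp; ring
    rw [e4, neg_div, neg_le_neg_iff, div_le_div_iff₀ (by positivity) (by positivity)]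
    have : c ≤ (1 + q) * (c * (1 + q) + 2 * σ) := by
      have : 0 ≤ q * c + q * (c * (1 + q)) + (1 + q) * (2 * σ) := by positivity
      nlinarith
    nlinarith
  have hmain : ((2 * √(π * h) / q * exp ((q - 1) / (2 * h) * σ - c * h * ((q - 1) / (2 * h)) ^ 2) :
      ℝ) : ℂ) = 1 / p * (Complex.exp E * (Complex.exp (2 * p * a) * (√π : ℝ))) := by
    have e3 : ξ = (q ^ 2 - 1) / (4 * h) := by rw [hq2]; field_simp; ring
    have : 2 * √(π * h) / q * exp ((q - 1) / (2 * h) * σ - c * h * ((q - 1) / (2 * h)) ^ 2) =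
        1 / p * (exp E * (exp (2 * p * a) * √π)) := by
      rw [← mul_assoc (exp E), ← exp_add, sqrt_mul pi_pos.le]
      have e5 : (q - 1) / (2 * h) * σ - c * h * ((q - 1) / (2 * h)) ^ 2 = E + 2 * p * a := by
        rw [hpa, hE, e3]; field_simp; ring
      have e6 : 1 / p = 2 * √h / q := by rw [hp, one_div_div]
      rw [e5, e6]
      ring
    rw [this]
    push_cast
    rfl
  have hdiff : Φ R - Φ (-R) - ((2 * √(π * h) / q *
      exp ((q - 1) / (2 * h) * σ - c * h * ((q - 1) / (2 * h)) ^ 2) : ℝ) : ℂ) =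
      1 / p * (Complex.exp E * (Complex.exp (-(2 * p * a)) * (√π : ℝ)) -
        Complex.exp E * (Complex.exp (2 * p * a) * gaussTail (z₁ R)) -
        Complex.exp E * (Complex.exp (-(2 * p * a)) * gaussTail (z₂ R)) -
        Complex.exp E * (Complex.exp (2 * p * a) * gaussTail (-z₁ (-R))) -
        Complex.exp E * (Complex.exp (-(2 * p * a)) * gaussTail (-z₂ (-R)))) := by
    rw [hmain]
    simp only [Φ]
    rw [hT₁, hT₂]
    ring
  rw [hdiff, norm_mul]
  have hp1 : ‖(1 / p : ℂ)‖ ≤ 4 * √h := by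
    rw [norm_div, norm_one, Complex.norm_real, norm_eq_abs, abs_of_pos hp0, hp, one_div_div,
      div_le_iff₀ hqpos]
    nlinarith
  calc _ ≤ 4 * √h * (2 * exp (-(c / (8 * h))) + exp (-(c / (8 * h))) + exp (-(c / (8 * h))) +
        exp (-(c / (8 * h))) + exp (-(c / (8 * h)))) := by
        exact mul_le_mul hp1 (norm_sub_sub_sub_sub_le g5 g1 g2 g3 g4) (norm_nonneg _)
          (by positivity)
    _ = _ := by ring

theorem continuous_kern {c h : ℝ} (hc : 0 < c) (hh : 0 < h) :
    Continuous fun p : ℝ × ℝ => kern c h p.1 p.2 := by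
  unfold kern
  have := continuous_sqrtC hc
  have h4 : (h : ℂ) ≠ 0 := by exact_mod_cast hh.ne'
  refine Continuous.mul (continuous_const.div (this.comp continuous_snd)
    fun p => sqrtC_ne_zero hc p.2) ?_
  refine Complex.continuous_exp.comp (Continuous.mul (Continuous.neg (continuous_const.div
    (by fun_prop) fun p => ?_)) (by fun_prop))
  exact mul_ne_zero (mul_ne_zero (by norm_num) h4)
    (Complex.slitPlane_ne_zero (mem_slitPlane_add_I_mul hc p.2))

theorem norm_one_div_sqrtC_le {c : ℝ} (hc : 0 < c) (x : ℝ) : ‖1 / sqrtC c x‖ ≤ 1 / √c := by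
  rw [norm_div, norm_one]
  refine one_div_le_one_div_of_le (sqrt_pos.2 hc) ?_
  rw [sqrt_le_left (norm_nonneg _), ← Complex.normSq_eq_norm_sq]
  exact le_normSq_sqrtC c x

theorem norm_kern_le_of_exp_le {c h σ x b : ℝ} (hc : 0 < c)
    (hb : ‖Complex.exp (-(1 / (4 * (h : ℂ) * ((c : ℂ) + Complex.I * x))) *
      ((x : ℂ) + Complex.I * (σ : ℂ)) ^ 2)‖ ≤ b) : ‖kern c h σ x‖ ≤ 1 / √c * b := by
  unfold kern
  rw [norm_mul]
  exact mul_le_mul (norm_one_div_sqrtC_le hc x) hb (norm_nonneg _) (by positivity)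

theorem exp_neg_div_le_sqrt {c h : ℝ} (hc : 0 < c) (hh : 0 < h) (hh1 : h ≤ 1) :
    exp (-(c / (8 * h))) ≤ 8 / c * √h := by
  have h1 : c / (8 * h) ≤ exp (c / (8 * h)) := by linarith [add_one_le_exp (c / (8 * h))]
  have h2 : exp (-(c / (8 * h))) ≤ 8 * h / c := by
    rw [exp_neg, ← inv_div c (8 * h)]
    exact inv_anti₀ (by positivity) h1
  have h3 : h ≤ √h := by
    have : √h ≤ 1 := sqrt_le_one.2 hh1
    nlinarith [sq_sqrt hh.le, sqrt_nonneg h]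
  calc _ ≤ 8 * h / c := h2
    _ = 8 / c * h := by ring
    _ ≤ _ := by gcongr

/-- The modal integrals with `ξ ≤ 0`, bounded by shifting the contour of integration. -/
theorem modal_integral_bound {c Y R : ℝ} (hc : 0 < c) (hY : 0 ≤ Y) (hR : 2 * (c + Y) ≤ R) :
    ∃ C : ℝ, 0 ≤ C ∧ ∀ h σ ξ : ℝ, 0 < h → h ≤ 1 → 0 ≤ σ → σ ≤ Y → ξ ≤ 0 →
      ‖∫ x in -R..R, kern c h σ x * Complex.exp (Complex.I * (ξ * x : ℝ))‖ ≤ C * √h := by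
  set β : ℝ := c / (4 * ((c + Y) ^ 2 + R ^ 2)) with hβ
  refine ⟨1 / √c * √(π / β) + 2 * (1 / √c * (8 / c) * Y), by positivity, ?_⟩
  intro h σ ξ hh hh1 hσ hσY hξ
  have h4 : (h : ℂ) ≠ 0 := by exact_mod_cast hh.ne'
  let f : ℂ → ℂ := fun z => 1 / ((c : ℂ) + Complex.I * z) ^ (1 / 2 : ℂ) *
    Complex.exp (-(1 / (4 * (h : ℂ) * ((c : ℂ) + Complex.I * z))) *
      (z + Complex.I * (σ : ℂ)) ^ 2) * Complex.exp (Complex.I * (ξ * z))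
  -- Moving down by b stays within the family of kernels: c becomes c + b and σ becomes σ - b. The
  -- exponential acquires e^{ξb}, which is at most 1 because ξ ≤ 0.
  have hf : ∀ x b : ℝ, f (x + (-b : ℝ) * Complex.I) = kern (c + b) h (σ - b) x *
      Complex.exp (Complex.I * (ξ * x : ℝ)) * Complex.exp ((ξ * b : ℝ)) := by
    intro x b
    have e1 : (c : ℂ) + Complex.I * (x + (-b : ℝ) * Complex.I) =
        ((c + b : ℝ) : ℂ) + Complex.I * x := by
      push_cast
      linear_combination (-(b : ℂ)) * Complex.I_sq
    have e2 : (x : ℂ) + (-b : ℝ) * Complex.I + Complex.I * σ =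
        (x : ℂ) + Complex.I * ((σ - b : ℝ) : ℂ) := by push_cast; ring
    have e3 : Complex.I * ((ξ : ℂ) * (x + (-b : ℝ) * Complex.I)) =
        Complex.I * (ξ * x : ℝ) + (ξ * b : ℝ) := by
      push_cast
      linear_combination (-(ξ : ℂ) * b) * Complex.I_sq
    simp only [f, kern, sqrtC]
    rw [e1, e2, e3, Complex.exp_add (Complex.I * (ξ * x : ℝ)), mul_assoc _ _ (Complex.exp _)]
  have hfn : ∀ x b : ℝ, 0 ≤ b → ‖f (x + (-b : ℝ) * Complex.I)‖ ≤ ‖kern (c + b) h (σ - b) x‖ := by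
    intro x b hb
    rw [hf, norm_mul, norm_mul, mul_comm Complex.I, Complex.norm_exp_ofReal_mul_I, mul_one,
      Complex.norm_exp, Complex.ofReal_re]
    refine mul_le_of_le_one_right (norm_nonneg _) (exp_le_one_iff.2 ?_)
    exact mul_nonpos_of_nonpos_of_nonneg hξ hb
  have hcb : ∀ b : ℝ, 0 ≤ b → 1 / √(c + b) ≤ 1 / √c := fun b hb =>
    one_div_le_one_div_of_le (sqrt_pos.2 hc) (sqrt_le_sqrt (by linarith))
  -- The contour goes down to depth σ, where the shifted parameter σ is 0 and the modulus of the
  -- kernel has Gaussian decay at rate at least β/h on [-R, R].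
  have hrect := Complex.integral_boundary_rect_eq_zero_of_differentiableOn f
    ((-R : ℝ) + (-σ : ℝ) * Complex.I) ((R : ℝ) + (0 : ℝ) * Complex.I) (by
      intro z hz
      have him : z.im ≤ 0 := by
        have := hz.2
        simp only [Complex.add_im, Complex.ofReal_im, Complex.mul_im, Complex.ofReal_re,
          Complex.I_im, Complex.I_re, mul_one, mul_zero, add_zero, zero_add] at this
        rw [mem_preimage, uIcc_of_le (by linarith)] at this
        exact this.2
      have hs : (c : ℂ) + Complex.I * z ∈ Complex.slitPlane := by
        left
        simp
        linarith
      have hne := Complex.slitPlane_ne_zero hs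
      have hne2 : ((c : ℂ) + Complex.I * z) ^ (1 / 2 : ℂ) ≠ 0 := by
        rw [Complex.cpow_ne_zero_iff]
        exact Or.inl hne
      refine DifferentiableAt.differentiableWithinAt ?_
      have hne3 : 4 * (h : ℂ) * ((c : ℂ) + Complex.I * z) ≠ 0 :=
        mul_ne_zero (mul_ne_zero (by norm_num) h4) hne
      have hd : DifferentiableAt ℂ (fun z : ℂ => (c : ℂ) + Complex.I * z) z := by fun_prop
      refine DifferentiableAt.mul (DifferentiableAt.mul
        ((differentiableAt_const _).div (hd.cpow_const hs) hne2) ?_) (by fun_prop)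
      refine DifferentiableAt.cexp (DifferentiableAt.mul (DifferentiableAt.neg
        ((differentiableAt_const _).div (by fun_prop) hne3)) (by fun_prop)))
  have ere : ∀ a b : ℝ, ((a : ℂ) + (b : ℂ) * Complex.I).re = a := by intro a b; simp
  have eim : ∀ a b : ℝ, ((a : ℂ) + (b : ℂ) * Complex.I).im = b := by intro a b; simp
  rw [ere, ere, eim, eim] at hrect
  have htop : ∫ x in -R..R, f (x + (0 : ℝ) * Complex.I) =
      ∫ x in -R..R, kern c h σ x * Complex.exp (Complex.I * (ξ * x : ℝ)) := by
    refine intervalIntegral.integral_congr fun x _ => ?_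
    have := hf x 0
    simpa using this
  rw [htop] at hrect
  have hbot : ‖∫ x in -R..R, f (x + (-σ : ℝ) * Complex.I)‖ ≤ 1 / √c * √(π / β) * √h := by
    have hg : ∀ x ∈ Ioc (-R) R, ‖f (x + (-σ : ℝ) * Complex.I)‖ ≤
        1 / √c * exp (-(β / h) * x ^ 2) := by
      intro x hx
      refine (hfn x σ hσ).trans ((norm_kern_le_of_exp_le (by linarith) ?_).trans
        (mul_le_mul_of_nonneg_right (hcb σ hσ) (exp_pos _).le))
      rw [norm_kern_exp (by linarith) hh]
      apply exp_le_exp.2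
      rw [neg_mul, neg_le_neg_iff, sub_self]
      have hx2 : x ^ 2 ≤ R ^ 2 := sq_le_sq' (by linarith [hx.1]) hx.2
      have e1 : (x ^ 2 * (c + σ + 2 * 0) - (c + σ) * 0 ^ 2) / (4 * h * ((c + σ) ^ 2 + x ^ 2)) =
          (c + σ) / (4 * ((c + σ) ^ 2 + x ^ 2)) / h * x ^ 2 := by
        field_simp
        ring
      rw [e1, hβ]
      gcongr
      linarith
    have hint : Integrable fun x : ℝ => 1 / √c * exp (-(β / h) * x ^ 2) :=
      (integrable_exp_neg_mul_sq (by positivity)).const_mul _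
    calc _ ≤ ∫ x in -R..R, 1 / √c * exp (-(β / h) * x ^ 2) :=
          intervalIntegral.norm_integral_le_of_norm_le (by linarith)
            (Eventually.of_forall hg) hint.intervalIntegrable
      _ ≤ ∫ x, 1 / √c * exp (-(β / h) * x ^ 2) := by
          rw [intervalIntegral.integral_of_le (by linarith)]
          exact setIntegral_le_integral hint (Eventually.of_forall fun x => by positivity)
      _ = _ := by
          rw [integral_const_mul, integral_gaussian, mul_assoc, ← sqrt_mul (by positivity)]
          congr 2
          field_simp
  -- The sum c + σ is invariant under the shift, so the decay estimate at |x| = R holds along the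
  -- whole vertical side.
  have hside : ∀ r : ℝ, r ^ 2 = R ^ 2 → ‖∫ y in -σ..0, f (r + y * Complex.I)‖ ≤
      1 / √c * (8 / c) * Y * √h := by
    intro r hr
    have hg : ∀ y ∈ uIoc (-σ) 0, ‖f (r + y * Complex.I)‖ ≤ 1 / √c * exp (-(c / (8 * h))) := by
      intro y hy
      rw [uIoc_of_le (by linarith)] at hy
      have hb : 0 ≤ -y := by linarith [hy.2]
      have h1 := hfn r (-y) hb
      rw [neg_neg] at h1
      refine h1.trans ((norm_kern_le_of_exp_le (by linarith) (kern_exp_le_of_far (by linarith) hh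
        (by linarith [hy.1]) (by linarith) hr)).trans ?_)
      refine mul_le_mul (hcb (-y) hb) (exp_le_exp.2 ?_) (exp_pos _).le (by positivity)
      rw [neg_le_neg_iff]
      gcongr
      linarith
    refine (intervalIntegral.norm_integral_le_of_norm_le_const hg).trans ?_
    rw [zero_sub, neg_neg, abs_of_nonneg hσ]
    calc _ ≤ 1 / √c * (8 / c * √h) * Y := by
          gcongr
          exact exp_neg_div_le_sqrt hc hh hh1
      _ = _ := by ring
  have hfin : ∫ x in -R..R, kern c h σ x * Complex.exp (Complex.I * (ξ * x : ℝ)) =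
      (∫ x in -R..R, f (x + (-σ : ℝ) * Complex.I)) +
      Complex.I • (∫ y in -σ..0, f ((R : ℝ) + y * Complex.I)) -
      Complex.I • (∫ y in -σ..0, f ((-R : ℝ) + y * Complex.I)) := by
    linear_combination (-1 : ℂ) * hrect
  rw [hfin]
  refine (norm_sub_le _ _).trans ?_
  refine (add_le_add_left (norm_add_le _ _) _).trans ?_
  rw [norm_smul, norm_smul, Complex.norm_I, one_mul, one_mul]
  have s1 := hside R rfl
  have s2 := hside (-R) (by ring)
  linarith

/-! ### The kernel applied to exponentials -/

/-- The constant factor of the kernel. -/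
def kernConst (h : ℝ) : ℝ := 1 / (2 * π ^ (3 / 2 : ℝ) * √h)

theorem pi_rpow_three_halves : π ^ (3 / 2 : ℝ) = π * √π := by
  rw [sqrt_eq_rpow, ← rpow_one_add' pi_pos.le (by norm_num)]
  norm_num

theorem kernConst_mul_sqrt {h : ℝ} (hh : 0 < h) : kernConst h * √h = 1 / (2 * (π * √π)) := by
  have : √h ≠ 0 := (sqrt_pos.2 hh).ne'
  unfold kernConst
  rw [pi_rpow_three_halves]
  field_simp

theorem kernConst_mul_sqrt_pi {h : ℝ} (hh : 0 < h) : kernConst h * √(π * h) = 1 / (2 * π) := by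
  rw [sqrt_mul pi_pos.le, mul_comm √π, ← mul_assoc, kernConst_mul_sqrt hh]
  have := (sqrt_pos.2 pi_pos).ne'
  field_simp

theorem kernConst_nonneg (h : ℝ) : 0 ≤ kernConst h := by unfold kernConst; positivity

/-- The complex-valued kernel without the constant factor. -/
def cKern (c h y t x : ℝ) : ℂ := ∫ s in (0 : ℝ)..(π / 2), kern c h (√(y ^ 2 - t ^ 2) * sin s) x

theorem K_eq (c h x y t : ℝ) : K c h x y t = kernConst h * (cKern c h y t x).re := by
  unfold K cKern kern kernConst
  rw [intervalIntegral.integral_const_mul]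

theorem continuous_kern_comp {c h : ℝ} (hc : 0 < c) (hh : 0 < h) {E : Type*} [TopologicalSpace E]
    {f g : E → ℝ} (hf : Continuous f) (hg : Continuous g) :
    Continuous fun e => kern c h (f e) (g e) :=
  Continuous.comp (g := fun p : ℝ × ℝ => kern c h p.1 p.2) (f := fun e => (f e, g e))
    (continuous_kern hc hh) (hf.prodMk hg)

theorem continuous_cKern {c h : ℝ} (hc : 0 < c) (hh : 0 < h) (y : ℝ) :
    Continuous fun p : ℝ × ℝ => cKern c h y p.2 p.1 :=
  intervalIntegral.continuous_parametric_intervalIntegral_of_continuous'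
    (f := fun (p : ℝ × ℝ) s => kern c h (√(y ^ 2 - p.2 ^ 2) * sin s) p.1)
    (continuous_kern_comp hc hh (by fun_prop) (by fun_prop)) _ _

theorem continuous_K {c h : ℝ} (hc : 0 < c) (hh : 0 < h) (y : ℝ) :
    Continuous fun p : ℝ × ℝ => K c h p.1 y p.2 := by
  simp only [K_eq]
  exact continuous_const.mul (Complex.continuous_re.comp (continuous_cKern hc hh y))

theorem conj_kern {c : ℝ} (hc : 0 < c) (h σ x : ℝ) :
    (starRingEnd ℂ) (kern c h σ x) = kern c h σ (-x) := by
  unfold kern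
  rw [map_mul, map_div₀, map_one, ← sqrtC_neg hc, ← Complex.exp_conj]
  congr 2
  simp only [map_mul, map_neg, map_div₀, map_one, map_ofNat, Complex.conj_ofReal, map_add,
    Complex.conj_I, map_pow, Complex.ofReal_neg]
  ring

theorem conj_cKern {c : ℝ} (hc : 0 < c) (h y t x : ℝ) :
    (starRingEnd ℂ) (cKern c h y t x) = cKern c h y t (-x) := by
  unfold cKern
  rw [← intervalIntegral.intervalIntegral_conj]
  simp only [conj_kern hc]

/-- The integral of the kernel against `exp (iξx)` over `[-R, R]`. -/
def modalX (c h R ξ σ : ℝ) : ℂ :=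
  ∫ x in -R..R, kern c h σ x * Complex.exp (Complex.I * (ξ * x : ℝ))

theorem continuous_modalX {c h : ℝ} (hc : 0 < c) (hh : 0 < h) (R ξ : ℝ) :
    Continuous (modalX c h R ξ) := by
  unfold modalX
  refine intervalIntegral.continuous_parametric_intervalIntegral_of_continuous' ?_ _ _
  exact (continuous_kern hc hh).mul (by fun_prop)

/-- The real part is the mean of the kernel and its conjugate, and conjugation amounts to x ↦ -x;
hence ξ and -ξ both occur. -/
theorem integral_K_mul_exp {c h : ℝ} (hc : 0 < c) (hh : 0 < h) (y t R ξ : ℝ) :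
    ∫ x in -R..R, (K c h x y t : ℂ) * Complex.exp (Complex.I * (ξ * x : ℝ)) =
      kernConst h / 2 * ((∫ s in (0 : ℝ)..(π / 2), modalX c h R ξ (√(y ^ 2 - t ^ 2) * sin s)) +
        ∫ s in (0 : ℝ)..(π / 2), modalX c h R (-ξ) (√(y ^ 2 - t ^ 2) * sin s)) := by
  have hcont : Continuous fun x => cKern c h y t x :=
    (continuous_cKern hc hh y).comp (f := fun x => (x, t)) (by fun_prop)
  have h1 : ∀ ξ : ℝ, ∫ x in -R..R, cKern c h y t x * Complex.exp (Complex.I * (ξ * x : ℝ)) =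
      ∫ s in (0 : ℝ)..(π / 2), modalX c h R ξ (√(y ^ 2 - t ^ 2) * sin s) := by
    intro ξ
    unfold modalX cKern
    simp only [← intervalIntegral.integral_mul_const]
    refine intervalIntegral_swap_of_continuous ?_ _ _ _ _
    exact (continuous_kern_comp hc hh (by fun_prop) (by fun_prop)).mul (by fun_prop)
  have h2 : ∫ x in -R..R, cKern c h y t (-x) * Complex.exp (Complex.I * (ξ * x : ℝ)) =
      ∫ x in -R..R, cKern c h y t x * Complex.exp (Complex.I * (-ξ * x : ℝ)) := by
    have := intervalIntegral.integral_comp_neg (a := -R) (b := R)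
      (fun x => cKern c h y t x * Complex.exp (Complex.I * (-ξ * x : ℝ)))
    rw [neg_neg] at this
    rw [← this]
    simp
  have h3 : ∀ x, (K c h x y t : ℂ) * Complex.exp (Complex.I * (ξ * x : ℝ)) = kernConst h / 2 *
      (cKern c h y t x * Complex.exp (Complex.I * (ξ * x : ℝ)) +
        cKern c h y t (-x) * Complex.exp (Complex.I * (ξ * x : ℝ))) := by
    intro x
    rw [K_eq, Complex.ofReal_mul, ← conj_cKern hc, ← add_mul, Complex.add_conj]
    push_cast
    ring
  simp only [h3]
  rw [intervalIntegral.integral_const_mul, intervalIntegral.integral_add, h2, h1, h1]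
  · exact Continuous.intervalIntegrable (hcont.mul (by fun_prop)) _ _
  · exact Continuous.intervalIntegrable ((hcont.comp continuous_neg).mul (by fun_prop)) _ _

/-- The integral of `modalX` against `cos (ρt)` over the half-disc. -/
def modalB (c h y R ξ ρ : ℝ) : ℂ :=
  ∫ t in -y..y, ∫ s in (0 : ℝ)..(π / 2),
    (cos (ρ * t) : ℂ) * modalX c h R ξ (√(y ^ 2 - t ^ 2) * sin s)

/-- The kernel applied to `exp (iξx) cos (ρt)`. -/
def modal (c h y R ξ ρ : ℝ) : ℂ :=
  ∫ t in -y..y, ∫ x in -R..R,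
    (K c h x y t : ℂ) * (Complex.exp (Complex.I * (ξ * x : ℝ)) * (cos (ρ * t) : ℂ))

theorem continuous_inner_modalB {c h : ℝ} (hc : 0 < c) (hh : 0 < h) (y R ξ ρ : ℝ) :
    Continuous fun t : ℝ => ∫ s in (0 : ℝ)..(π / 2),
      (cos (ρ * t) : ℂ) * modalX c h R ξ (√(y ^ 2 - t ^ 2) * sin s) := by
  refine intervalIntegral.continuous_parametric_intervalIntegral_of_continuous' ?_ _ _
  have := continuous_modalX hc hh R ξ
  fun_prop

theorem modal_eq {c h : ℝ} (hc : 0 < c) (hh : 0 < h) (y R ξ ρ : ℝ) :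
    modal c h y R ξ ρ = kernConst h / 2 * (modalB c h y R ξ ρ + modalB c h y R (-ξ) ρ) := by
  unfold modal modalB
  rw [← intervalIntegral.integral_add
    ((continuous_inner_modalB hc hh y R ξ ρ).intervalIntegrable _ _)
    ((continuous_inner_modalB hc hh y R (-ξ) ρ).intervalIntegrable _ _),
    ← intervalIntegral.integral_const_mul]
  refine intervalIntegral.integral_congr fun t _ => ?_
  simp only [← mul_assoc, intervalIntegral.integral_mul_const, intervalIntegral.integral_const_mul]
  rw [integral_K_mul_exp hc hh]
  ring

theorem norm_integral_half_disc_le {y M : ℝ} (hy : 0 < y) {F : ℝ → ℝ → ℂ}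
    (hF : ∀ t s, s ∈ Icc 0 (π / 2) → ‖F t s‖ ≤ M) :
    ‖∫ t in -y..y, ∫ s in (0 : ℝ)..(π / 2), F t s‖ ≤ π * y * M := by
  have h1 : ∀ t ∈ uIoc (-y) y, ‖∫ s in (0 : ℝ)..(π / 2), F t s‖ ≤ M * (π / 2) := by
    intro t _
    have := intervalIntegral.norm_integral_le_of_norm_le_const (a := (0 : ℝ)) (b := π / 2) (C := M)
      (f := F t) (fun s hs => by
        rw [uIoc_of_le (by positivity)] at hs
        exact hF t s (Ioc_subset_Icc_self hs))
    rwa [sub_zero, abs_of_pos (by positivity)] at this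
  have := intervalIntegral.norm_integral_le_of_norm_le_const h1
  rw [sub_neg_eq_add, abs_of_pos (by linarith : 0 < y + y)] at this
  linarith

theorem sqrt_mul_sin_mem {y t s : ℝ} (hy : 0 < y) (hs : s ∈ Icc 0 (π / 2)) :
    √(y ^ 2 - t ^ 2) * sin s ∈ Icc 0 y := by
  have h1 : 0 ≤ sin s := sin_nonneg_of_nonneg_of_le_pi hs.1 (by linarith [hs.2, pi_pos])
  have h2 : √(y ^ 2 - t ^ 2) ≤ y := by
    rw [sqrt_le_left hy.le]
    linarith [sq_nonneg t]
  refine ⟨by positivity, ?_⟩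
  calc _ ≤ y * 1 := mul_le_mul h2 (sin_le_one s) h1 hy.le
    _ = y := mul_one y

theorem norm_cos_mul_le (a : ℝ) (z : ℂ) : ‖(cos a : ℂ) * z‖ ≤ ‖z‖ := by
  rw [norm_mul, Complex.norm_real]
  exact mul_le_of_le_one_left (norm_nonneg _) (abs_cos_le_one a)

theorem modalB_approx {c h y R ξ : ℝ} (ρ : ℝ) (hc : 0 < c) (hh : 0 < h) (hy : 0 < y)
    (hR : 2 * (c + y) ≤ R) (hξ : -(3 / 4) ≤ 4 * h * ξ) :
    ‖modalB c h y R ξ ρ - ((2 * √(π * h) / √(1 + 4 * h * ξ) *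
      exp (-(c * h * ((√(1 + 4 * h * ξ) - 1) / (2 * h)) ^ 2)) *
      halfMean y ((√(1 + 4 * h * ξ) - 1) / (2 * h)) ρ : ℝ) : ℂ)‖ ≤
      π * y * (24 * √h * exp (-(c / (8 * h)))) := by
  set κ := (√(1 + 4 * h * ξ) - 1) / (2 * h) with hκ
  set A := 2 * √(π * h) / √(1 + 4 * h * ξ) with hA
  have e1 : ((A * exp (-(c * h * κ ^ 2)) * halfMean y κ ρ : ℝ) : ℂ) =
      ∫ t in -y..y, ∫ s in (0 : ℝ)..(π / 2), (cos (ρ * t) : ℂ) *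
        ((A * exp (κ * (√(y ^ 2 - t ^ 2) * sin s) - c * h * κ ^ 2) : ℝ) : ℂ) := by
    unfold halfMean
    simp only [← intervalIntegral.integral_const_mul]
    rw [← intervalIntegral.integral_ofReal]
    refine intervalIntegral.integral_congr fun t _ => ?_
    rw [← intervalIntegral.integral_ofReal]
    refine intervalIntegral.integral_congr fun s _ => ?_
    have e : exp (κ * (√(y ^ 2 - t ^ 2) * sin s) - c * h * κ ^ 2) =
        exp (κ * (√(y ^ 2 - t ^ 2) * sin s)) * exp (-(c * h * κ ^ 2)) := by
      rw [← exp_add, sub_eq_add_neg]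
    rw [e]
    push_cast
    ring
  have hc2 : Continuous fun t : ℝ => ∫ s in (0 : ℝ)..(π / 2), (cos (ρ * t) : ℂ) *
        ((A * exp (κ * (√(y ^ 2 - t ^ 2) * sin s) - c * h * κ ^ 2) : ℝ) : ℂ) :=
    intervalIntegral.continuous_parametric_intervalIntegral_of_continuous' (by fun_prop) _ _
  have hm := continuous_modalX hc hh R ξ
  rw [e1]
  unfold modalB
  rw [← intervalIntegral.integral_sub
    ((continuous_inner_modalB hc hh y R ξ ρ).intervalIntegrable _ _) (hc2.intervalIntegrable _ _)]
  have e2 : ∀ t : ℝ, (∫ s in (0 : ℝ)..(π / 2),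
      (cos (ρ * t) : ℂ) * modalX c h R ξ (√(y ^ 2 - t ^ 2) * sin s)) -
      (∫ s in (0 : ℝ)..(π / 2), (cos (ρ * t) : ℂ) *
        ((A * exp (κ * (√(y ^ 2 - t ^ 2) * sin s) - c * h * κ ^ 2) : ℝ) : ℂ)) =
      ∫ s in (0 : ℝ)..(π / 2), (cos (ρ * t) : ℂ) *
        (modalX c h R ξ (√(y ^ 2 - t ^ 2) * sin s) -
          ((A * exp (κ * (√(y ^ 2 - t ^ 2) * sin s) - c * h * κ ^ 2) : ℝ) : ℂ)) := by
    intro t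
    rw [← intervalIntegral.integral_sub (Continuous.intervalIntegrable (by fun_prop) _ _)
      (Continuous.intervalIntegrable (by fun_prop) _ _)]
    simp only [mul_sub]
  simp only [e2]
  refine norm_integral_half_disc_le hy fun t s hs => ?_
  have hσ := sqrt_mul_sin_mem (t := t) hy hs
  have := norm_cos_mul_le (ρ * t) (modalX c h R ξ (√(y ^ 2 - t ^ 2) * sin s) -
          ((A * exp (κ * (√(y ^ 2 - t ^ 2) * sin s) - c * h * κ ^ 2) : ℝ) : ℂ))
  refine this.trans ?_
  exact modal_integral_approx (R := R) hc hh hσ.1 (by linarith [hσ.2]) hξ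

/-- The upper bound keeps κ below ρ whenever ξ is, so Poisson's formula stays available at the
perturbed frequency. -/
theorem kappa_bounds {h ξ : ℝ} (hh : 0 < h) (hξ : 0 ≤ ξ) :
    1 ≤ √(1 + 4 * h * ξ) ∧ 0 ≤ (√(1 + 4 * h * ξ) - 1) / (2 * h) ∧
      (√(1 + 4 * h * ξ) - 1) / (2 * h) ≤ ξ := by
  have h1 : 1 ≤ √(1 + 4 * h * ξ) := by
    rw [one_le_sqrt]
    have : 0 ≤ 4 * h * ξ := by positivity
    linarith
  refine ⟨h1, div_nonneg (by linarith) (by positivity), ?_⟩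
  rw [div_le_iff₀ (by positivity), sub_le_iff_le_add]
  rw [sqrt_le_left (by positivity)]
  nlinarith [sq_nonneg (h * ξ)]

theorem norm_modalB_le_of_nonneg {c h y R ξ ρ : ℝ} (hc : 0 < c) (hh : 0 < h) (hy : 0 < y)
    (hR : 2 * (c + y) ≤ R) (hξ : 0 ≤ ξ) (hρ : ξ < ρ) :
    ‖modalB c h y R ξ ρ‖ ≤ (2 * √π * (3 * π * y) + π * y * 24) * √h := by
  have h0 : 0 ≤ 4 * h * ξ := by positivity
  have h1 := modalB_approx ρ hc hh hy hR (by linarith : -(3 / 4) ≤ 4 * h * ξ)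
  obtain ⟨hq, hκ0, hκ1⟩ := kappa_bounds hh hξ
  set q := √(1 + 4 * h * ξ)
  set κ := (q - 1) / (2 * h)
  have h2 : ‖((2 * √(π * h) / q * exp (-(c * h * κ ^ 2)) * halfMean y κ ρ : ℝ) : ℂ)‖ ≤
      2 * √(π * h) * 1 * (3 * π * y) := by
    rw [Complex.norm_real, norm_eq_abs, abs_mul, abs_mul, abs_exp,
      abs_of_nonneg (by positivity : 0 ≤ 2 * √(π * h) / q)]
    have e1 : exp (-(c * h * κ ^ 2)) ≤ 1 := by
      rw [exp_le_one_iff, neg_nonpos]; positivity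
    have e2 : 2 * √(π * h) / q ≤ 2 * √(π * h) := div_le_self (by positivity) hq
    exact mul_le_mul (mul_le_mul e2 e1 (exp_pos _).le (by positivity))
      (abs_halfMean_le hy hκ0 (hκ1.trans_lt hρ)) (abs_nonneg _) (by positivity)
  have h3 : exp (-(c / (8 * h))) ≤ 1 := by
    rw [exp_le_one_iff, neg_nonpos]; positivity
  have h4 := norm_le_norm_add_norm_sub' (modalB c h y R ξ ρ)
    ((2 * √(π * h) / q * exp (-(c * h * κ ^ 2)) * halfMean y κ ρ : ℝ) : ℂ)
  rw [sqrt_mul pi_pos.le] at h2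
  rw [sqrt_mul pi_pos.le] at h1 h4
  have h5 : π * y * (24 * √h * exp (-(c / (8 * h)))) ≤ π * y * (24 * √h * 1) := by gcongr
  linarith

/-- One of ξ, -ξ is nonnegative and is controlled by Poisson's formula; the other is controlled by
the contour shift. Both bounds are of order √h uniformly in the frequencies, and the constant of the
kernel contributes 1/√h. -/
theorem modal_bound {c y R : ℝ} (hc : 0 < c) (hy : 0 < y) (hR : 2 * (c + y) ≤ R) :
    ∃ C : ℝ, ∀ h ξ ρ : ℝ, 0 < h → h ≤ 1 → |ξ| < ρ → ‖modal c h y R ξ ρ‖ ≤ C := by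
  obtain ⟨C, hC0, hC⟩ := modal_integral_bound hc hy.le hR
  have hneg : ∀ h ξ ρ : ℝ, 0 < h → h ≤ 1 → ξ ≤ 0 → ‖modalB c h y R ξ ρ‖ ≤ π * y * C * √h := by
    intro h ξ ρ hh hh1 hξ
    rw [mul_assoc]
    refine norm_integral_half_disc_le hy fun t s hs => ?_
    have hσ := sqrt_mul_sin_mem (t := t) hy hs
    have := norm_cos_mul_le (ρ * t) (modalX c h R ξ (√(y ^ 2 - t ^ 2) * sin s))
    exact this.trans (hC h _ ξ hh hh1 hσ.1 hσ.2 hξ)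
  refine ⟨1 / (2 * (π * √π)) / 2 * ((2 * √π * (3 * π * y) + π * y * 24) + π * y * C), ?_⟩
  intro h ξ ρ hh hh1 hξ
  have hk : ‖((kernConst h / 2 : ℂ))‖ = kernConst h / 2 := by
    rw [norm_div, Complex.norm_real, norm_eq_abs, abs_of_nonneg (kernConst_nonneg h)]
    simp
  rw [modal_eq hc hh, norm_mul, hk, ← kernConst_mul_sqrt hh]
  have hsum : ‖modalB c h y R ξ ρ + modalB c h y R (-ξ) ρ‖ ≤
      (2 * √π * (3 * π * y) + π * y * 24) * √h + π * y * C * √h := by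
    refine (norm_add_le _ _).trans ?_
    rcases le_total 0 ξ with h0 | h0
    · exact add_le_add (norm_modalB_le_of_nonneg hc hh hy hR h0 (lt_of_abs_lt hξ))
        (hneg h _ ρ hh hh1 (by linarith))
    · rw [add_comm]
      exact add_le_add (norm_modalB_le_of_nonneg hc hh hy hR (by linarith)
        (by linarith [neg_abs_le ξ])) (hneg h _ ρ hh hh1 h0)
  calc _ ≤ kernConst h / 2 * ((2 * √π * (3 * π * y) + π * y * 24) * √h + π * y * C * √h) :=
        mul_le_mul_of_nonneg_left hsum (div_nonneg (kernConst_nonneg h) (by norm_num))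
    _ = _ := by ring

/-! ### Limits of the modal integrals as h → 0+ -/

theorem tendsto_kappa (ξ : ℝ) :
    Tendsto (fun h : ℝ => (√(1 + 4 * h * ξ) - 1) / (2 * h)) (𝓝[>] 0) (𝓝 ξ) := by
  -- Rationalising the numerator gives κ = 2ξ/(√(1 + 4hξ) + 1), which is continuous at h = 0.
  have h1 : Tendsto (fun h : ℝ => 2 * ξ / (√(1 + 4 * h * ξ) + 1)) (𝓝[>] 0) (𝓝 ξ) := by
    have : Continuous fun h : ℝ => 2 * ξ / (√(1 + 4 * h * ξ) + 1) := by
      refine continuous_const.div (by fun_prop) fun h => ?_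
      positivity
    have h2 := this.tendsto 0
    have e : 2 * ξ / (√(1 + 4 * 0 * ξ) + 1) = ξ := by
      rw [mul_zero, zero_mul, add_zero, sqrt_one]; ring
    rw [e] at h2
    exact h2.mono_left nhdsWithin_le_nhds
  refine h1.congr' ?_
  have hev : ∀ᶠ h : ℝ in 𝓝[>] 0, 0 ≤ 1 + 4 * h * ξ := by
    have : Tendsto (fun h : ℝ => 1 + 4 * h * ξ) (𝓝 0) (𝓝 (1 + 4 * 0 * ξ)) :=
      Continuous.tendsto (by fun_prop) 0
    have h2 := this.eventually (lt_mem_nhds (by norm_num : (0 : ℝ) < 1 + 4 * 0 * ξ))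
    exact (h2.filter_mono nhdsWithin_le_nhds).mono fun h hh => le_of_lt hh
  filter_upwards [hev, self_mem_nhdsWithin] with h h3 hh
  have hh' : 0 < h := hh
  have h4 := sq_sqrt h3
  rw [div_eq_div_iff (by positivity) (by positivity)]
  linear_combination -h4

theorem tendsto_exp_neg_div {a : ℝ} (ha : 0 < a) :
    Tendsto (fun h : ℝ => exp (-(a / h))) (𝓝[>] 0) (𝓝 0) := by
  refine tendsto_exp_neg_atTop_nhds_zero.comp ?_
  exact (tendsto_inv_nhdsGT_zero.const_mul_atTop ha).congr fun h => (div_eq_mul_inv _ _).symm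

theorem tendsto_kernConst_modalB {c y R : ℝ} (hc : 0 < c) (hy : 0 < y) (hR : 2 * (c + y) ≤ R)
    (ξ ρ : ℝ) : Tendsto (fun h : ℝ => (kernConst h / 2 : ℂ) * modalB c h y R ξ ρ) (𝓝[>] 0)
      (𝓝 ((1 / (2 * π) * halfMean y ξ ρ : ℝ) : ℂ)) := by
  have hk := tendsto_kappa ξ
  have hmain : Tendsto (fun h : ℝ => 1 / (2 * π) * (1 / √(1 + 4 * h * ξ) *
      exp (-(c * h * ((√(1 + 4 * h * ξ) - 1) / (2 * h)) ^ 2)) *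
      halfMean y ((√(1 + 4 * h * ξ) - 1) / (2 * h)) ρ)) (𝓝[>] 0)
      (𝓝 (1 / (2 * π) * (1 * 1 * halfMean y ξ ρ))) := by
    refine Tendsto.const_mul _ (Tendsto.mul (Tendsto.mul ?_ ?_)
      (((continuous_halfMean y ρ).tendsto ξ).comp hk))
    · have : Tendsto (fun h : ℝ => √(1 + 4 * h * ξ)) (𝓝 0) (𝓝 √(1 + 4 * 0 * ξ)) :=
        Continuous.tendsto (by fun_prop) 0
      rw [mul_zero, zero_mul, add_zero, sqrt_one] at this
      simpa using (this.mono_left nhdsWithin_le_nhds).inv₀ one_ne_zero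
    · have h1 : Tendsto (fun h : ℝ => c * h) (𝓝[>] 0) (𝓝 0) := by
        have : Tendsto (fun h : ℝ => c * h) (𝓝 0) (𝓝 (c * 0)) := Continuous.tendsto (by fun_prop) 0
        rw [mul_zero] at this
        exact this.mono_left nhdsWithin_le_nhds
      have h2 := (h1.mul (hk.pow 2)).neg
      rw [zero_mul, neg_zero] at h2
      have h3 := (continuous_exp.tendsto 0).comp h2
      rwa [exp_zero] at h3
  rw [one_mul, one_mul] at hmain
  have hmainC := (Complex.continuous_ofReal.tendsto _).comp hmain
  have hdiff : Tendsto (fun h : ℝ => (kernConst h / 2 : ℂ) * modalB c h y R ξ ρ -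
      ((1 / (2 * π) * (1 / √(1 + 4 * h * ξ) *
      exp (-(c * h * ((√(1 + 4 * h * ξ) - 1) / (2 * h)) ^ 2)) *
      halfMean y ((√(1 + 4 * h * ξ) - 1) / (2 * h)) ρ) : ℝ) : ℂ)) (𝓝[>] 0) (𝓝 0) := by
    have hz : Tendsto (fun h : ℝ => 1 / (2 * (π * √π)) / 2 * (π * y * 24) * exp (-(c / 8 / h)))
        (𝓝[>] 0) (𝓝 0) := by
      simpa using (tendsto_exp_neg_div (by positivity : 0 < c / 8)).const_mul
        (1 / (2 * (π * √π)) / 2 * (π * y * 24))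
    refine squeeze_zero_norm' ?_ hz
    have hev : ∀ᶠ h : ℝ in 𝓝[>] 0, -(3 / 4) ≤ 4 * h * ξ := by
      have : Tendsto (fun h : ℝ => 4 * h * ξ) (𝓝 0) (𝓝 (4 * 0 * ξ)) :=
        Continuous.tendsto (by fun_prop) 0
      have h2 := this.eventually (lt_mem_nhds (by norm_num : -(3 / 4 : ℝ) < 4 * 0 * ξ))
      exact (h2.filter_mono nhdsWithin_le_nhds).mono fun h hh => le_of_lt hh
    filter_upwards [hev, self_mem_nhdsWithin] with h h3 hh
    have hh' : 0 < h := hh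
    have h1 := modalB_approx ρ hc hh' hy hR h3
    set q := √(1 + 4 * h * ξ)
    set κ := (q - 1) / (2 * h)
    have e1 : 1 / (2 * π) * (1 / q * exp (-(c * h * κ ^ 2)) * halfMean y κ ρ) = kernConst h / 2 *
        (2 * √(π * h) / q * exp (-(c * h * κ ^ 2)) * halfMean y κ ρ) := by
      rw [← kernConst_mul_sqrt_pi hh']
      ring
    rw [e1, Complex.ofReal_mul (kernConst h / 2)]
    have e2 : ((kernConst h / 2 : ℝ) : ℂ) = kernConst h / 2 := by push_cast; rfl
    rw [e2, ← mul_sub, norm_mul]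
    have hk : ‖((kernConst h / 2 : ℂ))‖ = kernConst h / 2 := by
      rw [norm_div, Complex.norm_real, norm_eq_abs, abs_of_nonneg (kernConst_nonneg h)]
      simp
    rw [hk, ← kernConst_mul_sqrt hh']
    calc _ ≤ kernConst h / 2 * (π * y * (24 * √h * exp (-(c / (8 * h))))) :=
          mul_le_mul_of_nonneg_left h1 (div_nonneg (kernConst_nonneg h) (by norm_num))
      _ = _ := by rw [div_div]; ring
  have := hdiff.add hmainC
  rw [zero_add] at this
  refine this.congr fun h => ?_
  simp only [Function.comp_apply]
  ring

theorem tendsto_modal {c y R ξ ρ : ℝ} (hc : 0 < c) (hy : 0 < y) (hR : 2 * (c + y) ≤ R)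
    (hξ : |ξ| < ρ) : Tendsto (fun h : ℝ => modal c h y R ξ ρ) (𝓝[>] 0)
      (𝓝 ((sin (√(ρ ^ 2 - ξ ^ 2) * y) / √(ρ ^ 2 - ξ ^ 2) : ℝ) : ℂ)) := by
  have h := (tendsto_kernConst_modalB hc hy hR ξ ρ).add (tendsto_kernConst_modalB hc hy hR (-ξ) ρ)
  have e : ((1 / (2 * π) * halfMean y ξ ρ : ℝ) : ℂ) + ((1 / (2 * π) * halfMean y (-ξ) ρ : ℝ) : ℂ) =
      ((sin (√(ρ ^ 2 - ξ ^ 2) * y) / √(ρ ^ 2 - ξ ^ 2) : ℝ) : ℂ) := by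
    rw [← Complex.ofReal_add, ← mul_add, halfMean_add_neg hy hξ]
    congr 1
    field_simp
  rw [e] at h
  refine h.congr' ?_
  filter_upwards [self_mem_nhdsWithin] with h hh
  rw [modal_eq hc hh, mul_add]

/-! ### Operations on gradients of waves -/

section WaveGradOps

variable {dx dy dt dxx dyy dxt dyt fx fy ft fxx fyy fxt fyt : ℝ → ℝ → ℝ → ℝ}

theorem WaveGrad.half_add (h : WaveGrad dx dy dt dxx dyy dxt dyt)
    (k : WaveGrad fx fy ft fxx fyy fxt fyt) :
    WaveGrad (fun x y t => (dx x y t + fx x y t) / 2) (fun x y t => (dy x y t + fy x y t) / 2)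
      (fun x y t => (dt x y t + ft x y t) / 2) (fun x y t => (dxx x y t + fxx x y t) / 2)
      (fun x y t => (dyy x y t + fyy x y t) / 2) (fun x y t => (dxt x y t + fxt x y t) / 2)
      (fun x y t => (dyt x y t + fyt x y t) / 2) where
  cx := (h.cx.add k.cx).div_const 2
  cy := (h.cy.add k.cy).div_const 2
  ct := (h.ct.add k.ct).div_const 2
  cxx := (h.cxx.add k.cxx).div_const 2
  cyy := (h.cyy.add k.cyy).div_const 2
  cxt := (h.cxt.add k.cxt).div_const 2
  cyt := (h.cyt.add k.cyt).div_const 2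
  x_x x y t := ((h.x_x x y t).add (k.x_x x y t)).div_const 2
  y_y x y t := ((h.y_y x y t).add (k.y_y x y t)).div_const 2
  x_t x y t := ((h.x_t x y t).add (k.x_t x y t)).div_const 2
  t_x x y t := ((h.t_x x y t).add (k.t_x x y t)).div_const 2
  y_t x y t := ((h.y_t x y t).add (k.y_t x y t)).div_const 2
  t_y x y t := ((h.t_y x y t).add (k.t_y x y t)).div_const 2
  t_t x y t := (((h.t_t x y t).add (k.t_t x y t)).div_const 2).congr_deriv (by ring)

theorem hasDerivAt_comp_neg_id {f : ℝ → ℝ} {f' t : ℝ} (h : HasDerivAt f f' (-t)) :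
    HasDerivAt (fun s => f (-s)) (-f') t := by
  exact (HasDerivAt.scomp t h (hasDerivAt_neg t)).congr_deriv (by simp)

/-- Averaging with the time reversal yields the time-even part, whose velocity at t = 0 is zero. -/
theorem WaveGrad.reverse (h : WaveGrad dx dy dt dxx dyy dxt dyt) :
    WaveGrad (fun x y t => dx x y (-t)) (fun x y t => dy x y (-t))
      (fun x y t => -dt x y (-t)) (fun x y t => dxx x y (-t))
      (fun x y t => dyy x y (-t)) (fun x y t => -dxt x y (-t))
      (fun x y t => -dyt x y (-t)) := by
  have hc : Continuous fun p : ℝ × ℝ × ℝ => (p.1, p.2.1, -p.2.2) := by fun_prop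
  exact
  { cx := h.cx.comp hc
    cy := h.cy.comp hc
    ct := (h.ct.comp hc).neg
    cxx := h.cxx.comp hc
    cyy := h.cyy.comp hc
    cxt := (h.cxt.comp hc).neg
    cyt := (h.cyt.comp hc).neg
    x_x := fun x y t => h.x_x x y (-t)
    y_y := fun x y t => h.y_y x y (-t)
    x_t := fun x y t => hasDerivAt_comp_neg_id (h.x_t x y (-t))
    t_x := fun x y t => (h.t_x x y (-t)).neg
    y_t := fun x y t => hasDerivAt_comp_neg_id (h.y_t x y (-t))
    t_y := fun x y t => (h.t_y x y (-t)).neg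
    t_t := fun x y t => ((hasDerivAt_comp_neg_id (h.t_t x y (-t))).neg).congr_deriv (by ring) }

theorem WaveGrad.translate (h : WaveGrad dx dy dt dxx dyy dxt dyt) (x₀ t₀ : ℝ) :
    WaveGrad (fun x y t => dx (x₀ + x) y (t₀ + t)) (fun x y t => dy (x₀ + x) y (t₀ + t))
      (fun x y t => dt (x₀ + x) y (t₀ + t)) (fun x y t => dxx (x₀ + x) y (t₀ + t))
      (fun x y t => dyy (x₀ + x) y (t₀ + t)) (fun x y t => dxt (x₀ + x) y (t₀ + t))
      (fun x y t => dyt (x₀ + x) y (t₀ + t)) := by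
  have hc : Continuous fun p : ℝ × ℝ × ℝ => (x₀ + p.1, p.2.1, t₀ + p.2.2) := by fun_prop
  exact
  { cx := h.cx.comp hc
    cy := h.cy.comp hc
    ct := h.ct.comp hc
    cxx := h.cxx.comp hc
    cyy := h.cyy.comp hc
    cxt := h.cxt.comp hc
    cyt := h.cyt.comp hc
    x_x := fun x y t => (h.x_x (x₀ + x) y (t₀ + t)).comp_const_add x₀ x
    y_y := fun x y t => h.y_y (x₀ + x) y (t₀ + t)
    x_t := fun x y t => (h.x_t (x₀ + x) y (t₀ + t)).comp_const_add t₀ t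
    t_x := fun x y t => (h.t_x (x₀ + x) y (t₀ + t)).comp_const_add x₀ x
    y_t := fun x y t => (h.y_t (x₀ + x) y (t₀ + t)).comp_const_add t₀ t
    t_y := fun x y t => h.t_y (x₀ + x) y (t₀ + t)
    t_t := fun x y t => (h.t_t (x₀ + x) y (t₀ + t)).comp_const_add t₀ t }

end WaveGradOps

/-! ### Gradients of smooth solutions on the whole space -/

theorem contDiff_pd {f : ℝ × ℝ × ℝ → ℝ} (hf : ContDiff ℝ ∞ f) (e : ℝ × ℝ × ℝ) :
    ContDiff ℝ ∞ (pd e f) :=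
  (hf.fderiv_right (by simp)).clm_apply contDiff_const

theorem pd_comm {f : ℝ × ℝ × ℝ → ℝ} (hf : ContDiff ℝ ∞ f) (a b p : ℝ × ℝ × ℝ) :
    pd a (pd b f) p = pd b (pd a f) p := by
  have h2 : ∀ a b : ℝ × ℝ × ℝ, pd a (pd b f) p = fderiv ℝ (fderiv ℝ f) p a b := by
    intro a b
    have hd : DifferentiableAt ℝ (fderiv ℝ f) p :=
      ((hf.fderiv_right (m := ∞) (by simp)).differentiable (by simp)) p
    unfold pd
    rw [fderiv_clm_apply hd (by fun_prop)]
    simp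
  rw [h2, h2]
  refine (hf.contDiffAt (x := p)).isSymmSndFDerivAt ?_ a b
  simp only [minSmoothness_of_isRCLikeNormedField]
  exact WithTop.coe_le_coe.2 le_top

theorem hasDerivAt_pd {f : ℝ × ℝ × ℝ → ℝ} (hf : ContDiff ℝ ∞ f) {γ : ℝ → ℝ × ℝ × ℝ}
    {e : ℝ × ℝ × ℝ} {s : ℝ} (hγ : HasDerivAt γ e s) :
    HasDerivAt (fun s => f (γ s)) (pd e f (γ s)) s :=
  ((hf.differentiable (by simp)) (γ s)).hasFDerivAt.comp_hasDerivAt s hγ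

theorem hasDerivAt_line_x (x y t : ℝ) : HasDerivAt (fun s : ℝ => (s, y, t)) ex x :=
  (hasDerivAt_id x).prodMk ((hasDerivAt_const x y).prodMk (hasDerivAt_const x t))

theorem hasDerivAt_line_y (x y t : ℝ) : HasDerivAt (fun s : ℝ => (x, s, t)) ey y :=
  (hasDerivAt_const y x).prodMk ((hasDerivAt_id y).prodMk (hasDerivAt_const y t))

theorem hasDerivAt_line_t (x y t : ℝ) : HasDerivAt (fun s : ℝ => (x, y, s)) et t :=
  (hasDerivAt_const t x).prodMk ((hasDerivAt_const t y).prodMk (hasDerivAt_id t))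

theorem waveGrad_of_contDiff {f : ℝ × ℝ × ℝ → ℝ} (hf : ContDiff ℝ ∞ f)
    (hw : ∀ p, pd et (pd et f) p = pd ex (pd ex f) p + pd ey (pd ey f) p) :
    WaveGrad (fun x y t => pd ex f (x, y, t)) (fun x y t => pd ey f (x, y, t))
      (fun x y t => pd et f (x, y, t)) (fun x y t => pd ex (pd ex f) (x, y, t))
      (fun x y t => pd ey (pd ey f) (x, y, t)) (fun x y t => pd et (pd ex f) (x, y, t))
      (fun x y t => pd et (pd ey f) (x, y, t)) := by
  have h1 := contDiff_pd hf
  exact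
  { cx := (h1 ex).continuous
    cy := (h1 ey).continuous
    ct := (h1 et).continuous
    cxx := (contDiff_pd (h1 ex) ex).continuous
    cyy := (contDiff_pd (h1 ey) ey).continuous
    cxt := (contDiff_pd (h1 ex) et).continuous
    cyt := (contDiff_pd (h1 ey) et).continuous
    x_x := fun x y t => hasDerivAt_pd (h1 ex) (hasDerivAt_line_x x y t)
    y_y := fun x y t => hasDerivAt_pd (h1 ey) (hasDerivAt_line_y x y t)
    x_t := fun x y t => hasDerivAt_pd (h1 ex) (hasDerivAt_line_t x y t)
    t_x := fun x y t => by
      rw [pd_comm hf]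
      exact hasDerivAt_pd (h1 et) (hasDerivAt_line_x x y t)
    y_t := fun x y t => hasDerivAt_pd (h1 ey) (hasDerivAt_line_t x y t)
    t_y := fun x y t => by
      rw [pd_comm hf]
      exact hasDerivAt_pd (h1 et) (hasDerivAt_line_y x y t)
    t_t := fun x y t => by
      rw [← hw]
      exact hasDerivAt_pd (h1 et) (hasDerivAt_line_t x y t) }

/-! ### Superpositions of plane waves -/

/-- Functions that are integrable against every power of the norm. -/
structure RapidlyIntegrable (a : EuclideanSpace ℝ (Fin 2) → ℂ) : Prop where
  cont : Continuous a
  int : ∀ k : ℕ, Integrable fun w => ‖w‖ ^ k * ‖a w‖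

theorem RapidlyIntegrable.integrable {a : EuclideanSpace ℝ (Fin 2) → ℂ}
    (ha : RapidlyIntegrable a) : Integrable a :=
  (ha.int 0).mono' ha.cont.aestronglyMeasurable (Eventually.of_forall fun w => by simp)

/-- Multiplication by `i b`. -/
def mulI (b : EuclideanSpace ℝ (Fin 2) → ℝ) (a : EuclideanSpace ℝ (Fin 2) → ℂ)
    (w : EuclideanSpace ℝ (Fin 2)) : ℂ := Complex.I * b w * a w

theorem RapidlyIntegrable.mulI {a : EuclideanSpace ℝ (Fin 2) → ℂ} (ha : RapidlyIntegrable a)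
    {b : EuclideanSpace ℝ (Fin 2) → ℝ} (hb : Continuous b) {C : ℝ}
    (hbC : ∀ w, |b w| ≤ C * ‖w‖) : RapidlyIntegrable (mulI b a) where
  cont := by
    have := ha.cont
    unfold WaveCauchy.mulI
    fun_prop
  int k := by
    have := ha.cont
    refine ((ha.int (k + 1)).const_mul C).mono' (by unfold WaveCauchy.mulI; fun_prop)
      (Eventually.of_forall fun w => ?_)
    rw [norm_mul, norm_pow, norm_norm, norm_norm]
    unfold WaveCauchy.mulI
    rw [norm_mul, norm_mul, Complex.norm_I, one_mul, Complex.norm_real, norm_eq_abs]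
    calc ‖w‖ ^ k * (|b w| * ‖a w‖) ≤ ‖w‖ ^ k * (C * ‖w‖ * ‖a w‖) := by
          gcongr
          exact hbC w
      _ = _ := by ring

/-- The frequency in `x`. -/
def freqX (w : EuclideanSpace ℝ (Fin 2)) : ℝ := 2 * π * w 0
/-- The frequency in `y`. -/
def freqY (w : EuclideanSpace ℝ (Fin 2)) : ℝ := 2 * π * w 1
/-- The frequency in `t`. -/
def freqT (w : EuclideanSpace ℝ (Fin 2)) : ℝ := 2 * π * ‖w‖

theorem continuous_freqX : Continuous freqX := by unfold freqX; fun_prop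
theorem continuous_freqY : Continuous freqY := by unfold freqY; fun_prop
theorem continuous_freqT : Continuous freqT := by unfold freqT; fun_prop

theorem freqT_sq (w : EuclideanSpace ℝ (Fin 2)) : freqT w ^ 2 = freqX w ^ 2 + freqY w ^ 2 := by
  unfold freqT freqX freqY
  rw [mul_pow, EuclideanSpace.norm_sq_eq, Fin.sum_univ_two, norm_eq_abs, norm_eq_abs, sq_abs,
    sq_abs]
  ring

theorem abs_freqX_le (w : EuclideanSpace ℝ (Fin 2)) : |freqX w| ≤ 2 * π * ‖w‖ := by
  have h := freqT_sq w
  refine abs_le_of_sq_le_sq ?_ (by positivity)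
  have : freqT w ^ 2 = (2 * π * ‖w‖) ^ 2 := rfl
  nlinarith [sq_nonneg (freqY w)]

theorem abs_freqY_le (w : EuclideanSpace ℝ (Fin 2)) : |freqY w| ≤ 2 * π * ‖w‖ := by
  have h := freqT_sq w
  refine abs_le_of_sq_le_sq ?_ (by positivity)
  have : freqT w ^ 2 = (2 * π * ‖w‖) ^ 2 := rfl
  nlinarith [sq_nonneg (freqX w)]

theorem abs_freqT_le (w : EuclideanSpace ℝ (Fin 2)) : |freqT w| ≤ 2 * π * ‖w‖ := by
  unfold freqT
  rw [abs_of_nonneg (by positivity)]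

/-- The superposition of plane waves with amplitude `a`. -/
def planeWaves (a : EuclideanSpace ℝ (Fin 2) → ℂ) (x y t : ℝ) : ℂ :=
  ∫ w, a w * Complex.exp (Complex.I * (freqX w * x + freqY w * y + freqT w * t : ℝ))

theorem norm_exp_I_mul (r : ℝ) : ‖Complex.exp (Complex.I * r)‖ = 1 := by
  rw [mul_comm, Complex.norm_exp_ofReal_mul_I]

theorem continuous_planeWaves {a : EuclideanSpace ℝ (Fin 2) → ℂ} (ha : RapidlyIntegrable a) :
    Continuous fun p : ℝ × ℝ × ℝ => planeWaves a p.1 p.2.1 p.2.2 := by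
  have h1 := continuous_freqX
  have h2 := continuous_freqY
  have h3 := continuous_freqT
  have h4 := ha.cont
  unfold planeWaves
  refine continuous_of_dominated (bound := fun w => ‖a w‖) (fun p => ?_)
    (fun p => Eventually.of_forall fun w => ?_) ha.integrable.norm
    (Eventually.of_forall fun w => ?_)
  · exact Continuous.aestronglyMeasurable (by fun_prop)
  · rw [norm_mul, norm_exp_I_mul, mul_one]
  · fun_prop

theorem hasDerivAt_integral_exp {a : EuclideanSpace ℝ (Fin 2) → ℂ}
    {b β : EuclideanSpace ℝ (Fin 2) → ℝ} (ha : RapidlyIntegrable a)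
    (hb : Continuous b) (hβ : Continuous β) {C : ℝ} (hbC : ∀ w, |b w| ≤ C * ‖w‖) (s : ℝ) :
    HasDerivAt (fun s : ℝ => ∫ w, a w * Complex.exp (Complex.I * (β w + b w * s : ℝ)))
      (∫ w, mulI b a w * Complex.exp (Complex.I * (β w + b w * s : ℝ))) s := by
  have h1 := ha.cont
  have h2 := ha.mulI hb hbC
  have h3 := h2.cont
  refine (hasDerivAt_integral_of_dominated_loc_of_deriv_le (s := univ)
    (F := fun (s : ℝ) w => a w * Complex.exp (Complex.I * (β w + b w * s : ℝ)))
    (F' := fun (s : ℝ) w => mulI b a w * Complex.exp (Complex.I * (β w + b w * s : ℝ)))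
    (bound := fun w => ‖mulI b a w‖) univ_mem
    (Eventually.of_forall fun s => Continuous.aestronglyMeasurable (by fun_prop)) ?_
    (Continuous.aestronglyMeasurable (by fun_prop))
    (Eventually.of_forall fun w s _ => ?_) h2.integrable.norm
    (Eventually.of_forall fun w s _ => ?_)).2
  · refine ha.integrable.norm.mono' (Continuous.aestronglyMeasurable (by fun_prop))
      (Eventually.of_forall fun w => ?_)
    rw [norm_mul, norm_exp_I_mul, mul_one]
  · rw [norm_mul, norm_exp_I_mul, mul_one]
  · have h4 : HasDerivAt (fun s : ℝ => β w + b w * s) (b w) s := by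
      simpa using ((hasDerivAt_id s).const_mul (b w)).const_add (β w)
    refine ((h4.ofReal_comp.const_mul Complex.I).cexp.const_mul (a w)).congr_deriv ?_
    unfold mulI
    ring

theorem hasDerivAt_planeWaves_x {a : EuclideanSpace ℝ (Fin 2) → ℂ} (ha : RapidlyIntegrable a)
    (x y t : ℝ) : HasDerivAt (fun s => planeWaves a s y t) (planeWaves (mulI freqX a) x y t) x := by
  have hX := continuous_freqX
  have hY := continuous_freqY
  have hT := continuous_freqT
  have h := hasDerivAt_integral_exp (β := fun w => freqY w * y + freqT w * t) ha hX
    (by fun_prop) abs_freqX_le x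
  have e : ∀ (w : EuclideanSpace ℝ (Fin 2)) (s : ℝ), freqY w * y + freqT w * t + freqX w * s =
      freqX w * s + freqY w * y + freqT w * t := fun w s => by ring
  simp only [e] at h
  exact h

theorem hasDerivAt_planeWaves_y {a : EuclideanSpace ℝ (Fin 2) → ℂ} (ha : RapidlyIntegrable a)
    (x y t : ℝ) : HasDerivAt (fun s => planeWaves a x s t) (planeWaves (mulI freqY a) x y t) y := by
  have hX := continuous_freqX
  have hY := continuous_freqY
  have hT := continuous_freqT
  have h := hasDerivAt_integral_exp (β := fun w => freqX w * x + freqT w * t) ha hY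
    (by fun_prop) abs_freqY_le y
  have e : ∀ (w : EuclideanSpace ℝ (Fin 2)) (s : ℝ), freqX w * x + freqT w * t + freqY w * s =
      freqX w * x + freqY w * s + freqT w * t := fun w s => by ring
  simp only [e] at h
  exact h

theorem hasDerivAt_planeWaves_t {a : EuclideanSpace ℝ (Fin 2) → ℂ} (ha : RapidlyIntegrable a)
    (x y t : ℝ) : HasDerivAt (fun s => planeWaves a x y s) (planeWaves (mulI freqT a) x y t) t := by
  have hX := continuous_freqX
  have hY := continuous_freqY
  have hT := continuous_freqT
  exact hasDerivAt_integral_exp (β := fun w => freqX w * x + freqY w * y) ha hT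
    (by fun_prop) abs_freqT_le t

theorem HasDerivAt.complex_re {f : ℝ → ℂ} {f' : ℂ} {x : ℝ} (h : HasDerivAt f f' x) :
    HasDerivAt (fun s => (f s).re) f'.re x :=
  Complex.reCLM.hasFDerivAt.comp_hasDerivAt x h

theorem mulI_comm (b b' : EuclideanSpace ℝ (Fin 2) → ℝ) (a : EuclideanSpace ℝ (Fin 2) → ℂ) :
    mulI b (mulI b' a) = mulI b' (mulI b a) := by
  funext w
  unfold mulI
  ring

theorem planeWaves_tt {a : EuclideanSpace ℝ (Fin 2) → ℂ} (ha : RapidlyIntegrable a) (x y t : ℝ) :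
    planeWaves (mulI freqT (mulI freqT a)) x y t =
      planeWaves (mulI freqX (mulI freqX a)) x y t +
        planeWaves (mulI freqY (mulI freqY a)) x y t := by
  have hX := continuous_freqX
  have hY := continuous_freqY
  have hT := continuous_freqT
  have hint : ∀ {b : EuclideanSpace ℝ (Fin 2) → ℂ}, RapidlyIntegrable b → Integrable fun w =>
      b w * Complex.exp (Complex.I * (freqX w * x + freqY w * y + freqT w * t : ℝ)) := by
    intro b hb
    have := hb.cont
    refine hb.integrable.norm.mono' (Continuous.aestronglyMeasurable (by fun_prop))
      (Eventually.of_forall fun w => ?_)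
    rw [norm_mul, norm_exp_I_mul, mul_one]
  unfold planeWaves
  rw [← integral_add (hint ((ha.mulI hX abs_freqX_le).mulI hX abs_freqX_le))
    (hint ((ha.mulI hY abs_freqY_le).mulI hY abs_freqY_le))]
  refine integral_congr_ae (Eventually.of_forall fun w => ?_)
  have h : (freqT w : ℂ) ^ 2 = freqX w ^ 2 + freqY w ^ 2 := by exact_mod_cast freqT_sq w
  simp only [mulI]
  linear_combination (Complex.I ^ 2 * a w *
    Complex.exp (Complex.I * (freqX w * x + freqY w * y + freqT w * t : ℝ))) * h

theorem waveGrad_planeWaves {a : EuclideanSpace ℝ (Fin 2) → ℂ} (ha : RapidlyIntegrable a) :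
    WaveGrad (fun x y t => (planeWaves (mulI freqX a) x y t).re)
      (fun x y t => (planeWaves (mulI freqY a) x y t).re)
      (fun x y t => (planeWaves (mulI freqT a) x y t).re)
      (fun x y t => (planeWaves (mulI freqX (mulI freqX a)) x y t).re)
      (fun x y t => (planeWaves (mulI freqY (mulI freqY a)) x y t).re)
      (fun x y t => (planeWaves (mulI freqT (mulI freqX a)) x y t).re)
      (fun x y t => (planeWaves (mulI freqT (mulI freqY a)) x y t).re) := by
  have hX := ha.mulI continuous_freqX abs_freqX_le
  have hY := ha.mulI continuous_freqY abs_freqY_le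
  have hT := ha.mulI continuous_freqT abs_freqT_le
  have hre := Complex.continuous_re
  exact
  { cx := hre.comp (continuous_planeWaves hX)
    cy := hre.comp (continuous_planeWaves hY)
    ct := hre.comp (continuous_planeWaves hT)
    cxx := hre.comp (continuous_planeWaves (hX.mulI continuous_freqX abs_freqX_le))
    cyy := hre.comp (continuous_planeWaves (hY.mulI continuous_freqY abs_freqY_le))
    cxt := hre.comp (continuous_planeWaves (hX.mulI continuous_freqT abs_freqT_le))
    cyt := hre.comp (continuous_planeWaves (hY.mulI continuous_freqT abs_freqT_le))
    x_x := fun x y t => HasDerivAt.complex_re (hasDerivAt_planeWaves_x hX x y t)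
    y_y := fun x y t => HasDerivAt.complex_re (hasDerivAt_planeWaves_y hY x y t)
    x_t := fun x y t => HasDerivAt.complex_re (hasDerivAt_planeWaves_t hX x y t)
    t_x := fun x y t => by
      rw [mulI_comm]
      exact HasDerivAt.complex_re (hasDerivAt_planeWaves_x hT x y t)
    y_t := fun x y t => HasDerivAt.complex_re (hasDerivAt_planeWaves_t hY x y t)
    t_y := fun x y t => by
      rw [mulI_comm]
      exact HasDerivAt.complex_re (hasDerivAt_planeWaves_y hT x y t)
    t_t := fun x y t => by
      rw [← Complex.add_re, ← planeWaves_tt ha]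
      exact HasDerivAt.complex_re (hasDerivAt_planeWaves_t hT x y t) }

/-- Smooth initial data coincide on a disc with a superposition of plane waves. -/
theorem exists_planeWaves_initial {f : ℝ × ℝ → ℝ} (hf : ContDiff ℝ ∞ f) {R : ℝ} (hR : 0 < R) :
    ∃ a : EuclideanSpace ℝ (Fin 2) → ℂ, RapidlyIntegrable a ∧
      ∀ x y : ℝ, x ^ 2 + y ^ 2 < R ^ 2 → (f (x, y) : ℂ) = planeWaves a x y 0 := by
  -- The bump is 1 on the disc of radius R and has compact support, so the data become a Schwartz
  -- function; the Fourier transform then has all moments, and the inversion formula recovers f on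
  -- the disc.
  let b : ContDiffBump (0 : EuclideanSpace ℝ (Fin 2)) := ⟨R, 2 * R, hR, by linarith⟩
  let φ : EuclideanSpace ℝ (Fin 2) → ℂ := fun v => ((b v * f (v 0, v 1) : ℝ) : ℂ)
  have hφs : ContDiff ℝ ∞ φ := by
    refine Complex.ofRealCLM.contDiff.comp (b.contDiff.mul (hf.comp ?_))
    fun_prop
  have hφc : HasCompactSupport φ := by
    have h1 : HasCompactSupport fun v => b v * f (v 0, v 1) := b.hasCompactSupport.mul_right
    exact h1.comp_left (g := fun r : ℝ => (r : ℂ)) Complex.ofReal_zero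
  let Φ := hφc.toSchwartzMap hφs
  refine ⟨FourierTransform.fourier Φ, ⟨(FourierTransform.fourier Φ).continuous, fun k =>
    (FourierTransform.fourier Φ).integrable_pow_mul volume k⟩, fun x y hxy => ?_⟩
  have h1 : FourierTransformInv.fourierInv (FourierTransform.fourier Φ) = Φ :=
    FourierTransform.fourierInv_fourier_eq Φ
  have h2 := congrArg (fun g : SchwartzMap (EuclideanSpace ℝ (Fin 2)) ℂ => g !₂[x, y]) h1
  simp only [SchwartzMap.fourierInv_coe] at h2
  have h3 : Φ !₂[x, y] = (f (x, y) : ℂ) := by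
    have h4 : b !₂[x, y] = 1 := by
      refine b.one_of_mem_closedBall ?_
      rw [mem_closedBall_zero_iff]
      refine le_of_sq_le_sq ?_ hR.le
      rw [EuclideanSpace.norm_sq_eq, Fin.sum_univ_two]
      simpa using hxy.le
    change ((b !₂[x, y] * f (x, y) : ℝ) : ℂ) = _
    rw [h4, one_mul]
  rw [← h3, ← h2, Real.fourierInv_eq']
  refine integral_congr_ae (Eventually.of_forall fun w => ?_)
  simp only [smul_eq_mul]
  rw [mul_comm]
  congr 2
  simp only [PiLp.inner_apply, Fin.sum_univ_two, freqX, freqY]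
  simp
  ring

/-- The time-symmetrized solution agrees with a superposition of plane waves in a cone. -/
theorem exists_planeWaves_rep {W : ℝ × ℝ × ℝ → ℝ} (hW : ContDiff ℝ ∞ W)
    (hw : ∀ p, pd et (pd et W) p = pd ex (pd ex W) p + pd ey (pd ey W) p) (x₀ t₀ : ℝ) {R : ℝ}
    (hR : 0 < R) :
    ∃ a : EuclideanSpace ℝ (Fin 2) → ℂ, RapidlyIntegrable a ∧
      (∀ x y : ℝ, x ^ 2 + y ^ 2 < R ^ 2 → (W (x₀ + x, y, t₀) : ℂ) = planeWaves a x y 0) ∧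
      ∀ x y t : ℝ, |t| < R → x ^ 2 + y ^ 2 < (R - |t|) ^ 2 →
        (pd ey W (x₀ + x, y, t₀ + t) + pd ey W (x₀ + x, y, t₀ - t)) / 2 =
          ((planeWaves (mulI freqY a) x y t + planeWaves (mulI freqY a) x y (-t)) / 2).re := by
  obtain ⟨a, ha, hinit⟩ := exists_planeWaves_initial (f := fun p => W (x₀ + p.1, p.2, t₀))
    (hW.comp (by fun_prop)) hR
  refine ⟨a, ha, hinit, ?_⟩
  have g1 := (waveGrad_of_contDiff hW hw).translate x₀ t₀
  have g2 := waveGrad_planeWaves ha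
  -- Only the value at time 0 of the plane waves is matched, not their velocity. After averaging
  -- with the time reversal both velocities vanish at time 0, so the difference has zero gradient on
  -- the initial disc.
  have g := (g1.half_add g1.reverse).sub (g2.half_add g2.reverse)
  have hinit' : ∀ x y : ℝ, x ^ 2 + y ^ 2 < R ^ 2 → (planeWaves a x y 0).re = W (x₀ + x, y, t₀) := by
    intro x y hxy
    rw [← hinit x y hxy, Complex.ofReal_re]
  have hz := fun (x y t : ℝ) (ht : 0 ≤ t) => g.eq_zero (R := R) (x := x) (y := y) (t := t) (by
    intro x y hxy
    have hnx : ∀ᶠ s in 𝓝 x, s ^ 2 + y ^ 2 < R ^ 2 :=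
      (isOpen_lt (by fun_prop) continuous_const).mem_nhds hxy
    have hny : ∀ᶠ s in 𝓝 y, x ^ 2 + s ^ 2 < R ^ 2 :=
      (isOpen_lt (by fun_prop) continuous_const).mem_nhds hxy
    have ex1 : (planeWaves (mulI freqX a) x y 0).re = pd ex W (x₀ + x, y, t₀) := by
      refine (HasDerivAt.complex_re (hasDerivAt_planeWaves_x ha x y 0)).unique ?_
      refine HasDerivAt.congr_of_eventuallyEq ?_ (hnx.mono fun s hs => hinit' s y hs)
      exact (hasDerivAt_pd hW (hasDerivAt_line_x (x₀ + x) y t₀)).comp_const_add x₀ x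
    have ey1 : (planeWaves (mulI freqY a) x y 0).re = pd ey W (x₀ + x, y, t₀) := by
      refine (HasDerivAt.complex_re (hasDerivAt_planeWaves_y ha x y 0)).unique ?_
      refine HasDerivAt.congr_of_eventuallyEq ?_ (hny.mono fun s hs => hinit' x s hs)
      exact hasDerivAt_pd hW (hasDerivAt_line_y (x₀ + x) y t₀)
    simp [ex1, ey1]) ht
  have key : ∀ x y t : ℝ, 0 ≤ t → t < R → x ^ 2 + y ^ 2 < (R - t) ^ 2 →
        (pd ey W (x₀ + x, y, t₀ + t) + pd ey W (x₀ + x, y, t₀ - t)) / 2 =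
          ((planeWaves (mulI freqY a) x y t + planeWaves (mulI freqY a) x y (-t)) / 2).re := by
    intro x y t ht htR hxy
    have h := (hz x y t ht htR hxy).2.1
    simp only [Pi.sub_apply] at h
    have e : ∀ z : ℂ, (z / 2).re = z.re / 2 := fun z => Complex.div_ofNat_re z 2
    rw [e, Complex.add_re, sub_eq_add_neg t₀ t]
    linarith
  intro x y t ht hxy
  rcases le_total 0 t with h | h
  · rw [abs_of_nonneg h] at ht hxy
    exact key x y t h ht hxy
  · rw [abs_of_nonpos h] at ht hxy
    have := key x y (-t) (by linarith) ht hxy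
    rw [neg_neg, sub_neg_eq_add, ← sub_eq_add_neg, add_comm (pd ey W _)] at this
    rw [this, add_comm (planeWaves (mulI freqY a) x y (-t))]

/-! ### The set of boundary points -/

theorem mem_U_zero {c ε y₀ : ℝ} {p : ℝ × ℝ} :
    p ∈ U c ε 0 y₀ 0 ↔ |p.1| ≤ D c √(y₀ ^ 2 - p.2 ^ 2) + ε ∧ |p.2| ≤ y₀ := by
  simp [U]

theorem mem_U_iff {c ε x₀ y₀ t₀ : ℝ} {p : ℝ × ℝ} :
    p ∈ U c ε x₀ y₀ t₀ ↔ p - (x₀, t₀) ∈ U c ε 0 y₀ 0 := by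
  simp [U]

theorem D_nonneg {c z : ℝ} (hz : 0 ≤ z) : 0 ≤ D c z := mul_nonneg hz (sqrt_nonneg _)

theorem D_sq_mul {c z : ℝ} (hc : 0 < c) (hz : 0 ≤ z) : D c z ^ 2 * (c + 2 * z) = c * z ^ 2 := by
  unfold D
  rw [mul_pow, sq_sqrt (by positivity)]
  field_simp

theorem D_le_self {c z : ℝ} (hc : 0 < c) (hz : 0 ≤ z) : D c z ≤ z := by
  refine mul_le_of_le_one_right hz (sqrt_le_one.2 ?_)
  rw [div_le_one (by linarith)]
  linarith

theorem sqrt_sq_sub_sq_le {y t : ℝ} (hy : 0 ≤ y) : √(y ^ 2 - t ^ 2) ≤ y := by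
  rw [sqrt_le_left hy]
  linarith [sq_nonneg t]

theorem abs_fst_le_of_mem_U {c ε y₀ : ℝ} (hc : 0 < c) (hy₀ : 0 ≤ y₀) {p : ℝ × ℝ}
    (hp : p ∈ U c ε 0 y₀ 0) : |p.1| ≤ y₀ + ε :=
  (mem_U_zero.1 hp).1.trans (add_le_add_left
    ((D_le_self hc (sqrt_nonneg _)).trans (sqrt_sq_sub_sq_le hy₀)) ε)

theorem isClosed_U_zero {c : ℝ} (hc : 0 < c) (ε y₀ : ℝ) : IsClosed (U c ε 0 y₀ 0) := by
  have h1 : Continuous fun p : ℝ × ℝ => D c √(y₀ ^ 2 - p.2 ^ 2) + ε := by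
    unfold D
    refine Continuous.add (Continuous.mul (by fun_prop) (Continuous.sqrt
      (continuous_const.div (by fun_prop) fun p => ?_))) continuous_const
    positivity
  have h2 : U c ε 0 y₀ 0 = {p : ℝ × ℝ | |p.1| ≤ D c √(y₀ ^ 2 - p.2 ^ 2) + ε} ∩
      {p : ℝ × ℝ | |p.2| ≤ y₀} := by
    ext p
    exact mem_U_zero
  rw [h2]
  exact (isClosed_le (by fun_prop) h1).inter (isClosed_le (by fun_prop) continuous_const)

theorem U_zero_subset_box {c ε y₀ R : ℝ} (hc : 0 < c) (hy₀ : 0 ≤ y₀) (hR : y₀ + ε ≤ R) :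
    U c ε 0 y₀ 0 ⊆ Icc (-R) R ×ˢ Icc (-y₀) y₀ := fun _ hp =>
  ⟨abs_le.1 ((abs_fst_le_of_mem_U hc hy₀ hp).trans hR), abs_le.1 (mem_U_zero.1 hp).2⟩

theorem isCompact_U_zero {c : ℝ} (hc : 0 < c) (ε : ℝ) {y₀ : ℝ} (hy₀ : 0 ≤ y₀) :
    IsCompact (U c ε 0 y₀ 0) :=
  (isCompact_Icc.prod isCompact_Icc).of_isClosed_subset (isClosed_U_zero hc ε y₀)
    (U_zero_subset_box hc hy₀ le_rfl)

theorem isCompact_U {c : ℝ} (hc : 0 < c) (ε x₀ t₀ : ℝ) {y₀ : ℝ} (hy₀ : 0 ≤ y₀) :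
    IsCompact (U c ε x₀ y₀ t₀) := by
  have h : U c ε x₀ y₀ t₀ = (Homeomorph.addRight (x₀, t₀)) '' (U c ε 0 y₀ 0) := by
    ext p
    rw [mem_U_iff, Homeomorph.image_eq_preimage_symm, sub_eq_add_neg]
    rfl
  rw [h]
  exact (isCompact_U_zero hc ε hy₀).image (Homeomorph.continuous _)

theorem U_thin (x₀ y₀ t₀ : ℝ) (hy₀ : 0 < y₀) {δ : ℝ} (hδ : 0 < δ) : ∃ η : ℝ, 0 < η ∧
    ∀ c ε : ℝ, 0 < c → c < η → 0 < ε → ε < η →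
      U c ε x₀ y₀ t₀ ⊆ {p | |p.1 - x₀| ≤ δ ∧ |p.2 - t₀| ≤ y₀} := by
  -- The bound D(z)² = cz²/(c + 2z) ≤ cy₀/2 makes D at most δ/2 for c < δ²/(2y₀); the other half of
  -- δ is left for ε.
  refine ⟨min (δ / 2) (δ ^ 2 / (2 * y₀)), by positivity, ?_⟩
  rintro c ε hc hcη _ hεη p ⟨hp1, hp2⟩
  refine ⟨hp1.trans ?_, hp2⟩
  have h1 : ε < δ / 2 := hεη.trans_le (min_le_left _ _)
  have h2 : c < δ ^ 2 / (2 * y₀) := hcη.trans_le (min_le_right _ _)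
  rw [lt_div_iff₀ (by positivity)] at h2
  set z := √(y₀ ^ 2 - (p.2 - t₀) ^ 2)
  have hz : 0 ≤ z := sqrt_nonneg _
  have hzy : z ≤ y₀ := sqrt_sq_sub_sq_le hy₀.le
  have h3 := D_sq_mul hc hz
  have h4 : D c z ^ 2 ≤ (δ / 2) ^ 2 := by
    have h5 : D c z ^ 2 * (c + 2 * z) ≤ (δ / 2) ^ 2 * (c + 2 * z) := by
      rw [h3]
      have h6 : c * z ≤ c * y₀ := by gcongr
      nlinarith [mul_le_mul_of_nonneg_right h6 hz, sq_nonneg δ,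
        mul_nonneg (sub_nonneg.2 h2.le) hz, mul_nonneg (sq_nonneg δ) hc.le]
    exact le_of_mul_le_mul_right h5 (by linarith)
  have := le_of_sq_le_sq h4 (by positivity)
  linarith

/-! ### Smallness of the kernel outside the set -/

/-- D is increasing, so a point beyond D(z) is beyond D(σ) for each σ ≤ z occurring in the kernel;
(D + ε)² ≥ D² + ε² then leaves the margin cε². -/
theorem quadratic_ge_of_far {c ε z σ x : ℝ} (hc : 0 < c) (hε : 0 < ε) (hσ : 0 ≤ σ) (hσz : σ ≤ z)
    (hx : D c z + ε ≤ |x|) : c * ε ^ 2 ≤ x ^ 2 * (c + 2 * σ) - c * σ ^ 2 := by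
  have hz : 0 ≤ z := hσ.trans hσz
  have hD := D_nonneg (c := c) hz
  have h1 : D c z ^ 2 + ε ^ 2 ≤ x ^ 2 := by
    rw [← sq_abs x]
    nlinarith
  have h2 : c * σ ^ 2 ≤ D c z ^ 2 * (c + 2 * σ) := by
    have h3 := D_sq_mul hc hz
    have h4 : σ ^ 2 * (c + 2 * z) ≤ z ^ 2 * (c + 2 * σ) := by
      have e1 : σ ^ 2 ≤ z ^ 2 := pow_le_pow_left₀ hσ hσz 2
      have e2 : σ ^ 2 * z ≤ z ^ 2 * σ := by nlinarith [mul_nonneg hσ hz]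
      nlinarith
    have h5 : c * σ ^ 2 * (c + 2 * z) ≤ D c z ^ 2 * (c + 2 * σ) * (c + 2 * z) := by
      calc _ = c * (σ ^ 2 * (c + 2 * z)) := by ring
        _ ≤ c * (z ^ 2 * (c + 2 * σ)) := by gcongr
        _ = (c * z ^ 2) * (c + 2 * σ) := by ring
        _ = _ := by rw [← h3]; ring
    exact le_of_mul_le_mul_right h5 (by linarith)
  have h6 : (D c z ^ 2 + ε ^ 2) * (c + 2 * σ) ≤ x ^ 2 * (c + 2 * σ) := by gcongr
  nlinarith [mul_nonneg (sq_nonneg ε) hσ]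

theorem abs_K_le_of_far {c ε y₀ R : ℝ} (hc : 0 < c) (hε : 0 < ε) (hR : 0 < R) :
    ∃ C : ℝ, 0 ≤ C ∧ ∀ h : ℝ, 0 < h → ∀ p : ℝ × ℝ, |p.1| ≤ R →
      D c √(y₀ ^ 2 - p.2 ^ 2) + ε ≤ |p.1| → |K c h p.1 y₀ p.2| ≤ C * √h := by
  set a : ℝ := c * ε ^ 2 / (4 * (c ^ 2 + R ^ 2)) with ha
  refine ⟨1 / (2 * (π * √π)) * (1 / √c * (π / 2)) / a, by positivity, ?_⟩
  rintro h hh ⟨x, t⟩ hxR hx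
  simp only at hxR hx
  have hk : ∀ s ∈ uIoc 0 (π / 2), ‖kern c h (√(y₀ ^ 2 - t ^ 2) * sin s) x‖ ≤
      1 / √c * (h / a) := by
    intro s hs
    rw [uIoc_of_le (by positivity)] at hs
    refine norm_kern_le_of_exp_le hc ?_
    rw [norm_kern_exp hc hh]
    have hsin : 0 ≤ sin s := sin_nonneg_of_nonneg_of_le_pi hs.1.le (by linarith [hs.2, pi_pos])
    have hq := quadratic_ge_of_far hc hε (z := √(y₀ ^ 2 - t ^ 2))
      (σ := √(y₀ ^ 2 - t ^ 2) * sin s) (by positivity)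
      (mul_le_of_le_one_right (sqrt_nonneg _) (sin_le_one s)) hx
    set σ := √(y₀ ^ 2 - t ^ 2) * sin s
    have hx2 : x ^ 2 ≤ R ^ 2 := sq_le_sq' (abs_le.1 hxR).1 (abs_le.1 hxR).2
    have h1 : a / h ≤ (x ^ 2 * (c + 2 * σ) - c * σ ^ 2) / (4 * h * (c ^ 2 + x ^ 2)) := by
      have e : a / h = c * ε ^ 2 / (4 * h * (c ^ 2 + R ^ 2)) := by
        rw [ha]; field_simp
      rw [e]
      gcongr
      exact le_trans (by positivity) hq
    calc _ ≤ exp (-(a / h)) := exp_le_exp.2 (neg_le_neg h1)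
      -- This weak form of the exponential decay suffices: it absorbs the factor 1/√h of the kernel
      -- and leaves √h.
      _ ≤ h / a := by
        rw [exp_neg, ← inv_div a h]
        exact inv_anti₀ (by positivity) (by linarith [add_one_le_exp (a / h)])
  have hn := intervalIntegral.norm_integral_le_of_norm_le_const hk
  rw [sub_zero, abs_of_pos (by positivity)] at hn
  rw [K_eq, abs_mul, abs_of_nonneg (kernConst_nonneg h)]
  calc kernConst h * |(cKern c h y₀ t x).re| ≤ kernConst h * (1 / √c * (h / a) * (π / 2)) :=
        mul_le_mul_of_nonneg_left ((Complex.abs_re_le_norm _).trans hn) (kernConst_nonneg h)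
    _ = _ := by
        rw [← kernConst_mul_sqrt hh]
        have : h = √h * √h := (mul_self_sqrt hh.le).symm
        nth_rewrite 2 [this]
        ring

theorem K_neg (c h x y t : ℝ) : K c h x y (-t) = K c h x y t := by
  unfold K
  rw [neg_sq]

theorem tendsto_integral_box_diff {c ε y₀ R : ℝ} (hc : 0 < c) (hε : 0 < ε) (hy₀ : 0 < y₀)
    (hR : y₀ + ε ≤ R) {g : ℝ × ℝ → ℝ} (hg : Continuous g) :
    Tendsto (fun h : ℝ => (∫ p in Icc (-R) R ×ˢ Icc (-y₀) y₀, K c h p.1 y₀ p.2 * g p) -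
      ∫ p in U c ε 0 y₀ 0, K c h p.1 y₀ p.2 * g p) (𝓝[>] 0) (𝓝 0) := by
  have hR0 : 0 < R := by linarith
  obtain ⟨C, hC0, hC⟩ := abs_K_le_of_far (y₀ := y₀) hc hε hR0
  set Q : Set (ℝ × ℝ) := Icc (-R) R ×ˢ Icc (-y₀) y₀ with hQ
  have hQc : IsCompact Q := isCompact_Icc.prod isCompact_Icc
  obtain ⟨M, hM⟩ := hQc.exists_bound_of_continuousOn hg.continuousOn
  have hlim : Tendsto (fun h : ℝ => C * √h * M * (volume (Q \ U c ε 0 y₀ 0)).toReal)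
      (𝓝[>] 0) (𝓝 0) := by
    have : Tendsto (fun h : ℝ => C * √h * M * (volume (Q \ U c ε 0 y₀ 0)).toReal) (𝓝 0)
        (𝓝 (C * √0 * M * (volume (Q \ U c ε 0 y₀ 0)).toReal)) := Continuous.tendsto (by fun_prop) 0
    rw [sqrt_zero, mul_zero, zero_mul, zero_mul] at this
    exact this.mono_left nhdsWithin_le_nhds
  refine squeeze_zero_norm' ?_ hlim
  filter_upwards [self_mem_nhdsWithin] with h hh
  have hh' : 0 < h := hh
  have hcont : Continuous fun p : ℝ × ℝ => K c h p.1 y₀ p.2 * g p := (continuous_K hc hh' y₀).mul hg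
  rw [← setIntegral_sdiff (isClosed_U_zero hc ε y₀).measurableSet
    (hcont.continuousOn.integrableOn_compact hQc) (U_zero_subset_box hc hy₀.le hR)]
  refine norm_setIntegral_le_of_norm_le_const
    ((measure_mono sdiff_subset).trans_lt hQc.measure_lt_top) (fun p hp => ?_)
  rw [norm_mul]
  have h1 : |p.1| ≤ R := abs_le.2 hp.1.1
  have h2 : |p.2| ≤ y₀ := abs_le.2 hp.1.2
  have h3 : D c √(y₀ ^ 2 - p.2 ^ 2) + ε ≤ |p.1| := by
    by_contra! hlt
    exact hp.2 (mem_U_zero.2 ⟨hlt.le, h2⟩)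
  exact mul_le_mul (hC h hh' p h1 h3) (hM p hp.1) (norm_nonneg _) (by positivity)

/-! ### The kernel applied to superpositions of plane waves -/

theorem continuous_modal {c h : ℝ} (hc : 0 < c) (hh : 0 < h) (y R : ℝ) :
    Continuous fun p : ℝ × ℝ => modal c h y R p.1 p.2 := by
  unfold modal
  refine intervalIntegral.continuous_parametric_intervalIntegral_of_continuous' ?_ _ _
  refine intervalIntegral.continuous_parametric_intervalIntegral_of_continuous'
    (f := fun (p : (ℝ × ℝ) × ℝ) x => (K c h x y p.2 : ℂ) *
      (Complex.exp (Complex.I * (p.1.1 * x : ℝ)) * (cos (p.1.2 * p.2) : ℂ))) ?_ _ _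
  refine Continuous.mul (Complex.continuous_ofReal.comp ?_) (by fun_prop)
  exact (continuous_K hc hh y).comp (f := fun p : ((ℝ × ℝ) × ℝ) × ℝ => (p.2, p.1.2)) (by fun_prop)

theorem planeWaves_time_even {a : EuclideanSpace ℝ (Fin 2) → ℂ} (ha : RapidlyIntegrable a)
    (x t : ℝ) : (planeWaves a x 0 t + planeWaves a x 0 (-t)) / 2 =
      ∫ w, a w * (Complex.exp (Complex.I * (freqX w * x : ℝ)) * (cos (freqT w * t) : ℂ)) := by
  have hX := continuous_freqX
  have hY := continuous_freqY
  have hT := continuous_freqT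
  have hac := ha.cont
  have hint : ∀ t : ℝ, Integrable fun w =>
      a w * Complex.exp (Complex.I * (freqX w * x + freqY w * (0 : ℝ) + freqT w * t : ℝ)) := by
    intro t
    refine ha.integrable.norm.mono' (Continuous.aestronglyMeasurable (by fun_prop))
      (Eventually.of_forall fun w => ?_)
    rw [norm_mul, norm_exp_I_mul, mul_one]
  unfold planeWaves
  rw [← integral_add (hint t) (hint (-t)), ← integral_div]
  refine integral_congr_ae (Eventually.of_forall fun w => ?_)
  simp only
  have e1 : Complex.I * ((freqX w * x + freqY w * (0 : ℝ) + freqT w * t : ℝ) : ℂ) =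
      Complex.I * (freqX w * x : ℝ) + (freqT w * t : ℝ) * Complex.I := by push_cast; ring
  have e2 : Complex.I * ((freqX w * x + freqY w * (0 : ℝ) + freqT w * (-t) : ℝ) : ℂ) =
      Complex.I * (freqX w * x : ℝ) + -(freqT w * t : ℝ) * Complex.I := by push_cast; ring
  rw [e1, e2, Complex.exp_add, Complex.exp_add, Complex.ofReal_cos, Complex.cos]
  ring

theorem setIntegral_box {f : ℝ × ℝ → ℂ} (hf : Continuous f) {R y : ℝ} (hR : 0 ≤ R) (hy : 0 ≤ y) :
    ∫ p in Icc (-R) R ×ˢ Icc (-y) y, f p = ∫ t in -y..y, ∫ x in -R..R, f (x, t) := by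
  have hint : IntegrableOn f (Icc (-R) R ×ˢ Icc (-y) y) (volume.prod volume) :=
    hf.continuousOn.integrableOn_compact (isCompact_Icc.prod isCompact_Icc)
  have h1 : ∫ p in Icc (-R) R ×ˢ Icc (-y) y, f p =
      ∫ x in Icc (-R) R, ∫ t in Icc (-y) y, f (x, t) := setIntegral_prod f hint
  rw [h1, intervalIntegral_swap_of_continuous (f := fun t x => f (x, t))
      (by exact hf.comp continuous_swap),
    intervalIntegral.integral_of_le (by linarith), integral_Icc_eq_integral_Ioc]
  refine integral_congr_ae (Eventually.of_forall fun x => ?_)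
  simp only
  rw [intervalIntegral.integral_of_le (by linarith), integral_Icc_eq_integral_Ioc]

theorem integral_box_planeWaves {a : EuclideanSpace ℝ (Fin 2) → ℂ} (ha : RapidlyIntegrable a)
    {c h y₀ R : ℝ} (hc : 0 < c) (hh : 0 < h) (hy₀ : 0 ≤ y₀) (hR : 0 ≤ R) :
    ∫ p in Icc (-R) R ×ˢ Icc (-y₀) y₀, (K c h p.1 y₀ p.2 : ℂ) *
      ((planeWaves a p.1 0 p.2 + planeWaves a p.1 0 (-p.2)) / 2) =
    ∫ w, a w * modal c h y₀ R (freqX w) (freqT w) := by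
  have hX := continuous_freqX
  have hT := continuous_freqT
  have hac := ha.cont
  have hK := continuous_K hc hh y₀
  have hQc : IsCompact (Icc (-R) R ×ˢ Icc (-y₀) y₀) := isCompact_Icc.prod isCompact_Icc
  simp only [planeWaves_time_even ha, ← integral_const_mul]
  rw [integral_integral_swap]
  · refine integral_congr_ae (Eventually.of_forall fun w => ?_)
    simp only
    have hcw : Continuous fun p : ℝ × ℝ => (K c h p.1 y₀ p.2 : ℂ) *
        (Complex.exp (Complex.I * (freqX w * p.1 : ℝ)) * (cos (freqT w * p.2) : ℂ)) := by
      fun_prop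
    have e : ∀ p : ℝ × ℝ, (K c h p.1 y₀ p.2 : ℂ) * (a w *
        (Complex.exp (Complex.I * (freqX w * p.1 : ℝ)) * (cos (freqT w * p.2) : ℂ))) =
        a w * ((K c h p.1 y₀ p.2 : ℂ) *
        (Complex.exp (Complex.I * (freqX w * p.1 : ℝ)) * (cos (freqT w * p.2) : ℂ))) :=
      fun p => by ring
    simp only [e]
    rw [integral_const_mul, setIntegral_box hcw hR hy₀]
    rfl
  · have h1 : Integrable (fun p : ℝ × ℝ => (K c h p.1 y₀ p.2 : ℂ))
        (volume.restrict (Icc (-R) R ×ˢ Icc (-y₀) y₀)) :=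
      (Complex.continuous_ofReal.comp hK).continuousOn.integrableOn_compact hQc
    refine (h1.mul_prod ha.integrable).norm.mono' ?_ (Eventually.of_forall fun q => ?_)
    · refine Continuous.aestronglyMeasurable ?_
      simp only [Function.uncurry_def]
      fun_prop
    · simp only [Function.uncurry_def]
      rw [norm_mul, norm_mul, norm_mul (K c h q.1.1 y₀ q.1.2 : ℂ)]
      refine mul_le_mul_of_nonneg_left (mul_le_of_le_one_right (norm_nonneg _) ?_) (norm_nonneg _)
      rw [norm_mul, norm_exp_I_mul, one_mul, Complex.norm_real]
      exact abs_cos_le_one _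

theorem sin_sqrt_sq_div (v y : ℝ) : sin (√(v ^ 2) * y) / √(v ^ 2) = sin (v * y) / v := by
  rw [sqrt_sq_eq_abs]
  rcases le_total 0 v with h | h
  · rw [abs_of_nonneg h]
  · rw [abs_of_nonpos h, neg_mul, sin_neg, neg_div_neg_eq]

/-- The odd part of e^{iηy} is i sin(ηy) = iη · sin(ηy)/η, so the amplitude of the normal derivative
meets the limit of the modal integrals. For η = 0 both sides vanish. -/
theorem planeWaves_sub_reflY {a : EuclideanSpace ℝ (Fin 2) → ℂ} (ha : RapidlyIntegrable a) (y : ℝ) :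
    (planeWaves a 0 y 0 - planeWaves a 0 (-y) 0) / 2 =
      ∫ w, mulI freqY a w * ((sin (freqY w * y) / freqY w : ℝ) : ℂ) := by
  have hX := continuous_freqX
  have hY := continuous_freqY
  have hT := continuous_freqT
  have hac := ha.cont
  have hint : ∀ y : ℝ, Integrable fun w => a w * Complex.exp (Complex.I *
      (freqX w * (0 : ℝ) + freqY w * y + freqT w * (0 : ℝ) : ℝ)) := by
    intro t
    refine ha.integrable.norm.mono' (Continuous.aestronglyMeasurable (by fun_prop))
      (Eventually.of_forall fun w => ?_)
    rw [norm_mul, norm_exp_I_mul, mul_one]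
  unfold planeWaves
  rw [← integral_sub (hint y) (hint (-y)), ← integral_div]
  refine integral_congr_ae (Eventually.of_forall fun w => ?_)
  simp only
  have e1 : Complex.I * ((freqX w * (0 : ℝ) + freqY w * y + freqT w * (0 : ℝ) : ℝ) : ℂ) =
      (freqY w * y : ℝ) * Complex.I := by push_cast; ring
  have e2 : Complex.I * ((freqX w * (0 : ℝ) + freqY w * (-y) + freqT w * (0 : ℝ) : ℝ) : ℂ) =
      -(freqY w * y : ℝ) * Complex.I := by push_cast; ring
  rw [e1, e2]
  unfold mulI
  by_cases hw : freqY w = 0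
  · simp [hw]
  · have hw' : (freqY w : ℂ) ≠ 0 := by exact_mod_cast hw
    rw [Complex.ofReal_div, Complex.ofReal_sin, Complex.sin, neg_mul]
    generalize Complex.exp ((freqY w * y : ℝ) * Complex.I) = e₁
    generalize Complex.exp (-((freqY w * y : ℝ) * Complex.I)) = e₂
    field_simp
    linear_combination (a w * (e₁ - e₂)) * Complex.I_sq

/-- Dominated convergence over frequencies. The modal bound requires |ξ| < ρ, which fails only for η
= 0, and there the amplitude iηa vanishes. -/
theorem tendsto_integral_modal {a : EuclideanSpace ℝ (Fin 2) → ℂ} (ha : RapidlyIntegrable a)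
    {c y₀ R : ℝ} (hc : 0 < c) (hy₀ : 0 < y₀) (hR : 2 * (c + y₀) ≤ R) :
    Tendsto (fun h : ℝ => ∫ w, mulI freqY a w * modal c h y₀ R (freqX w) (freqT w)) (𝓝[>] 0)
      (𝓝 ((planeWaves a 0 y₀ 0 - planeWaves a 0 (-y₀) 0) / 2)) := by
  have hX := continuous_freqX
  have hY := continuous_freqY
  have hT := continuous_freqT
  have hb := ha.mulI hY abs_freqY_le
  have hbc := hb.cont
  obtain ⟨C, hC⟩ := modal_bound hc hy₀ hR
  have hlt : ∀ w, freqY w ≠ 0 → |freqX w| < freqT w := by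
    intro w hw
    have h1 := freqT_sq w
    have h2 : 0 < freqY w ^ 2 := by positivity
    refine abs_lt_of_sq_lt_sq (by linarith) ?_
    unfold freqT
    positivity
  rw [planeWaves_sub_reflY ha]
  refine tendsto_integral_filter_of_dominated_convergence (fun w => ‖mulI freqY a w‖ * C) ?_ ?_
    (hb.integrable.norm.mul_const C) (Eventually.of_forall fun w => ?_)
  · filter_upwards [self_mem_nhdsWithin] with h hh
    have hm : Continuous fun w => modal c h y₀ R (freqX w) (freqT w) :=
      (continuous_modal hc hh y₀ R).comp (f := fun w => (freqX w, freqT w)) (hX.prodMk hT)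
    exact (hbc.mul hm).aestronglyMeasurable
  · filter_upwards [Ioc_mem_nhdsGT (zero_lt_one (α := ℝ))] with h hh
    refine Eventually.of_forall fun w => ?_
    by_cases hw : freqY w = 0
    · simp [mulI, hw]
    · rw [norm_mul]
      exact mul_le_mul_of_nonneg_left (hC h _ _ hh.1 hh.2 (hlt w hw)) (norm_nonneg _)
  · by_cases hw : freqY w = 0
    · simp [mulI, hw]
    · have h1 := tendsto_modal hc hy₀ hR (hlt w hw)
      have e : freqT w ^ 2 - freqX w ^ 2 = freqY w ^ 2 := by rw [freqT_sq]; ring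
      rw [e, sin_sqrt_sq_div] at h1
      exact h1.const_mul _

/-! ### The inversion formula -/

theorem integral_U_eq {c ε x₀ y₀ t₀ : ℝ} (h : ℝ) (g : ℝ → ℝ → ℝ) :
    ∫ p in U c ε x₀ y₀ t₀, K c h (p.1 - x₀) y₀ (p.2 - t₀) * g p.1 p.2 =
      ∫ p in U c ε 0 y₀ 0, K c h p.1 y₀ p.2 * g (x₀ + p.1) (t₀ + p.2) := by
  have hpre : U c ε x₀ y₀ t₀ = (fun p : ℝ × ℝ => p - (x₀, t₀)) ⁻¹' (U c ε 0 y₀ 0) := by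
    ext p
    exact mem_U_iff
  have := (measurePreserving_sub_right (volume : Measure (ℝ × ℝ)) (x₀, t₀)).setIntegral_preimage_emb
    (Homeomorph.subRight (x₀, t₀)).measurableEmbedding
    (fun p : ℝ × ℝ => K c h p.1 y₀ p.2 * g (x₀ + p.1) (t₀ + p.2)) (U c ε 0 y₀ 0)
  rw [← this, hpre]
  simp

theorem integral_U_zero_time_symm {c ε y₀ h : ℝ} (g : ℝ → ℝ → ℝ) :
    ∫ p in U c ε 0 y₀ 0, K c h p.1 y₀ p.2 * g p.1 (-p.2) =
      ∫ p in U c ε 0 y₀ 0, K c h p.1 y₀ p.2 * g p.1 p.2 := by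
  have hmp : MeasurePreserving (fun p : ℝ × ℝ => (p.1, -p.2)) volume volume :=
    (MeasurePreserving.id volume).prod (Measure.measurePreserving_neg volume)
  have hpre : (fun p : ℝ × ℝ => (p.1, -p.2)) ⁻¹' (U c ε 0 y₀ 0) = U c ε 0 y₀ 0 := by
    ext p
    simp [mem_U_zero]
  have := hmp.setIntegral_preimage_emb
    ((Homeomorph.refl ℝ).prodCongr (Homeomorph.neg ℝ)).measurableEmbedding
    (fun p : ℝ × ℝ => K c h p.1 y₀ p.2 * g p.1 p.2) (U c ε 0 y₀ 0)
  rw [hpre] at this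
  simpa [K_neg] using this

theorem tendsto_integral_U {u : ℝ → ℝ → ℝ → ℝ} (hu : IsWaveSolution u) (x₀ t₀ : ℝ) {y₀ : ℝ}
    (hy₀ : 0 < y₀) {c ε : ℝ} (hc : 0 < c) (hε : 0 < ε) :
    Tendsto (fun h : ℝ => ∫ p in U c ε x₀ y₀ t₀,
      K c h (p.1 - x₀) y₀ (p.2 - t₀) * normalDeriv u p.1 p.2) (𝓝[>] 0) (𝓝 (u x₀ y₀ t₀)) := by
  set W := oddExt fun p => u p.1 p.2.1 p.2.2 with hWdef
  have hW : ContDiff ℝ ∞ W := hu.halfSol.contDiff_oddExt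
  have hG := (contDiff_pd hW ey).continuous
  -- The first summand serves the modal estimates, the second puts U inside the box. A cone of
  -- radius R + y₀ + 1 contains U, since there |t| ≤ y₀ and |x| ≤ y₀ + ε, and its base contains the
  -- points (0, ±y₀).
  set R : ℝ := 2 * (c + y₀) + ε with hRdef
  obtain ⟨a, ha, hinit, hcone⟩ := exists_planeWaves_rep hW hu.halfSol.wave_oddExt x₀ t₀
    (R := R + y₀ + 1) (by positivity)
  have hb := ha.mulI continuous_freqY abs_freqY_le
  let g : ℝ × ℝ → ℂ := fun p =>
    (planeWaves (mulI freqY a) p.1 0 p.2 + planeWaves (mulI freqY a) p.1 0 (-p.2)) / 2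
  have hpw := continuous_planeWaves hb
  have hgc : Continuous g := ((hpw.comp (f := fun p : ℝ × ℝ => (p.1, (0 : ℝ), p.2))
    (by fun_prop)).add (hpw.comp (f := fun p : ℝ × ℝ => (p.1, (0 : ℝ), -p.2))
    (by fun_prop))).div_const 2
  have hval : ((planeWaves a 0 y₀ 0 - planeWaves a 0 (-y₀) 0) / 2).re = u x₀ y₀ t₀ := by
    have hR1 : (0 : ℝ) ^ 2 + y₀ ^ 2 < (R + y₀ + 1) ^ 2 := by
      rw [zero_pow two_ne_zero, zero_add]
      exact pow_lt_pow_left₀ (by linarith) hy₀.le two_ne_zero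
    rw [← hinit 0 y₀ hR1, ← hinit 0 (-y₀) (by rwa [neg_sq])]
    have h1 : W (x₀ + 0, -y₀, t₀) = -W (x₀ + 0, y₀, t₀) :=
      oddExt_reflY hu.halfSol.boundary (x₀ + 0, y₀, t₀)
    have h2 : W (x₀ + 0, y₀, t₀) = u x₀ y₀ t₀ := by
      rw [add_zero]
      exact oddExt_of_nonneg _ hy₀.le
    rw [h1, h2, ← Complex.ofReal_sub, Complex.div_ofNat_re, Complex.ofReal_re]
    ring
  have hbox : Tendsto (fun h : ℝ => ∫ p in Icc (-R) R ×ˢ Icc (-y₀) y₀,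
      K c h p.1 y₀ p.2 * (g p).re) (𝓝[>] 0) (𝓝 (u x₀ y₀ t₀)) := by
    rw [← hval]
    refine ((Complex.continuous_re.tendsto _).comp
      (tendsto_integral_modal ha hc hy₀ (R := R) (by linarith))).congr' ?_
    filter_upwards [self_mem_nhdsWithin] with h hh
    rw [Function.comp_apply, ← integral_box_planeWaves hb hc hh hy₀.le (by positivity)]
    have hint : IntegrableOn (fun p : ℝ × ℝ => (K c h p.1 y₀ p.2 : ℂ) * g p)
        (Icc (-R) R ×ˢ Icc (-y₀) y₀) :=
      ((Complex.continuous_ofReal.comp (continuous_K hc hh y₀)).mul hgc).continuousOn.integrableOn_compact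
        (isCompact_Icc.prod isCompact_Icc)
    have h1 := Complex.reCLM.integral_comp_comm hint
    simp only [Complex.reCLM_apply, Complex.re_ofReal_mul] at h1
    exact h1.symm
  -- The box carries the plane-wave data only. Once the box is cut down to U, these data equal the
  -- time-even part of the true normal derivative, so u is not needed outside U.
  have hdiff := tendsto_integral_box_diff hc hε hy₀ (R := R) (by linarith)
    (show Continuous fun p => (g p).re from Complex.continuous_re.comp hgc)
  have hlim := hbox.sub hdiff
  rw [sub_zero] at hlim
  refine hlim.congr' ?_
  filter_upwards [self_mem_nhdsWithin] with h hh
  have hUc := isCompact_U_zero hc ε hy₀.le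
  have hKc := continuous_K hc hh y₀
  have i1 : IntegrableOn (fun p : ℝ × ℝ => K c h p.1 y₀ p.2 * pd ey W (x₀ + p.1, 0, t₀ + p.2))
      (U c ε 0 y₀ 0) :=
    (hKc.mul (hG.comp (f := fun p : ℝ × ℝ => (x₀ + p.1, (0 : ℝ), t₀ + p.2))
      (by fun_prop))).continuousOn.integrableOn_compact hUc
  have i2 : IntegrableOn (fun p : ℝ × ℝ => K c h p.1 y₀ p.2 * pd ey W (x₀ + p.1, 0, t₀ + -p.2))
      (U c ε 0 y₀ 0) :=
    (hKc.mul (hG.comp (f := fun p : ℝ × ℝ => (x₀ + p.1, (0 : ℝ), t₀ + -p.2))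
      (by fun_prop))).continuousOn.integrableOn_compact hUc
  rw [integral_U_eq, sub_sub_cancel]
  simp only [hu.normalDeriv_eq]
  have hsym := integral_U_zero_time_symm (c := c) (ε := ε) (y₀ := y₀) (h := h)
    (fun x t => pd ey W (x₀ + x, 0, t₀ + t))
  -- Since K and U are even in time, replacing the data by their time-even part does not change the
  -- integral.
  have havg : ∫ p in U c ε 0 y₀ 0, K c h p.1 y₀ p.2 * pd ey W (x₀ + p.1, 0, t₀ + p.2) =
      ∫ p in U c ε 0 y₀ 0, (K c h p.1 y₀ p.2 * pd ey W (x₀ + p.1, 0, t₀ + p.2) +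
        K c h p.1 y₀ p.2 * pd ey W (x₀ + p.1, 0, t₀ + -p.2)) / 2 := by
    rw [integral_div, integral_add i1 i2, hsym]
    ring
  rw [havg]
  refine setIntegral_congr_fun (isClosed_U_zero hc ε y₀).measurableSet fun p hp => ?_
  have hp1 := abs_fst_le_of_mem_U hc hy₀.le hp
  have hp2 := (mem_U_zero.1 hp).2
  have hc1 := hcone p.1 0 p.2 (by linarith) (by
    rw [zero_pow two_ne_zero, add_zero, ← sq_abs p.1]
    exact pow_lt_pow_left₀ (by linarith) (abs_nonneg _) two_ne_zero)
  simp only [g]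
  rw [← hc1, sub_eq_add_neg]
  ring

end WaveCauchy
end

theorem mainTheorem1 (u : ℝ → ℝ → ℝ → ℝ) (hu : WaveCauchy.IsWaveSolution u)
    (x₀ y₀ t₀ : ℝ) (hy₀ : 0 < y₀) :
    (∀ c ε : ℝ, 0 < c → 0 < ε →
      (∀ h : ℝ, 0 < h →
        IntegrableOn (fun p : ℝ × ℝ =>
          WaveCauchy.K c h (p.1 - x₀) y₀ (p.2 - t₀) * WaveCauchy.normalDeriv u p.1 p.2)
          (WaveCauchy.U c ε x₀ y₀ t₀)) ∧
      Tendsto (fun h : ℝ => ∫ p in WaveCauchy.U c ε x₀ y₀ t₀,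
          WaveCauchy.K c h (p.1 - x₀) y₀ (p.2 - t₀) * WaveCauchy.normalDeriv u p.1 p.2)
        (𝓝[>] 0) (𝓝 (u x₀ y₀ t₀))) ∧
    (∀ δ : ℝ, 0 < δ → ∃ η : ℝ, 0 < η ∧ ∀ c ε : ℝ, 0 < c → c < η → 0 < ε → ε < η →
      WaveCauchy.U c ε x₀ y₀ t₀ ⊆ {p | |p.1 - x₀| ≤ δ ∧ |p.2 - t₀| ≤ y₀}) := by
  refine ⟨fun c ε hc hε => ⟨fun h hh => ?_, WaveCauchy.tendsto_integral_U hu x₀ t₀ hy₀ hc hε⟩,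
    fun δ hδ => WaveCauchy.U_thin x₀ y₀ t₀ hy₀ hδ⟩
  refine ContinuousOn.integrableOn_compact (WaveCauchy.isCompact_U hc ε x₀ t₀ hy₀.le)
    (Continuous.continuousOn ?_)
  simp only [hu.normalDeriv_eq]
  exact ((WaveCauchy.continuous_K hc hh y₀).comp
    (f := fun p : ℝ × ℝ => (p.1 - x₀, p.2 - t₀)) (by fun_prop)).mul
    ((WaveCauchy.contDiff_pd hu.halfSol.contDiff_oddExt WaveCauchy.ey).continuous.comp
      (f := fun p : ℝ × ℝ => (p.1, (0 : ℝ), p.2)) (by fun_prop))
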